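/- **Definitions.** Let $A$ be a set of $m$ alternatives. A preference is a complete order on $A$; $\mathrm{pos}(a,\succ)$ is the position of $a$ in $\succ$, counted from the top. For preferences $\succ,\succ'$ on $A$ let - $d_{\mathrm{swap}}(\succ,\succ')$ be the number of unordered pairs of alternatives that $\succ$ and $\succ'$ order differently, - $d_{\mathrm{foot}}(\succ,\succ')=\sum_{a\in A}|\mathrm{pos}(a,\succ)-\mathrm{pos}(a,\succ')|$ be the footrule distance, - $d_{\max}(\succ,\succ')=\max_{a\in A}|\mathrm{pos}(a,\succ)-\mathrm{pos}(a,\succ')|$ be the maximum displacement distance. For $1\le k\le m-1$, the winners of a profile under $k$-approval are the alternatives that are placed among the first $k$ positions in the largest number of preferences of the profile. For a distance function $d$, an instance of *Local Distance constrained \$bribery* for $k$-approval consists of a set $A$ of $m$ alternatives, an integer $k$ with $1\le k\le m-1$, a profile $(\succ_i)_{i\in[n]}$ of $n\ge 1$ preferences on $A$, allowed distances $\delta_i\in\mathbb{N}$ and prices $p_i\in\mathbb{N}$ for $i\in[n]$, a budget $B\in\mathbb{N}$, and an alternative $c\in A$. The question is whether there are a subset $J\subseteq[n]$ and preferences $(\succ'_i)_{i\in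 J}$ such that $\sum_{i\in J}p_i\le B$, $d(\succ_i,\succ'_i)\le\delta_i$ for every $i\in J$, and $c$ is the unique $k$-approval winner of the profile obtained from $(\succ_i)_{i\in[n]}$ by replacing $\succ_i$ with $\succ'_i$ for every $i\in J$. All numbers in the input are written in binary. **Theorem.** Local Distance constrained \$bribery for $k$-approval, for any $k$ (given with the input), is solvable in polynomial time 1. for the swap distance, on the instances with $\delta_i=1$ for every $i$; 2. for the maximum displacement distance, on the instances with $\delta_i=1$ for every $i$; 3. for the footrule distance, on the instances with $\delta_i\le 3$ for every $i$. Moreover, any two preferences $\succ,\succ'$ on the same finite set with $d_{\mathrm{foot}}(\succ,\succ')\le 3$ satisfy $d_{\mathrm{swap}}(\succ,\succ')\le 1$. -/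

import Mathlib

namespace LocalBribery

/-! ### Preferences, distances, and the `k`-approval rule -/

/-- A preference (complete order) over the alternatives `Fin m`, given by its position map:
`σ a` is the position of the alternative `a`, where position `0` is the top. -/
abbrev Pref (m : ℕ) : Type := Equiv.Perm (Fin m)

/-- `a` is preferred to `b`. -/
def Prefers {m : ℕ} (σ : Pref m) (a b : Fin m) : Prop := σ a < σ b

instance {m : ℕ} (σ : Pref m) (a b : Fin m) : Decidable (Prefers σ a b) :=
  inferInstanceAs (Decidable (σ a < σ b))

/-- The absolute difference of the positions of the alternative `a` in two preferences. -/
def displacement {m : ℕ} (σ τ : Pref m) (a : Fin m) : ℕ :=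
  (((σ a : ℕ) : ℤ) - ((τ a : ℕ) : ℤ)).natAbs

/-- The swap (Kendall tau) distance. Each unordered pair that the two preferences order
differently is counted once, namely as the pair `(a, b)` with `a` above `b` in `σ`. -/
def swapDist {m : ℕ} (σ τ : Pref m) : ℕ :=
  (Finset.univ.filter fun ab : Fin m × Fin m =>
    Prefers σ ab.1 ab.2 ∧ Prefers τ ab.2 ab.1).card

/-- The footrule distance. -/
def footruleDist {m : ℕ} (σ τ : Pref m) : ℕ := ∑ a, displacement σ τ a

/-- The maximum displacement distance. -/
def maxDisplacementDist {m : ℕ} (σ τ : Pref m) : ℕ := Finset.univ.sup (displacement σ τ)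

/-- The total score of the alternative `a` in a profile, for the score vector `α`. -/
def score {m n : ℕ} (α : Fin m → ℕ) (P : Fin n → Pref m) (a : Fin m) : ℕ :=
  ∑ i, α (P i a)

/-- The winners of a positional scoring rule: the alternatives of maximum score. -/
def scoringWinners {m n : ℕ} (α : Fin m → ℕ) (P : Fin n → Pref m) : Finset (Fin m) :=
  Finset.univ.filter fun a => ∀ b, score α P b ≤ score α P a

/-- The score vector of `k`-approval: `1` on the first `k` positions and `0` elsewhere. -/
def approvalVector (m k : ℕ) (j : Fin m) : ℕ := if (j : ℕ) < k then 1 else 0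

/-- The winners of the `k`-approval voting rule. -/
def kApproval {m n : ℕ} (k : ℕ) (P : Fin n → Pref m) : Finset (Fin m) :=
  scoringWinners (approvalVector m k) P

/-! ### The bribery problem -/

/-- An instance of Local Distance constrained $bribery for the `k`-approval voting rule;
`k` is part of the instance. -/
structure Instance where
  /-- number of alternatives -/
  m : ℕ
  /-- number of preferences -/
  n : ℕ
  /-- the parameter of the voting rule -/
  k : ℕ
  n_pos : 0 < n
  k_pos : 0 < k
  k_lt : k < m
  /-- the distinguished alternative -/
  c : Fin m
  /-- the budget -/
  budget : ℕ
  /-- the profile -/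
  profile : Fin n → Pref m
  /-- the distances allowed -/
  δ : Fin n → ℕ
  /-- the prices -/
  price : Fin n → ℕ

/-- The instance `I` is a yes instance with respect to the distance function `d`: the preferences
in some set `J` can be changed, within the budget and within the distances allowed, so that `c` is
the unique `k`-approval winner. (The values of `Q` outside `J` play no role.) -/
def IsYes (d : ∀ {m : ℕ}, Pref m → Pref m → ℕ) (I : Instance) : Prop :=
  ∃ (J : Finset (Fin I.n)) (Q : Fin I.n → Pref I.m),
    ∑ i ∈ J, I.price i ≤ I.budget ∧
    (∀ i ∈ J, d (I.profile i) (Q i) ≤ I.δ i) ∧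
    kApproval I.k (fun i => if i ∈ J then Q i else I.profile i) = {I.c}

/-! ### Encoding of instances as strings -/

/-- A list of natural numbers as a string over `{0, 1, separator}`: every number is written in
binary (least significant bit first) and followed by the separator `none`. -/
def encodeNats (l : List ℕ) : List (Option Bool) :=
  l.flatMap fun x => (Computability.encodeNat x).map some ++ [none]

/-- The part of an instance that belongs to the voter `i`: price, distance allowed, and the
alternatives listed from top to bottom. -/
def Instance.voterNats (I : Instance) (i : Fin I.n) : List ℕ :=
  I.price i :: I.δ i :: List.ofFn fun j : Fin I.m => (((I.profile i).symm j : Fin I.m) : ℕ)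

/-- An instance written as a list of natural numbers. -/
def Instance.toNats (I : Instance) : List ℕ :=
  I.m :: I.n :: I.k :: (I.c : ℕ) :: I.budget :: (List.finRange I.n).flatMap I.voterNats

/-- An instance written as a string; all numbers are in binary. -/
def Instance.encode (I : Instance) : List (Option Bool) := encodeNats I.toNats

theorem encodeNats_injective : Function.Injective encodeNats := by
  have key : ∀ (u v : List Bool) (s t : List (Option Bool)),
      u.map some ++ none :: s = v.map some ++ none :: t → u = v ∧ s = t := by
    intro u
    induction u with
    | nil =>
      intro v s t h
      cases v with
      | nil => simpa using h
      | cons b v => simp at h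
    | cons a u ih =>
      intro v s t h
      cases v with
      | nil => simp at h
      | cons b v =>
        simp only [List.map_cons, List.cons_append, List.cons.injEq, Option.some.injEq] at h
        obtain ⟨h1, h2⟩ := ih v s t h.2
        exact ⟨by rw [h.1, h1], h2⟩
  intro l
  induction l with
  | nil =>
    intro l' h
    cases l' with
    | nil => rfl
    | cons b l' => simp [encodeNats] at h
  | cons a l ih =>
    intro l' h
    cases l' with
    | nil => simp [encodeNats] at h
    | cons b l' =>
      simp only [encodeNats, List.flatMap_cons, List.append_assoc, List.singleton_append] at h
      obtain ⟨h1, h2⟩ := key _ _ _ _ h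
      have h3 : a = b := by
        rw [← Computability.decode_encodeNat a, ← Computability.decode_encodeNat b, h1]
      rw [h3, ih h2]

/-- Different instances are written as different strings. -/
theorem Instance.encode_injective : Function.Injective Instance.encode := by
  have key : ∀ {ι : Type} (f g : ι → List ℕ) (_ : ∀ i, (f i).length = (g i).length) (l : List ι),
      l.flatMap f = l.flatMap g → ∀ i ∈ l, f i = g i := by
    intro ι f g hfg l
    induction l with
    | nil => simp
    | cons a l ih =>
      intro h i hi
      simp only [List.flatMap_cons] at h
      obtain ⟨h1, h2⟩ := List.append_inj h (hfg a)
      rcases List.mem_cons.1 hi with rfl | hi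
      · exact h1
      · exact ih h2 i hi
  intro I I' h
  have h' := encodeNats_injective h
  obtain ⟨m, n, k, h1, h2, h3, c, B, P, δ, p⟩ := I
  obtain ⟨m', n', k', h1', h2', h3', c', B', P', δ', p'⟩ := I'
  simp only [Instance.toNats, List.cons.injEq] at h'
  obtain ⟨rfl, rfl, rfl, hc, rfl, h'⟩ := h'
  have hi := fun i => key _ _ (by intro i; simp [Instance.voterNats]) _ h' i (List.mem_finRange i)
  simp only [Instance.voterNats, List.cons.injEq] at hi
  have e1 : c = c' := Fin.ext hc
  have e2 : p = p' := funext fun i => (hi i).1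
  have e3 : δ = δ' := funext fun i => (hi i).2.1
  have e4 : P = P' := by
    funext i
    have h5 := List.ofFn_injective (hi i).2.2
    have h6 : (P i).symm = (P' i).symm := by
      ext j
      exact congrFun h5 j
    rw [← (P i).symm_symm, h6, Equiv.symm_symm]
  subst e1 e2 e3 e4
  rfl

/-! ### Polynomial-time solvability -/

open Classical in
/-- The decision problem `yes`, restricted to the inputs that satisfy `D` and are written as
strings by `enc`, is solvable in polynomial time: some multi-stack Turing machine answers it on
every such input in a number of steps bounded by a polynomial in the length of the string. -/
def PolyTimeSolvable {α Γ : Type} (enc : α → List Γ) (D yes : α → Prop) : Prop :=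
  Nonempty (Turing.TM2ComputableInPolyTime (fun a : {a : α // D a} => enc a.1)
    Computability.encodeBool (fun a : {a : α // D a} => decide (yes a.1)))

end LocalBribery

/-!
The three distances behave alike. A change of a preference `σ` within the distances considered
either leaves the set of the first `k` alternatives as it is, or it exchanges the alternative at
position `k` with the one at position `k + 1`, counted from one (`Bribery.lost_of_swapDist_le`,
`Bribery.lost_of_maxDisplacementDist_le`, `Bribery.lost_of_footruleDist_le`). Conversely, the swap
of these two alternatives has swap distance and maximum displacement distance `1`, and footrule
distance `2`. As footrule distances are even (`Bribery.even_footruleDist`), a footrule distance of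
at most `3` is at most `2`, so that at most two alternatives change places. Hence the only question
is which voters `i`, among those with `δ i ≥ T` for a constant `T ∈ {1, 2}`, are paid to move one
approval from an alternative `x i` to an alternative `y i` (`Bribery.decideNats_iff_isYes`).

This is decided by minimum-cost flows. The alternative `c` wins alone if and only if, for some
`t ≤ n`, it has at least `t` approvals and the other alternatives have at most `t - 1`. For fixed
`t`, consider the network with unit capacities in which a unit of flow enters the alternative `a`
for every voter who approves of `a`, an arc of cost `price i` leads from `x i` to `y i` for every
voter `i` who can be bribed, and the flow through an alternative, which is the number of its
approvals after the bribe, continues to the sink: from `a ≠ c` by at most `t - 1` units, via a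
collector, and from `c` directly, by `t` units, or via the collector. The arcs from the collector to
the sink leave room for all but `t` units, so that a flow of full value must send `t` units from `c`
to the sink directly (`Bribery.exists_sublist_iff`). The bribes within the budget are the flows of
full value whose cost is within the budget.

Such flows are found by successive shortest paths. The residual arcs carry non-negative reduced
costs; a search lowers the potential of the vertices reached until another vertex is reached by an
arc of reduced cost zero (`Flow.tree_growStep`). The reduced costs certify that the cost is minimum
(`Flow.Valid.cost_le`), and a search that does not reach the sink yields a cut which shows that
there is no flow of greater value (`Flow.Valid.not_isFlow`).

Polynomial running time is established for the multi-stack machines of Mathlib. Structured programs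
on six stacks are compiled to such machines, with one machine step for each program step
(`StackProg.Cmd.code_steps`). Values are binary trees, written in prefix code on one of the stacks;
the functions on trees that are computed by such programs within polynomial time
(`StackProg.PolyD`) are closed under composition, pairing, case distinction and loops whose
intermediate results have polynomial size. This gives folds of lists
(`StackProg.Poly.foldl_of_take`) and with them binary arithmetic and the algorithm above. The bounds of the intermediate results of
the flow algorithm rest on the fact that a step of the search makes the reduced costs longer by at
most one binary digit (`Flow.small_growStep`).
-/

/-! ### Structured stack programs and their compilation to multi-stack machines -/

namespace StackProg

/-- Structured programs acting on stacks indexed by `K`, where the stack `k` has the alphabet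
`Γ k`. -/
inductive Cmd {K : Type} (Γ : K → Type) : Type
  /-- do nothing -/
  | skip : Cmd Γ
  /-- push a symbol -/
  | push (k : K) (a : Γ k) : Cmd Γ
  /-- pop a symbol (`none` if the stack is empty) and continue according to it -/
  | case (k : K) (c : Option (Γ k) → Cmd Γ) : Cmd Γ
  /-- one program after the other -/
  | seq (c d : Cmd Γ) : Cmd Γ
  /-- repeatedly pop a symbol; leave the loop if `brk` holds of it, otherwise run the body -/
  | loop (k : K) (brk : Option (Γ k) → Bool) (body : Option (Γ k) → Cmd Γ) : Cmd Γ

variable {K : Type} [DecidableEq K] {Γ : K → Type}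

/-- `Run c S S' t`: the program `c` transforms the stacks `S` into `S'` in `t` steps. -/
inductive Run : Cmd Γ → (∀ k, List (Γ k)) → (∀ k, List (Γ k)) → ℕ → Prop
  | skip (S) : Run .skip S S 1
  | push (k a S) : Run (.push k a) S (Function.update S k (a :: S k)) 1
  | case {k c S S' t} : Run (c (S k).head?) (Function.update S k (S k).tail) S' t →
      Run (.case k c) S S' (t + 1)
  | seq {c d S S' S'' t t'} : Run c S S' t → Run d S' S'' t' → Run (.seq c d) S S'' (t + t')
  | loop_break {k brk body S} : brk (S k).head? = true →
      Run (.loop k brk body) S (Function.update S k (S k).tail) 1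
  | loop_step {k brk body S S' S'' t t'} : brk (S k).head? = false →
      Run (body (S k).head?) (Function.update S k (S k).tail) S' t →
      Run (.loop k brk body) S' S'' t' → Run (.loop k brk body) S S'' (t + t' + 1)

/-- A program with running time `t` pushes at most `t` symbols. -/
theorem Run.length_le [Fintype K] {c : Cmd Γ} {S S' : ∀ k, List (Γ k)} {t : ℕ} (h : Run c S S' t) :
    ∑ k, (S' k).length ≤ ∑ k, (S k).length + t := by
  have upd : ∀ (S : ∀ k, List (Γ k)) (k : K) (l : List (Γ k)) (n : ℕ), l.length ≤ (S k).length + n →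
      ∑ j, (Function.update S k l j).length ≤ ∑ j, (S j).length + n := by
    intro S k l n hl
    rw [← Finset.add_sum_erase _ _ (Finset.mem_univ k),
      ← Finset.add_sum_erase _ (fun j => (S j).length) (Finset.mem_univ k)]
    have : ∑ j ∈ Finset.univ.erase k, (Function.update S k l j).length =
        ∑ j ∈ Finset.univ.erase k, (S j).length := by
      refine Finset.sum_congr rfl fun j hj => ?_
      rw [Function.update_of_ne (Finset.ne_of_mem_erase hj)]
    rw [this, Function.update_self]
    lia
  induction h with
  | skip S => lia
  | push k a S => exact upd S k _ 1 (by simp)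
  | @case k c S _ _ _ ih =>
    have := upd S k (S k).tail 0 (by simp)
    lia
  | seq _ _ ih1 ih2 => lia
  | @loop_break k _ _ S _ =>
    have := upd S k (S k).tail 0 (by simp)
    lia
  | @loop_step k _ _ S _ _ _ _ _ _ _ ih1 ih2 =>
    have := upd S k (S k).tail 0 (by simp)
    lia

namespace Cmd

/-- The program points of a program. -/
def Lbl : Cmd Γ → Type
  | .skip => Unit
  | .push _ _ => Unit
  | .case _ c => Option (Σ x, Lbl (c x))
  | .seq c d => Lbl c ⊕ Lbl d
  | .loop _ _ b => Option (Σ x, Lbl (b x))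

instance finite_lbl [∀ k, Finite (Γ k)] (c : Cmd Γ) : Finite (Lbl c) := by
  induction c with
  | skip => exact inferInstanceAs (Finite Unit)
  | push k a => exact inferInstanceAs (Finite Unit)
  | case k c ih => exact inferInstanceAs (Finite (Option (Σ x, Lbl (c x))))
  | seq c d ihc ihd => exact inferInstanceAs (Finite (Lbl c ⊕ Lbl d))
  | loop k b c ih => exact inferInstanceAs (Finite (Option (Σ x, Lbl (c x))))

/-- The program point at which the execution starts. -/
def start : (c : Cmd Γ) → Lbl c
  | .skip => ()
  | .push _ _ => ()
  | .case _ _ => none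
  | .seq c _ => Sum.inl (start c)
  | .loop _ _ _ => none

/-- The program point of a branching program that is entered when the symbol `x` is popped. -/
def enter {k : K} (b : Option (Γ k) → Cmd Γ) (x : Option (Γ k)) : Option (Σ x, Lbl (b x)) :=
  some ⟨x, start (b x)⟩

/-- The statement of a stack machine at each program point. The program points are embedded by `emb`
into the labels of the machine, which continues at the label `exit`. The internal state of the
machine remembers the symbol popped last from each stack. -/
def code {Λ : Type} : (c : Cmd Γ) → (Lbl c → Λ) → Λ → Lbl c →
    Turing.TM2.Stmt Γ Λ (∀ k, Option (Γ k))
  | .skip, _, exit, _ => .goto fun _ => exit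
  | .push k a, _, exit, _ => .push k (fun _ => a) (.goto fun _ => exit)
  | .case k c, emb, _, none =>
      .pop k (fun v a => Function.update v k a) (.goto fun v => emb (enter c (v k)))
  | .case _ c, emb, exit, some ⟨x, l⟩ => code (c x) (fun l => emb (some ⟨x, l⟩)) exit l
  | .seq c d, emb, _, .inl l => code c (fun l => emb (.inl l)) (emb (.inr (start d))) l
  | .seq _ d, emb, exit, .inr l => code d (fun l => emb (.inr l)) exit l
  | .loop k brk b, emb, exit, none =>
      .pop k (fun v a => Function.update v k a)
        (.goto fun v => if brk (v k) then exit else emb (enter b (v k)))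
  | .loop _ _ b, emb, _, some ⟨x, l⟩ => code (b x) (fun l => emb (some ⟨x, l⟩)) (emb none) l

/-- A machine that contains the code of the program `c` simulates every run of `c`, in the same
number of steps. -/
theorem code_steps {Λ : Type} {c : Cmd Γ} {S S' : ∀ k, List (Γ k)} {t : ℕ} (h : Run c S S' t)
    (M : Λ → Turing.TM2.Stmt Γ Λ (∀ k, Option (Γ k))) (emb : Lbl c → Λ) (exit : Λ)
    (hM : ∀ l, M (emb l) = code c emb exit l) (v : ∀ k, Option (Γ k)) :
    ∃ v', (flip bind (Turing.TM2.step M))^[t] (some ⟨some (emb (start c)), v, S⟩) =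
      some ⟨some exit, v', S'⟩ := by
  -- one step of the machine at the label `l`
  have step : ∀ (l : Λ) (q : Turing.TM2.Stmt Γ Λ (∀ k, Option (Γ k))) (v S), M l = q →
      flip bind (Turing.TM2.step M) (some ⟨some l, v, S⟩) = some (Turing.TM2.stepAux q v S) := by
    rintro l q v S rfl
    rfl
  induction h generalizing exit v with
  | skip S => exact ⟨v, step _ _ v S (hM (start _))⟩
  | push k a S => exact ⟨v, step _ _ v S (hM (start _))⟩
  | @case k c S S' t _ ih =>
    obtain ⟨v', hv'⟩ := ih (fun l => emb (some ⟨_, l⟩)) exit (fun l => hM (some ⟨_, l⟩))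
      (Function.update v k (S k).head?)
    refine ⟨v', ?_⟩
    rw [Function.iterate_succ_apply, ← hv', step _ _ v S (hM (start _))]
    simp only [start, code, Turing.TM2.stepAux, Function.update_self]
    rfl
  | @seq c d S S' S'' t t' _ _ ih1 ih2 =>
    obtain ⟨v', hv'⟩ := ih1 (fun l => emb (.inl l)) (emb (.inr (start d)))
      (fun l => hM (.inl l)) v
    obtain ⟨v'', hv''⟩ := ih2 (fun l => emb (.inr l)) exit (fun l => hM (.inr l)) v'
    refine ⟨v'', ?_⟩
    rw [add_comm, Function.iterate_add_apply, ← hv'', ← hv']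
    rfl
  | @loop_break k brk body S hb =>
    refine ⟨Function.update v k (S k).head?, ?_⟩
    rw [Function.iterate_one, step _ _ v S (hM (start _))]
    simp [start, code, hb]
  | @loop_step k brk body S S' S'' t t' hb _ _ ih1 ih2 =>
    obtain ⟨v', hv'⟩ := ih1 (fun l => emb (some ⟨_, l⟩)) (emb none) (fun l => hM (some ⟨_, l⟩))
      (Function.update v k (S k).head?)
    obtain ⟨v'', hv''⟩ := ih2 emb exit hM v'
    refine ⟨v'', ?_⟩
    rw [Function.iterate_succ_apply, add_comm, Function.iterate_add_apply, ← hv'',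
      step _ _ v S (hM (start _))]
    congr 1
    refine Eq.trans ?_ hv'
    simp only [start, code, Turing.TM2.stepAux, Function.update_self, hb]
    rfl

end Cmd

end StackProg

/-! ### A fixed set of stacks, and binary trees as data -/

namespace StackProg

/-- The stacks: input, output, the current value, saved values, and two auxiliary stacks. -/
inductive Stk
  | inp | out | cur | sav | tmp | aux
  deriving DecidableEq

instance : Fintype Stk := ⟨{.inp, .out, .cur, .sav, .tmp, .aux}, by rintro (_ | _) <;> simp⟩

/-- The alphabets of the stacks. On the stack of saved values the symbol `none` is a delimiter. -/
abbrev Alph : Stk → Type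
  | .inp => Option Bool
  | .sav => Option Bool
  | .out => Bool
  | .cur => Bool
  | .tmp => Bool
  | .aux => Bool

instance : ∀ k, Finite (Alph k)
  | .inp => inferInstanceAs (Finite (Option Bool))
  | .sav => inferInstanceAs (Finite (Option Bool))
  | .out => inferInstanceAs (Finite Bool)
  | .cur => inferInstanceAs (Finite Bool)
  | .tmp => inferInstanceAs (Finite Bool)
  | .aux => inferInstanceAs (Finite Bool)

/-- The programs with the stacks `Stk`. -/
abbrev Prog : Type := Cmd Alph

/-- The contents of all stacks. -/
abbrev Stacks : Type := ∀ k, List (Alph k)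

/-- The stacks with the given contents. -/
def mkStacks (i : List (Option Bool)) (o c : List Bool) (s : List (Option Bool)) (t a : List Bool) :
    Stacks
  | .inp => i
  | .out => o
  | .cur => c
  | .sav => s
  | .tmp => t
  | .aux => a

section
variable (i : List (Option Bool)) (o c : List Bool) (s : List (Option Bool)) (t a : List Bool)

@[simp] theorem mkStacks_inp : mkStacks i o c s t a .inp = i := rfl
@[simp] theorem mkStacks_out : mkStacks i o c s t a .out = o := rfl
@[simp] theorem mkStacks_cur : mkStacks i o c s t a .cur = c := rfl
@[simp] theorem mkStacks_sav : mkStacks i o c s t a .sav = s := rfl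
@[simp] theorem mkStacks_tmp : mkStacks i o c s t a .tmp = t := rfl
@[simp] theorem mkStacks_aux : mkStacks i o c s t a .aux = a := rfl

@[simp] theorem update_inp (x) :
    Function.update (mkStacks i o c s t a) .inp x = mkStacks x o c s t a := by
  funext k; cases k <;> rfl

@[simp] theorem update_out (x) :
    Function.update (mkStacks i o c s t a) .out x = mkStacks i x c s t a := by
  funext k; cases k <;> rfl

@[simp] theorem update_cur (x) :
    Function.update (mkStacks i o c s t a) .cur x = mkStacks i o x s t a := by
  funext k; cases k <;> rfl

@[simp] theorem update_sav (x) :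
    Function.update (mkStacks i o c s t a) .sav x = mkStacks i o c x t a := by
  funext k; cases k <;> rfl

@[simp] theorem update_tmp (x) :
    Function.update (mkStacks i o c s t a) .tmp x = mkStacks i o c s x a := by
  funext k; cases k <;> rfl

@[simp] theorem update_aux (x) :
    Function.update (mkStacks i o c s t a) .aux x = mkStacks i o c s t x := by
  funext k; cases k <;> rfl

end

/-- The program `c` transforms the stacks `S` into `S'` within `t` steps. -/
def Within (c : Prog) (S S' : Stacks) (t : ℕ) : Prop := ∃ t' ≤ t, Run c S S' t'

namespace Within

variable {c d : Prog} {S S' S'' : Stacks} {t t' : ℕ}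

theorem mono (h : Within c S S' t) (ht : t ≤ t') : Within c S S' t' :=
  let ⟨u, hu, hr⟩ := h
  ⟨u, hu.trans ht, hr⟩

theorem skip : Within .skip S S 1 := ⟨1, le_rfl, .skip S⟩

theorem push (k : Stk) (a : Alph k) (h : S' = Function.update S k (a :: S k)) :
    Within (.push k a) S S' 1 := by
  subst h
  exact ⟨1, le_rfl, .push k a S⟩

theorem case {k : Stk} {c : Option (Alph k) → Prog}
    (h : Within (c (S k).head?) (Function.update S k (S k).tail) S' t) :
    Within (.case k c) S S' (t + 1) :=
  let ⟨u, hu, hr⟩ := h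
  ⟨u + 1, by lia, .case hr⟩

theorem seq (h : Within c S S' t) (h' : Within d S' S'' t') :
    Within (.seq c d) S S'' (t + t') :=
  let ⟨u, hu, hr⟩ := h
  let ⟨u', hu', hr'⟩ := h'
  ⟨u + u', by lia, .seq hr hr'⟩

theorem loop_break {k brk body} (h : brk (S k).head? = true)
    (h' : S' = Function.update S k (S k).tail) : Within (.loop k brk body) S S' 1 := by
  subst h'
  exact ⟨1, le_rfl, .loop_break h⟩

theorem loop_step {k brk body} (h : brk (S k).head? = false)
    (h' : Within (body (S k).head?) (Function.update S k (S k).tail) S' t)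
    (h'' : Within (.loop k brk body) S' S'' t') : Within (.loop k brk body) S S'' (t + t' + 1) :=
  let ⟨u, hu, hr⟩ := h'
  let ⟨u', hu', hr'⟩ := h''
  ⟨u + u' + 1, by lia, .loop_step h hr hr'⟩

/-- A loop that consumes a list `w` and accumulates a result by `step`. The stacks are described by
the part of the list not yet consumed and the result obtained so far. -/
theorem loop_foldl {k : Stk} {brk} {body : Option (Alph k) → Prog} {A B : Type}
    (G : List B → A → Stacks) (step : A → B → A) (n : ℕ)
    (hbrk : ∀ b w a, brk (G (b :: w) a k).head? = false)
    (hstep : ∀ b w a, Within (body (G (b :: w) a k).head?)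
      (Function.update (G (b :: w) a) k (G (b :: w) a k).tail) (G w (step a b)) n)
    (hend : ∀ a, brk (G [] a k).head? = true) (w : List B) (a : A) :
    Within (.loop k brk body) (G w a)
      (Function.update (G [] (w.foldl step a)) k (G [] (w.foldl step a) k).tail)
      (w.length * (n + 1) + 1) := by
  induction w generalizing a with
  | nil => exact (loop_break (hend a) rfl).mono (by simp)
  | cons b w ih =>
    refine (loop_step (hbrk b w a) (hstep b w a) (ih (step a b))).mono ?_
    simp only [List.length_cons]
    lia

end Within

/-- Move the symbols of the stack `k` onto the top of another stack by the programs `f b`. -/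
def drain (k : Stk) (f : Alph k → Prog) : Prog :=
  .loop k Option.isNone fun x => x.elim .skip f

/-- Move the topmost saved value by the programs `f b`. -/
def drainSaved (f : Bool → Prog) : Prog :=
  .loop .sav (fun x => x.join.isNone) fun x => x.join.elim .skip f

theorem drain_foldl (k : Stk) {f : Alph k → Prog} {A : Type} (G : List (Alph k) → A → Stacks)
    (step : A → Alph k → A) (n : ℕ) (hG : ∀ w a, G w a k = w)
    (hstep : ∀ b w a, Within (f b) (Function.update (G (b :: w) a) k w) (G w (step a b)) n)
    (w : List (Alph k)) (a : A) :
    Within (drain k f) (G w a) (G [] (w.foldl step a)) (w.length * (n + 1) + 1) := by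
  have := Within.loop_foldl G step n (k := k) (brk := Option.isNone)
    (body := fun x => x.elim .skip f) (by simp [hG]) (by simpa [hG] using hstep) (by simp [hG]) w a
  rwa [hG, List.tail_nil, Function.update_eq_self_iff.2 (hG _ _).symm] at this

theorem drainSaved_foldl {f : Bool → Prog} {A : Type} (G : List (Option Bool) → A → Stacks)
    (step : A → Bool → A) (n : ℕ) (s : List (Option Bool)) (hG : ∀ w a, G w a .sav = w)
    (hstep : ∀ b w a, Within (f b) (Function.update (G (some b :: w) a) .sav w) (G w (step a b)) n)
    (w : List Bool) (a : A) :
    Within (drainSaved f) (G (w.map some ++ none :: s) a)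
      (Function.update (G (none :: s) (w.foldl step a)) .sav s) (w.length * (n + 1) + 1) := by
  have := Within.loop_foldl (fun w => G (w.map some ++ none :: s)) step n (k := .sav)
    (brk := fun x => x.join.isNone) (body := fun x => x.join.elim .skip f)
    (by simp [hG]) (by intro b w a; simpa [hG] using hstep b _ a) (by simp [hG]) w a
  simpa [hG, drainSaved] using this

section
variable {i : List (Option Bool)} {o c : List Bool} {s : List (Option Bool)} {t a : List Bool}

theorem clear_cur : Within (drain .cur fun _ => .skip) (mkStacks i o c s t a)
    (mkStacks i o [] s t a) (c.length * 2 + 1) :=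
  drain_foldl .cur (A := Unit) (fun w _ => mkStacks i o w s t a) (fun _ _ => ()) 1
    (by simp) (by intro b w u; simpa using Within.skip) c ()

theorem clear_tmp : Within (drain .tmp fun _ => .skip) (mkStacks i o c s t a)
    (mkStacks i o c s [] a) (t.length * 2 + 1) :=
  drain_foldl .tmp (A := Unit) (fun w _ => mkStacks i o c s w a) (fun _ _ => ()) 1
    (by simp) (by intro b w u; simpa using Within.skip) t ()

theorem move_cur_tmp : Within (drain .cur fun b => .push .tmp b) (mkStacks i o c s t a)
    (mkStacks i o [] s (c.reverse ++ t) a) (c.length * 2 + 1) := by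
  simpa using drain_foldl .cur (fun w u => mkStacks i o w s u a) (fun u b => b :: u) 1
    (by simp) (by intro b w u; exact Within.push .tmp b (by simp)) c t

theorem move_tmp_cur : Within (drain .tmp fun b => .push .cur b) (mkStacks i o c s t a)
    (mkStacks i o (t.reverse ++ c) s [] a) (t.length * 2 + 1) := by
  simpa using drain_foldl .tmp (fun w u => mkStacks i o u s w a) (fun u b => b :: u) 1
    (by simp) (by intro b w u; exact Within.push .cur b (by simp)) t c

theorem move_tmp_sav : Within (drain .tmp fun b => .push .sav (some b)) (mkStacks i o c s t a)
    (mkStacks i o c (t.reverse.map some ++ s) [] a) (t.length * 2 + 1) := by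
  have := drain_foldl .tmp (fun w u => mkStacks i o c u w a) (fun u b => some b :: u) 1
    (by simp) (by intro b w u; exact Within.push .sav (some b) (by simp)) t s
  have h : ∀ (t : List Bool) s, t.foldl (fun u b => some b :: u) s = t.reverse.map some ++ s := by
    intro t
    induction t with
    | nil => simp
    | cons b t ih => intro s; simp [ih]
  rwa [h] at this

theorem move_cur_sav_tmp : Within (drain .cur fun b => .seq (.push .tmp b) (.push .sav (some b)))
    (mkStacks i o c s t a) (mkStacks i o [] (c.reverse.map some ++ s) (c.reverse ++ t) a)
    (c.length * 3 + 1) := by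
  have := drain_foldl .cur (fun w (u : List Bool × List (Option Bool)) => mkStacks i o w u.2 u.1 a)
    (fun u b => (b :: u.1, some b :: u.2)) 2 (by simp)
    (by intro b w u; exact (Within.push .tmp b rfl).seq (Within.push .sav (some b) (by simp)))
    c (t, s)
  have h : ∀ (c : List Bool) (u : List Bool × List (Option Bool)),
      c.foldl (fun u b => (b :: u.1, some b :: u.2)) u =
        (c.reverse ++ u.1, c.reverse.map some ++ u.2) := by
    intro t
    induction t with
    | nil => simp
    | cons b t ih => intro s; simp [ih]
  rwa [h] at this

theorem move_sav_cur (w : List Bool) : Within (drainSaved fun b => .push .cur b)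
    (mkStacks i o c (w.map some ++ none :: s) t a) (mkStacks i o (w.reverse ++ c) s t a)
    (w.length * 2 + 1) := by
  simpa using drainSaved_foldl (fun w u => mkStacks i o u w t a) (fun u b => b :: u) 1 s
    (by simp) (by intro b w u; exact Within.push .cur b (by simp)) w c

theorem move_sav_tmp (w : List Bool) : Within (drainSaved fun b => .push .tmp b)
    (mkStacks i o c (w.map some ++ none :: s) t a) (mkStacks i o c s (w.reverse ++ t) a)
    (w.length * 2 + 1) := by
  simpa using drainSaved_foldl (fun w u => mkStacks i o c w u a) (fun u b => b :: u) 1 s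
    (by simp) (by intro b w u; exact Within.push .tmp b (by simp)) w t

end

/-- Binary trees, the values that programs compute with. -/
inductive Data
  | leaf
  | node (x y : Data)

namespace Data

/-- The prefix code of a binary tree. -/
def code : Data → List Bool
  | leaf => [false]
  | node x y => true :: (x.code ++ y.code)

/-- The length of the code of a binary tree, which is its number of vertices. -/
def size (x : Data) : ℕ := x.code.length

@[simp] theorem size_leaf : size leaf = 1 := rfl

@[simp] theorem size_node (x y : Data) : size (node x y) = size x + size y + 1 := by
  simp [size, code]

@[simp] theorem length_code (x : Data) : x.code.length = x.size := rfl

theorem size_pos (x : Data) : 0 < x.size := by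
  cases x <;> simp

/-- The left subtree. -/
def left : Data → Data
  | leaf => leaf
  | node x _ => x

/-- The right subtree. -/
def right : Data → Data
  | leaf => leaf
  | node _ y => y

/-- Whether a tree has more than one vertex, as a tree. -/
def isNode : Data → Data
  | leaf => leaf
  | node _ _ => node leaf leaf

end Data

/-- The stacks when the value `x` has been computed and the saved values are `s`. -/
def holds (x : Data) (s : List (Option Bool)) : Stacks := mkStacks [] [] x.code s [] []

/-- Move the code of one tree from `cur` to `tmp`, where `aux` holds a symbol for every tree that
remains to be read. -/
def parse : Prog :=
  .loop .aux Option.isNone fun _ => .case .cur fun x =>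
    if x = some true then
      .seq (.push .aux true) (.seq (.push .aux true) (.push .tmp true))
    else .push .tmp false

/-- Every `true` read adds one tree that remains to be read, and every `false` completes one. -/
theorem parse_step {i o s w} (x : Data) {t a S' n}
    (h : Within parse (mkStacks i o w s (x.code.reverse ++ t) a) S' n) :
    Within parse (mkStacks i o (x.code ++ w) s t (true :: a)) S' (5 * x.size + n) := by
  induction x generalizing w t a n with
  | leaf =>
    refine (Within.loop_step (by simp) (Within.case (Within.push .tmp false ?_)) h).mono ?_
    · simp [Data.code]
    · simp
  | node x y ihx ihy =>
    have h1 := ihx (w := y.code ++ w) (a := true :: a) (t := true :: t) (n := 5 * y.size + n)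
      (ihy (by simpa [Data.code] using h))
    have h2 : Within (.case .cur fun x =>
      if x = some true then
        .seq (.push .aux true) (.seq (.push .aux true) (.push .tmp true))
      else .push .tmp false) (mkStacks i o (true :: (x.code ++ (y.code ++ w))) s t a)
        (mkStacks i o (x.code ++ (y.code ++ w)) s (true :: t) (true :: true :: a)) 4 := by
      refine Within.case (t := 3) ?_
      simp only [mkStacks_cur, List.head?_cons, if_true, List.tail_cons, update_cur]
      exact ((Within.push _ _ rfl).seq ((Within.push _ _ rfl).seq (Within.push _ _ (by simp))))
    refine (Within.loop_step (t := 4) (by simp) ?_ h1).mono (by simp; lia)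
    simpa [Data.code] using h2

theorem parse_data {i o s w} (x : Data) {t} :
    Within parse (mkStacks i o (x.code ++ w) s t [true])
      (mkStacks i o w s (x.code.reverse ++ t) []) (5 * x.size + 1) :=
  parse_step x (Within.loop_break (by simp) (by simp))

end StackProg

/-! ### Tree functions computable in polynomial time -/

namespace StackProg

theorem eval_mono (p : Polynomial ℕ) {m n : ℕ} (h : m ≤ n) : p.eval m ≤ p.eval n := by
  simp only [Polynomial.eval_eq_sum, Polynomial.sum]
  gcongr

/-- The value `f i` can be computed from the value `e i` in polynomial time, by a program that does
not depend on `i` and respects the saved values. -/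
def PolyD {ι : Type} (e f : ι → Data) : Prop :=
  ∃ (c : Prog) (p : Polynomial ℕ), ∀ i s, Within c (holds (e i) s) (holds (f i) s)
    (p.eval (e i).size)

/-- A program can only compute values whose size is bounded by its running time. -/
theorem Within.size_le {c : Prog} {x y : Data} {s : List (Option Bool)} {t : ℕ}
    (h : Within c (holds x s) (holds y s) t) : y.size ≤ x.size + t := by
  obtain ⟨u, hu, hr⟩ := h
  have := hr.length_le
  have key : ∀ z : Data, ∑ k, (holds z s k).length = z.size + s.length := by
    intro z
    have : (Finset.univ : Finset Stk) = {.inp, .out, .cur, .sav, .tmp, .aux} := rfl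
    rw [this]
    simp [holds]
  rw [key, key] at this
  lia

/-- Save a copy of the current value. -/
def save : Prog :=
  .seq (.push .sav none) (.seq (drain .cur fun b => .seq (.push .tmp b) (.push .sav (some b)))
    (drain .tmp fun b => .push .cur b))

theorem save_spec (x : Data) (s) : Within save (holds x s)
    (holds x (x.code.reverse.map some ++ none :: s)) (5 * x.size + 3) := by
  have h₁ : Within (.push .sav none) (holds x s) (mkStacks [] [] x.code (none :: s) [] []) 1 :=
    Within.push _ _ (by simp [holds])
  have h₂ := move_cur_sav_tmp (i := []) (o := []) (c := x.code) (s := none :: s) (t := []) (a := [])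
  have h₃ := move_tmp_cur (i := []) (o := []) (c := []) (t := x.code.reverse ++ []) (a := [])
    (s := x.code.reverse.map some ++ none :: s)
  have h := (h₁.seq (h₂.seq h₃)).mono (t' := 5 * x.size + 3) (by simp; lia)
  simpa [holds, save] using h

/-- Replace the (empty) current value by the value saved last. -/
def restore : Prog := drainSaved fun b => .push .cur b

theorem restore_spec (x : Data) (s) : Within restore
    (mkStacks [] [] [] (x.code.reverse.map some ++ none :: s) [] []) (holds x s)
    (2 * x.size + 1) := by
  simpa [holds, restore, mul_comm] using move_sav_cur (i := []) (o := []) (c := []) (s := s)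
    (t := []) (a := []) x.code.reverse

/-- Exchange the current value and the value saved last; the value is saved with its code not
reversed. -/
def exchange : Prog :=
  .seq (drain .cur fun b => .push .tmp b) (.seq restore
    (.seq (.push .sav none) (drain .tmp fun b => .push .sav (some b))))

theorem exchange_spec (x y : Data) (s) : Within exchange
    (holds y (x.code.reverse.map some ++ none :: s)) (holds x (y.code.map some ++ none :: s))
    (4 * y.size + 2 * x.size + 4) := by
  have h₁ := move_cur_tmp (i := []) (o := []) (c := y.code)
    (s := x.code.reverse.map some ++ none :: s) (t := []) (a := [])
  have h₂ := move_sav_cur (i := []) (o := []) (c := []) (s := s) (t := y.code.reverse ++ [])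
    (a := []) x.code.reverse
  have h₃ : Within (.push .sav none)
      (mkStacks [] [] (x.code.reverse.reverse ++ []) s (y.code.reverse ++ []) [])
      (mkStacks [] [] x.code (none :: s) y.code.reverse []) 1 := Within.push _ _ (by simp)
  have h₄ := move_tmp_sav (i := []) (o := []) (c := x.code) (s := none :: s) (t := y.code.reverse)
    (a := [])
  have h := (h₁.seq (h₂.seq (h₃.seq h₄))).mono (t' := 4 * y.size + 2 * x.size + 4) (by simp; lia)
  simpa [holds, exchange, restore] using h

/-- Put the value saved last, whose code is not reversed, in front of the current value. -/
def join : Prog :=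
  .seq (drainSaved fun b => .push .tmp b) (.seq (drain .tmp fun b => .push .cur b)
    (.push .cur true))

theorem join_spec (x y : Data) (s) : Within join
    (holds y (x.code.map some ++ none :: s)) (holds (.node x y) s) (4 * x.size + 3) := by
  have h := move_sav_tmp (i := []) (o := []) (c := y.code) (s := s) (t := []) (a := []) x.code
  have h' := move_tmp_cur (i := []) (o := []) (c := y.code) (s := s) (t := x.code.reverse)
    (a := [])
  refine (h.seq ((Within.seq (by simpa using h') (Within.push _ _ ?_)))).mono ?_
  · simp [holds, Data.code]
  · simp
    lia

namespace PolyD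

variable {ι κ : Type} {e f g : ι → Data}

theorem id (e : ι → Data) : PolyD e e := ⟨.skip, 1, fun i s => by simpa using Within.skip⟩

theorem comp (h : PolyD e f) (h' : PolyD f g) : PolyD e g := by
  obtain ⟨c, p, hc⟩ := h
  obtain ⟨d, q, hd⟩ := h'
  refine ⟨.seq c d, p + q.comp (Polynomial.X + p), fun i s => ((hc i s).seq (hd i s)).mono ?_⟩
  simpa using eval_mono q (hc i s).size_le

theorem reindex (φ : κ → ι) (h : PolyD e f) : PolyD (fun i => e (φ i)) (fun i => f (φ i)) := by
  obtain ⟨c, p, hc⟩ := h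
  exact ⟨c, p, fun i s => hc _ s⟩

/-- The argument is saved while the first component is computed, which is then saved in turn. -/
theorem pair (h : PolyD e f) (h' : PolyD e g) : PolyD e (fun i => .node (f i) (g i)) := by
  obtain ⟨c, p, hc⟩ := h
  obtain ⟨d, q, hd⟩ := h'
  refine ⟨.seq save (.seq c (.seq exchange (.seq d join))),
    15 * Polynomial.X + 9 * p + q + 10, fun i s => ?_⟩
  have hs := (hc i s).size_le
  refine ((save_spec _ _).seq ((hc i _).seq ((exchange_spec _ _ _).seq
    ((hd i _).seq (join_spec _ _ _))))).mono ?_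
  simp
  lia

theorem leaf : PolyD e (fun _ => .leaf) := by
  refine ⟨.seq (drain .cur fun _ => .skip) (.push .cur false), 2 * Polynomial.X + 2, fun i s => ?_⟩
  have h₁ := clear_cur (i := []) (o := []) (c := (e i).code) (s := s) (t := []) (a := [])
  exact (h₁.seq (Within.push .cur false (by simp [holds, Data.code]))).mono (by simp; lia)

theorem const (x : Data) : PolyD e (fun _ => x) := by
  induction x with
  | leaf => exact leaf
  | node x y ihx ihy => exact ihx.pair ihy

theorem left_self : PolyD e (fun i => (e i).left) := by
  refine ⟨.case .cur fun x => if x = some true then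
      .seq (.push .aux true) (.seq parse (.seq (drain .cur fun _ => .skip)
        (drain .tmp fun b => .push .cur b)))
    else .push .cur false, 10 * Polynomial.X + 5, fun i s => ?_⟩
  refine (Within.case (t := 10 * (e i).size + 4) ?_).mono (by simp)
  beta_reduce
  generalize e i = z
  cases z with
  | leaf => exact (Within.push .cur false (by simp [holds, Data.code, Data.left])).mono (by lia)
  | node x y =>
    simp only [holds, Data.code, mkStacks_cur, List.head?_cons, if_true, List.tail_cons,
      update_cur, Data.left]
    refine ((Within.push _ _ rfl).seq (Within.seq (t := 5 * x.size + 1)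
      (S' := mkStacks [] [] y.code s x.code.reverse []) ?_ (clear_cur.seq
      (t' := x.size * 2 + 1) ?_))).mono ?_
    · simpa using parse_data (t := []) x
    · simpa using move_tmp_cur (i := []) (o := []) (c := []) (s := s) (t := x.code.reverse)
        (a := [])
    · simp
      lia

theorem right_self : PolyD e (fun i => (e i).right) := by
  refine ⟨.case .cur fun x => if x = some true then
      .seq (.push .aux true) (.seq parse (drain .tmp fun _ => .skip))
    else .push .cur false, 10 * Polynomial.X + 5, fun i s => ?_⟩
  refine (Within.case (t := 10 * (e i).size + 4) ?_).mono (by simp)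
  beta_reduce
  generalize e i = z
  cases z with
  | leaf => exact (Within.push .cur false (by simp [holds, Data.code, Data.right])).mono (by lia)
  | node x y =>
    simp only [holds, Data.code, mkStacks_cur, List.head?_cons, if_true, List.tail_cons,
      update_cur, Data.right]
    refine ((Within.push _ _ rfl).seq (Within.seq (t := 5 * x.size + 1)
      (S' := mkStacks [] [] y.code s x.code.reverse []) ?_ clear_tmp)).mono ?_
    · simpa using parse_data (t := []) x
    · simp
      lia

theorem isNode_self : PolyD e (fun i => (e i).isNode) := by
  refine ⟨.case .cur fun x => if x = some true then
      .seq (drain .cur fun _ => .skip) (.seq (.push .cur false) (.seq (.push .cur false)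
        (.push .cur true)))
    else .push .cur false, 2 * Polynomial.X + 5, fun i s => ?_⟩
  refine (Within.case (t := 2 * (e i).size + 4) ?_).mono (by simp)
  beta_reduce
  generalize e i = z
  cases z with
  | leaf => exact (Within.push .cur false (by simp [holds, Data.code, Data.isNode])).mono (by lia)
  | node x y =>
    simp only [holds, Data.code, mkStacks_cur, List.head?_cons, if_true, List.tail_cons,
      update_cur, Data.isNode]
    refine (clear_cur.seq ((Within.push _ _ rfl).seq ((Within.push _ _ rfl).seq
      (Within.push _ _ ?_)))).mono ?_
    · simp
    · simp
      lia

theorem left (h : PolyD e f) : PolyD e (fun i => (f i).left) := h.comp left_self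

theorem right (h : PolyD e f) : PolyD e (fun i => (f i).right) := h.comp right_self

theorem isNode (h : PolyD e f) : PolyD e (fun i => (f i).isNode) := h.comp isNode_self

end PolyD

/-- Truth values as trees. -/
def boolData : Bool → Data
  | false => .leaf
  | true => .node .leaf .leaf

/-- Pop the truth value at the front of the current value, and branch. -/
def branch (c d : Prog) : Prog :=
  .case .cur fun x => if x = some true then .case .cur fun _ => .case .cur fun _ => c else d

theorem branch_spec {c d : Prog} {b : Bool} {w s S t} (h : Within (if b then c else d)
    (mkStacks [] [] w s [] []) S t) : Within (branch c d)
    (mkStacks [] [] ((boolData b).code ++ w) s [] []) S (t + 3) := by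
  refine Within.case (t := t + 2) ?_
  cases b
  · simpa [boolData, Data.code] using h.mono (t' := t + 2) (by lia)
  · simp only [boolData, Data.code, mkStacks_cur, List.cons_append, List.nil_append,
      List.head?_cons, if_true, List.tail_cons, update_cur]
    refine Within.case (t := t + 1) (Within.case (t := t) ?_)
    simpa using h

namespace PolyD

variable {ι κ : Type} {e f g : ι → Data}

theorem cond {b : ι → Bool} (hb : PolyD e (fun i => boolData (b i)))
    (hf : PolyD (fun i : {i // b i = true} => e i) (fun i => f i))
    (hg : PolyD (fun i : {i // b i = false} => e i) (fun i => g i)) :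
    PolyD e (fun i => bif b i then f i else g i) := by
  obtain ⟨c₀, p₀, h₀⟩ := hb
  obtain ⟨c₁, p₁, h₁⟩ := hf
  obtain ⟨c₂, p₂, h₂⟩ := hg
  refine ⟨.seq save (.seq c₀ (branch (.seq restore c₁) (.seq restore c₂))),
    7 * Polynomial.X + 7 + p₀ + p₁ + p₂, fun i s => ?_⟩
  refine ((save_spec _ _).seq ((h₀ i _).seq (t' := (2 * (e i).size + 1 +
    p₁.eval (e i).size + p₂.eval (e i).size) + 3) ?_)).mono ?_
  · have := branch_spec (c := .seq restore c₁) (d := .seq restore c₂) (b := b i) (w := [])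
      (s := ((e i).code.reverse.map some ++ none :: s))
      (S := holds (bif b i then f i else g i) s) (t := (2 * (e i).size + 1 +
        p₁.eval (e i).size + p₂.eval (e i).size)) ?_
    · simpa [holds] using this
    · cases hbi : b i
      · exact ((restore_spec _ _).seq (h₂ ⟨i, hbi⟩ s)).mono (by simp)
      · exact ((restore_spec _ _).seq (h₁ ⟨i, hbi⟩ s)).mono (by simp)
  · simp
    lia

/-- Iteration: the step `F` is repeated as long as the step yields the flag `true`. If the flag is
`false` for the first time after polynomially many steps, and the values are of polynomial size
until then, the final value is computed in polynomial time. -/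
theorem doWhile {F : ι → ι} {b : ι → Bool}
    (h : PolyD e (fun i => .node (boolData (b i)) (e (F i)))) (start : κ → ι) (N : κ → ℕ)
    (q : Polynomial ℕ) (hN : ∀ k, N k ≤ q.eval (e (start k)).size)
    (hsize : ∀ k, ∀ j ≤ N k, (e (F^[j] (start k))).size ≤ q.eval (e (start k)).size)
    (hcont : ∀ k, ∀ j < N k, b (F^[j] (start k)) = true)
    (hlast : ∀ k, b (F^[N k] (start k)) = false) :
    PolyD (fun k => e (start k)) (fun k => e (F^[N k + 1] (start k))) := by
  obtain ⟨c, p, hc⟩ := h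
  -- popping the symbol for the root of the pair leaves the flag followed by the next value
  have hc' : ∀ i s, Within (.seq c (.case .cur fun _ => .skip)) (holds (e i) s)
      (mkStacks [] [] ((boolData (b i)).code ++ (e (F i)).code) s [] [])
      (p.eval (e i).size + 2) := by
    intro i s
    refine (hc i s).seq (Within.case (t := 1) ?_)
    simpa [holds, Data.code] using Within.skip
  let body : Prog := .case .cur fun _ => .case .cur fun _ => .seq c (.case .cur fun _ => .skip)
  let lp : Prog := .loop .cur (fun x => x != some true) fun _ => body
  have key : ∀ (s) (B n : ℕ) (i : ι), (∀ j ≤ n, (e (F^[j] i)).size ≤ B) →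
      (∀ j < n, b (F^[j] i) = true) → b (F^[n] i) = false →
      Within lp (mkStacks [] [] ((boolData (b i)).code ++ (e (F i)).code) s [] [])
        (holds (e (F^[n + 1] i)) s) (n * (p.eval B + 5) + 1) := by
    intro s B n
    induction n with
    | zero =>
      intro i _ _ h0
      refine (Within.loop_break ?_ ?_).mono (by simp)
      · simp only [Function.iterate_zero, id_eq] at h0
        simp [h0, boolData, Data.code]
      · simp only [Function.iterate_zero, id_eq] at h0
        simp [h0, boolData, Data.code, holds]
    | succ n ih =>
      intro i hB h1 h0
      have hi : b i = true := h1 0 (by lia)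
      refine (Within.loop_step (t := (p.eval B + 2) + 2) ?_ ?_ (ih (F i) ?_ ?_ h0)).mono ?_
      · simp [hi, boolData, Data.code]
      · refine Within.case (t := (p.eval B + 2) + 1) (Within.case (t := (p.eval B + 2)) ?_)
        simp only [hi, boolData, Data.code, mkStacks_cur, List.cons_append, List.nil_append,
          List.tail_cons, update_cur]
        exact (hc' (F i) s).mono (by gcongr; exact eval_mono p (hB 1 (by lia)))
      · exact fun j hj => hB (j + 1) (by lia)
      · exact fun j hj => h1 (j + 1) (by lia)
      · lia
  refine ⟨.seq (.seq c (.case .cur fun _ => .skip)) lp,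
    p + 2 + (q * (p.comp q + 5) + 1), fun k s => ?_⟩
  refine ((hc' _ s).seq (key s _ (N k) (start k) (hsize k) (hcont k) (hlast k))).mono ?_
  simp only [Polynomial.eval_add, Polynomial.eval_mul, Polynomial.eval_comp,
    Polynomial.eval_ofNat, Polynomial.eval_one]
  have := hN k
  gcongr

end PolyD

end StackProg

/-! ### Machines for tree programs -/

namespace StackProg

/-- The symbols of input strings as trees. -/
def symData : Option Bool → Data
  | none => .leaf
  | some b => .node (boolData b) .leaf

/-- Input strings as trees. -/
def strData : List (Option Bool) → Data
  | [] => .leaf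
  | a :: l => .node (symData a) (strData l)

theorem size_symData_le (a : Option Bool) : (symData a).size ≤ 5 := by
  rcases a with _ | _ | _ <;> simp [symData, boolData]

theorem size_strData_le (l : List (Option Bool)) : (strData l).size ≤ 6 * l.length + 1 := by
  induction l with
  | nil => simp [strData]
  | cons a l ih =>
    have := size_symData_le a
    simp [strData]
    lia

/-- Push a list of symbols onto `tmp`. -/
def pushTmp : List Bool → Prog
  | [] => .skip
  | b :: l => .seq (.push .tmp b) (pushTmp l)

theorem pushTmp_spec {i o c s a} (l t : List Bool) : Within (pushTmp l) (mkStacks i o c s t a)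
    (mkStacks i o c s (l.reverse ++ t) a) (l.length + 1) := by
  induction l generalizing t with
  | nil => exact Within.skip
  | cons b l ih =>
    refine ((Within.push .tmp b rfl).seq (t' := l.length + 1) ?_).mono (by simp; lia)
    simpa using ih (b :: t)

/-- Turn the input string into a tree. -/
def readInput : Prog :=
  .seq (drain .inp fun a => pushTmp (true :: (symData a).code)) (.seq (.push .tmp false)
    (drain .tmp fun b => .push .cur b))

theorem readInput_spec (l : List (Option Bool)) : Within readInput (mkStacks l [] [] [] [] [])
    (holds (strData l) []) (20 * l.length + 5) := by
  have key : ∀ (l : List (Option Bool)) (t : List Bool),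
      false :: l.foldl (fun t a => (true :: (symData a).code).reverse ++ t) t =
        (strData l).code.reverse ++ t := by
    intro l
    induction l with
    | nil => simp [strData, Data.code]
    | cons a l ih =>
      intro t
      rw [List.foldl_cons, ih]
      simp [strData, Data.code]
  have h₁ := drain_foldl .inp (fun w t => mkStacks w [] [] [] t [])
    (fun t a => (true :: (symData a).code).reverse ++ t) 7 (by simp)
    (f := fun a => pushTmp (true :: (symData a).code)) (by
      intro b w t
      rw [update_inp]
      refine (pushTmp_spec _ _).mono ?_
      have := size_symData_le b
      simp
      lia) l []
  have h₂ : Within (.push .tmp false) (mkStacks [] [] [] []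
      (l.foldl (fun t a => (true :: (symData a).code).reverse ++ t) []) [])
      (mkStacks [] [] [] [] (strData l).code.reverse []) 1 := by
    refine Within.push _ _ ?_
    rw [update_tmp, mkStacks_tmp, key, List.append_nil]
  have h₃ := move_tmp_cur (i := []) (o := []) (c := []) (s := []) (t := (strData l).code.reverse)
    (a := [])
  have h := (h₁.seq (h₂.seq h₃)).mono (t' := 20 * l.length + 5) (by
    have := size_strData_le l
    simp
    lia)
  simpa [holds, readInput] using h

/-- Turn a truth value given as a tree into an output. -/
def writeOutput : Prog := branch (.push .out true) (.push .out false)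

theorem writeOutput_spec (b : Bool) : Within writeOutput (holds (boolData b) [])
    (mkStacks [] [b] [] [] [] []) 4 := by
  have := branch_spec (c := .push .out true) (d := .push .out false) (b := b) (w := []) (s := [])
    (S := mkStacks [] [b] [] [] [] []) (t := 1) (by cases b <;> exact Within.push _ _ (by simp))
  simpa [holds, writeOutput] using this

/-- The machine that executes a program and halts. -/
noncomputable def machine (c : Prog) : Turing.FinTM2 where
  K := Stk
  k₀ := .inp
  k₁ := .out
  Γ := Alph
  Λ := Option (Cmd.Lbl c)
  main := some (Cmd.start c)
  ΛFin := Fintype.ofFinite _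
  σ := ∀ k, Option (Alph k)
  initialState := fun _ => none
  σFin := Fintype.ofFinite _
  Γk₀Fin := inferInstanceAs (Fintype (Option Bool))
  m
    | none => .load (fun _ _ => none) .halt
    | some l => Cmd.code c some none l

/-- The machine makes one step more than the program, in which it clears its internal state and
halts. -/
theorem machine_outputs {c : Prog} {w : List (Option Bool)} {b : Bool} {t : ℕ}
    (h : Within c (mkStacks w [] [] [] [] []) (mkStacks [] [b] [] [] [] []) t) :
    Nonempty (Turing.TM2OutputsInTime (machine c) w (some [b]) (t + 1)) := by
  obtain ⟨u, hu, hr⟩ := h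
  obtain ⟨v, hv⟩ := Cmd.code_steps hr (machine c).m some none (fun _ => rfl) (fun _ => none)
  refine ⟨⟨⟨u + 1, ?_⟩, by lia⟩⟩
  have h₀ : Turing.initList (machine c) w =
      ⟨some (some (Cmd.start c)), fun _ => none, mkStacks w [] [] [] [] []⟩ := by
    unfold Turing.initList
    congr 1
    funext k
    cases k <;> rfl
  have h₁ : Turing.haltList (machine c) [b] =
      ⟨none, fun _ => none, mkStacks [] [b] [] [] [] []⟩ := by
    unfold Turing.haltList
    congr 1
    funext k
    cases k <;> rfl
  rw [h₀, Option.map_some, h₁, Function.iterate_succ_apply']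
  exact congrArg (flip bind (Turing.TM2.step (machine c).m)) hv

/-- A predicate that is computed from the input string, as a tree, in polynomial time, is decided by
a machine in polynomial time. -/
theorem PolyD.computable {ι : Type} {w : ι → List (Option Bool)} {b : ι → Bool}
    (h : PolyD (fun i => strData (w i)) (fun i => boolData (b i))) :
    Nonempty (Turing.TM2ComputableInPolyTime w Computability.encodeBool b) := by
  obtain ⟨c, p, hc⟩ := h
  have key : ∀ i, Nonempty (Turing.TM2OutputsInTime (machine (.seq readInput (.seq c writeOutput)))
      (w i) (some [b i])
      ((20 * Polynomial.X + 10 + p.comp (6 * Polynomial.X + 1)).eval (w i).length)) := by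
    intro i
    have h := (readInput_spec (w i)).seq ((hc i []).seq (writeOutput_spec (b i)))
    have hle : p.eval (strData (w i)).size ≤ p.eval (6 * (w i).length + 1) :=
      eval_mono p (size_strData_le _)
    obtain ⟨h'⟩ := machine_outputs h
    refine ⟨⟨h'.toEvalsTo, h'.steps_le_m.trans ?_⟩⟩
    simp
    lia
  exact ⟨{
    tm := machine (.seq readInput (.seq c writeOutput))
    inputAlphabet := Equiv.refl _
    outputAlphabet := Equiv.refl _
    time := 20 * Polynomial.X + 10 + p.comp (6 * Polynomial.X + 1)
    outputsFun := fun i => cast (congrArg (fun l => Turing.TM2OutputsInTime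
      (machine (.seq readInput (.seq c writeOutput))) l (some [b i])
      ((20 * Polynomial.X + 10 + p.comp (6 * Polynomial.X + 1)).eval (w i).length))
      (List.map_id (w i)).symm) (key i).some }⟩

end StackProg

/-! ### Functions on lists and numbers computable in polynomial time -/

namespace StackProg

/-- Types whose elements are represented by binary trees. The representation need not be
injective. -/
class Enc (α : Type) where
  /-- the tree that represents an element -/
  enc : α → Data

open Enc (enc)

/-- A list of trees as a tree. -/
def listData {α : Type} (f : α → Data) : List α → Data
  | [] => .leaf
  | a :: l => .node (f a) (listData f l)

instance : Enc Bool := ⟨boolData⟩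
instance {α β : Type} [Enc α] [Enc β] : Enc (α × β) := ⟨fun x => .node (enc x.1) (enc x.2)⟩
instance {α : Type} [Enc α] : Enc (List α) := ⟨listData enc⟩
instance : Enc (Option Bool) := ⟨symData⟩

/-- Numbers are represented by their binary digits. -/
instance : Enc ℕ := ⟨fun n => enc n.bits⟩

section size
variable {α β : Type} [Enc α] [Enc β]

/-- The size of the representation of an element. -/
def esize (x : α) : ℕ := (enc x).size

theorem esize_pos (x : α) : 0 < esize x := Data.size_pos _

@[simp] theorem esize_prod (x : α × β) : esize x = esize x.1 + esize x.2 + 1 := Data.size_node _ _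

@[simp] theorem esize_nil : esize ([] : List α) = 1 := rfl

@[simp] theorem esize_cons (a : α) (l : List α) : esize (a :: l) = esize a + esize l + 1 :=
  Data.size_node _ _

theorem esize_bool_le (b : Bool) : esize b ≤ 3 := by cases b <;> decide

theorem length_le_esize (l : List α) : l.length ≤ esize l := by
  induction l with
  | nil => simp
  | cons a l ih =>
    simp
    lia

@[simp] theorem esize_append (l l' : List α) : esize (l ++ l') + 1 = esize l + esize l' := by
  induction l with
  | nil => simp [add_comm]
  | cons a l ih =>
    simp
    lia

theorem esize_le_of_mem {a : α} {l : List α} (h : a ∈ l) : esize a ≤ esize l := by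
  induction l with
  | nil => simp at h
  | cons b l ih =>
    rw [esize_cons]
    rcases List.mem_cons.1 h with rfl | h
    · lia
    · have := ih h
      lia

theorem esize_le_of_forall {l : List α} {B : ℕ} (h : ∀ a ∈ l, esize a ≤ B) :
    esize l ≤ l.length * (B + 1) + 1 := by
  induction l with
  | nil => simp
  | cons b l ih =>
    have h1 := ih fun a ha => h a (List.mem_cons_of_mem _ ha)
    have h2 := h b List.mem_cons_self
    simp only [esize_cons, List.length_cons]
    lia

theorem esize_drop_le (l : List α) (j : ℕ) : esize (l.drop j) ≤ esize l := by
  induction l generalizing j with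
  | nil => simp
  | cons b l ih =>
    cases j with
    | zero => simp
    | succ j =>
      have := ih j
      simp
      lia

theorem esize_nat (n : ℕ) : esize n = esize n.bits := rfl

theorem esize_nat_le (n : ℕ) : esize n ≤ 4 * n.size + 1 := by
  rw [esize_nat]
  refine (esize_le_of_forall (B := 3) fun b _ => esize_bool_le b).trans ?_
  rw [Nat.size_eq_bits_len]
  lia

theorem size_le_esize_nat (n : ℕ) : n.size ≤ esize n := by
  rw [esize_nat, ← Nat.size_eq_bits_len]
  exact length_le_esize _

end size

variable {α β γ : Type} [Enc α] [Enc β] [Enc γ]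

/-- The function `f` is computable in polynomial time, where arguments and values are represented by
trees. -/
@[fun_prop]
def Poly (f : α → β) : Prop := PolyD (fun x => enc x) (fun x => enc (f x))

theorem PolyD.congr {ι : Type} {e f f' : ι → Data} (h : PolyD e f) (hf : ∀ i, f i = f' i) :
    PolyD e f' := by
  rwa [← funext hf]

namespace Poly

/-- Functions computable in polynomial time have values of polynomial size. -/
theorem exists_esize_le {f : α → β} (h : Poly f) :
    ∃ q : Polynomial ℕ, ∀ x, esize (f x) ≤ q.eval (esize x) := by
  obtain ⟨c, p, hc⟩ := h
  refine ⟨Polynomial.X + p, fun x => ?_⟩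
  simpa [esize] using (hc x []).size_le

@[fun_prop]
theorem id : Poly (fun x : α => x) := PolyD.id _

@[fun_prop]
theorem const (b : β) : Poly (fun _ : α => b) := PolyD.const _

@[fun_prop]
theorem comp {f : β → γ} {g : α → β} (hf : Poly f) (hg : Poly g) : Poly (fun x => f (g x)) :=
  PolyD.comp hg (PolyD.reindex g hf)

@[fun_prop]
theorem prodMk {f : α → β} {g : α → γ} (hf : Poly f) (hg : Poly g) : Poly (fun x => (f x, g x)) :=
  PolyD.pair hf hg

@[fun_prop]
theorem fst {f : α → β × γ} (hf : Poly f) : Poly (fun x => (f x).1) := PolyD.left hf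

@[fun_prop]
theorem snd {f : α → β × γ} (hf : Poly f) : Poly (fun x => (f x).2) := PolyD.right hf

@[fun_prop]
theorem cond {b : α → Bool} {f g : α → β} (hb : Poly b) (hf : Poly f) (hg : Poly g) :
    Poly (fun x => bif b x then f x else g x) := by
  refine PolyD.congr (PolyD.cond hb (PolyD.reindex _ hf) (PolyD.reindex _ hg)) fun i => ?_
  beta_reduce
  cases b i <;> rfl

theorem of_enc_eq {f : α → β} {g : α → γ} (hg : Poly g) (h : ∀ x, enc (g x) = enc (f x)) :
    Poly f := PolyD.congr hg h

@[fun_prop]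
theorem not {b : α → Bool} (hb : Poly b) : Poly (fun x => !b x) := by
  refine of_enc_eq (g := fun x => bif b x then false else true) (by fun_prop) fun x => ?_
  cases b x <;> rfl

@[fun_prop]
theorem and {b c : α → Bool} (hb : Poly b) (hc : Poly c) : Poly (fun x => b x && c x) := by
  refine of_enc_eq (g := fun x => bif b x then c x else false) (by fun_prop) fun x => ?_
  cases b x <;> rfl

@[fun_prop]
theorem or {b c : α → Bool} (hb : Poly b) (hc : Poly c) : Poly (fun x => b x || c x) := by
  refine of_enc_eq (g := fun x => bif b x then true else c x) (by fun_prop) fun x => ?_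
  cases b x <;> rfl

@[fun_prop]
theorem xor {b c : α → Bool} (hb : Poly b) (hc : Poly c) : Poly (fun x => (b x ^^ c x)) := by
  refine of_enc_eq (g := fun x => bif b x then !c x else c x) (by fun_prop) fun x => ?_
  cases b x <;> cases c x <;> rfl

@[fun_prop]
theorem cons {f : α → β} {g : α → List β} (hf : Poly f) (hg : Poly g) :
    Poly (fun x => f x :: g x) := PolyD.pair hf hg

@[fun_prop]
theorem tail {f : α → List β} (hf : Poly f) : Poly (fun x => (f x).tail) := by
  refine PolyD.congr (PolyD.right hf) fun x => ?_
  beta_reduce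
  cases f x <;> rfl

@[fun_prop]
theorem isEmpty {f : α → List β} (hf : Poly f) : Poly (fun x => (f x).isEmpty) := by
  have h : Poly (fun x => !(f x).isEmpty) := by
    refine PolyD.congr (PolyD.isNode hf) fun x => ?_
    beta_reduce
    cases f x <;> rfl
  simpa using h.not

@[fun_prop]
theorem headD {f : α → List β} {g : α → β} (hf : Poly f) (hg : Poly g) :
    Poly (fun x => (f x).headD (g x)) := by
  refine PolyD.congr (f := fun x => bif (f x).isEmpty then enc (g x) else (enc (f x)).left) ?_
    fun x => ?_
  · exact PolyD.cond (isEmpty hf) (PolyD.reindex _ hg) (PolyD.reindex _ (PolyD.left hf))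
  · beta_reduce
    cases f x <;> rfl

/-- The bounded recursion principle: a fold is computable in polynomial time if its step is, and all
intermediate results have polynomial size. -/
theorem foldl_of_take {l : α → List β} {init : α → γ} {step : α → γ → β → γ} (hl : Poly l)
    (hi : Poly init) (hs : Poly fun q : α × γ × β => step q.1 q.2.1 q.2.2) (q : Polynomial ℕ)
    (hq : ∀ x j, esize (((l x).take j).foldl (step x) (init x)) ≤ q.eval (esize x)) :
    Poly (fun x => (l x).foldl (step x) (init x)) := by
  -- the state of the loop: the argument, the result so far, and the rest of the list
  let F : α × γ × List β → α × γ × List β := fun s =>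
    (s.1, s.2.2.head?.elim s.2.1 (step s.1 s.2.1), s.2.2.tail)
  let b : α × γ × List β → Bool := fun s => !s.2.2.isEmpty
  have hF : PolyD (fun s => enc s) (fun s => .node (boolData (b s)) (enc (F s))) := by
    refine PolyD.pair (f := fun s => boolData (b s)) (g := fun s => enc (F s)) ?_ ?_
    · exact (by fun_prop : Poly b)
    · have h₁ : PolyD (fun s => enc s) (fun s => enc (F s).1) :=
        (by fun_prop : Poly fun s : α × γ × List β => s.1)
      have h₂ : PolyD (fun s => enc s) (fun s => enc (F s).2.1) := by
        have h : PolyD (fun s => enc s) (fun s => bif b s then enc (F s).2.1 else enc s.2.1) := by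
          refine PolyD.cond (by fun_prop : Poly b) ?_
            (PolyD.reindex _ (by fun_prop : Poly fun s : α × γ × List β => s.2.1))
          have hne : ∀ i : {s // b s = true}, i.1.2.2 ≠ [] := by
            rintro ⟨s, hs⟩ h
            replace h : s.2.2 = [] := h
            simp [b, h] at hs
          have h : PolyD (fun i : {s // b s = true} => enc i.1)
              (fun i => enc ((i.1.1, i.1.2.1, i.1.2.2.head (hne i)) : α × γ × β)) := by
            have h' : PolyD (fun s : α × γ × List β => enc s)
                (fun s => .node (enc s.1) (.node (enc s.2.1) (enc s.2.2).left)) :=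
              PolyD.pair (by fun_prop : Poly fun s : α × γ × List β => s.1)
                (PolyD.pair (by fun_prop : Poly fun s : α × γ × List β => s.2.1)
                  (PolyD.left (by fun_prop : Poly fun s : α × γ × List β => s.2.2)))
            refine PolyD.congr (PolyD.reindex _ h') fun i => ?_
            have := hne i
            rcases i with ⟨⟨x, acc, _ | ⟨a, l⟩⟩, hi⟩
            · simp at this
            · rfl
          refine PolyD.congr (h.comp (PolyD.reindex (fun i : {s // b s = true} =>
            (i.1.1, i.1.2.1, i.1.2.2.head (hne i))) hs)) fun i => ?_
          have := hne i
          rcases i with ⟨⟨x, acc, _ | ⟨a, l⟩⟩, hi⟩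
          · simp at this
          · rfl
        refine PolyD.congr h fun s => ?_
        rcases s with ⟨x, acc, _ | ⟨a, l⟩⟩ <;> rfl
      have h₃ : PolyD (fun s => enc s) (fun s => enc (F s).2.2) :=
        (by fun_prop : Poly fun s : α × γ × List β => s.2.2.tail)
      exact h₁.pair (h₂.pair h₃)
  have hit : ∀ x j, F^[j] (x, init x, l x) =
      (x, ((l x).take j).foldl (step x) (init x), (l x).drop j) := by
    intro x j
    induction j with
    | zero => simp
    | succ j ih =>
      rw [Function.iterate_succ_apply', ih]
      simp only [F, List.tail_drop, Prod.mk.injEq, true_and, and_true]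
      rw [List.head?_drop]
      rcases lt_or_ge j (l x).length with h | h
      · rw [List.getElem?_eq_getElem h, Option.elim_some, List.take_succ_eq_append_getElem h,
          List.foldl_append]
        rfl
      · rw [List.getElem?_eq_none h, Option.elim_none, List.take_of_length_le h,
          List.take_of_length_le (by lia)]
  have h := PolyD.doWhile hF (fun x => (x, init x, l x)) (fun x => (l x).length)
    (q + Polynomial.X) ?_ ?_ ?_ ?_
  · refine PolyD.congr (PolyD.left (PolyD.right (PolyD.comp
      (by fun_prop : Poly fun x => (x, init x, l x)) h))) ?_
    intro x
    change enc (F^[(l x).length + 1] (x, init x, l x)).2.1 = _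
    rw [hit, List.take_of_length_le (by lia)]
  · intro x
    have h1 : (l x).length ≤ esize (l x) := length_le_esize _
    have h2 : esize (x, init x, l x) = esize x + (esize (init x) + esize (l x) + 1) + 1 := by simp
    change _ ≤ Polynomial.eval (esize (x, init x, l x)) _
    simp only [Polynomial.eval_add, Polynomial.eval_X]
    lia
  · intro x j _
    rw [hit]
    change esize (x, _, _) ≤ Polynomial.eval (esize (x, init x, l x)) _
    have h1 := hq x j
    have h2 := eval_mono q (show esize x ≤ esize (x, init x, l x) by simp; lia)
    have h3 := esize_drop_le (l x) j
    simp only [Polynomial.eval_add, Polynomial.eval_X]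
    rw [esize_prod (x, _, _), esize_prod (_, _)]
    have h4 := esize_prod (x, init x, l x)
    rw [esize_prod (init x, l x)] at h4
    dsimp only at h4 ⊢
    lia
  · intro x j hj
    rw [hit]
    simpa [b] using hj
  · intro x
    rw [hit]
    simp [b]

/-- A fold is computable in polynomial time if its step is, and every step increases the size by a
polynomially bounded amount, where the size is measured by an upper bound `μ`. -/
theorem foldl_of_le {l : α → List β} {init : α → γ} {step : α → γ → β → γ} (hl : Poly l)
    (hi : Poly init) (hs : Poly fun q : α × γ × β => step q.1 q.2.1 q.2.2) (μ : γ → ℕ)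
    (hμ : ∀ c, esize c ≤ μ c) (q : Polynomial ℕ) (hμi : ∀ x, μ (init x) ≤ q.eval (esize x))
    (hμs : ∀ x c, ∀ b ∈ l x, μ (step x c b) ≤ μ c + q.eval (esize x)) :
    Poly (fun x => (l x).foldl (step x) (init x)) := by
  obtain ⟨r, hr⟩ := hl.exists_esize_le
  refine foldl_of_take hl hi hs (q + r * q) fun x j => ?_
  have key : ∀ (l' : List β) (c : γ), (∀ b ∈ l', b ∈ l x) →
      μ (l'.foldl (step x) c) ≤ μ c + l'.length * q.eval (esize x) := by
    intro l'
    induction l' with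
    | nil => simp
    | cons b l' ih =>
      intro c h
      have h1 := hμs x c b (h b List.mem_cons_self)
      have h2 := ih (step x c b) fun b hb => h b (List.mem_cons_of_mem _ hb)
      simp only [List.foldl_cons, List.length_cons]
      lia
  have h1 := key ((l x).take j) (init x) fun b hb => List.mem_of_mem_take hb
  have h2 : ((l x).take j).length ≤ r.eval (esize x) :=
    (by simp : ((l x).take j).length ≤ (l x).length).trans ((length_le_esize _).trans (hr x))
  have h3 := Nat.mul_le_mul_right (q.eval (esize x)) h2
  have h4 := hμi x
  simp only [Polynomial.eval_add, Polynomial.eval_mul]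
  exact (hμ _).trans (by lia)

@[fun_prop]
theorem reverse {f : α → List β} (hf : Poly f) : Poly (fun x => (f x).reverse) := by
  obtain ⟨r, hr⟩ := hf.exists_esize_le
  have h : Poly (fun x => (f x).foldl (fun l b => b :: l) []) := by
    refine foldl_of_le hf (by fun_prop) (by fun_prop) esize (fun _ => le_rfl) (r + 1) ?_ ?_
    · simp
    · intro x c b hb
      have := (esize_le_of_mem hb).trans (hr x)
      simp
      lia
  simpa using h

@[fun_prop]
theorem append {f g : α → List β} (hf : Poly f) (hg : Poly g) : Poly (fun x => f x ++ g x) := by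
  obtain ⟨r, hr⟩ := hf.reverse.exists_esize_le
  obtain ⟨r', hr'⟩ := hg.exists_esize_le
  have h : Poly (fun x => (f x).reverse.foldl (fun l b => b :: l) (g x)) := by
    refine foldl_of_le hf.reverse (by fun_prop) (by fun_prop) esize (fun _ => le_rfl)
      (r + r' + 1) ?_ ?_
    · intro x
      have := hr' x
      simp
      lia
    · intro x c b hb
      have := (esize_le_of_mem hb).trans (hr x)
      simp
      lia
  simpa using h

@[fun_prop]
theorem flatMap {f : α → List β} {g : α → β → List γ} (hf : Poly f)
    (hg : Poly fun q : α × β => g q.1 q.2) : Poly (fun x => (f x).flatMap (g x)) := by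
  obtain ⟨r, hr⟩ := hf.exists_esize_le
  obtain ⟨r', hr'⟩ := hg.exists_esize_le
  have h : Poly (fun x => (f x).foldl (fun l b => l ++ g x b) []) := by
    refine foldl_of_le hf (by fun_prop) ?_ esize (fun _ => le_rfl)
      (1 + r'.comp (Polynomial.X + r + 1)) ?_ ?_
    · have : Poly fun q : α × List γ × β => g q.1 q.2.2 :=
        hg.comp (g := fun q : α × List γ × β => (q.1, q.2.2)) (by fun_prop)
      fun_prop
    · simp
    · intro x c b hb
      have h1 := (esize_le_of_mem hb).trans (hr x)
      have h2 := hr' (x, b)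
      have h3 := eval_mono r' (show esize (x, b) ≤ esize x + r.eval (esize x) + 1 by simp; lia)
      have h4 := esize_append c (g x b)
      simp
      lia
  refine of_enc_eq h fun x => ?_
  rw [List.flatMap_eq_foldl]

@[fun_prop]
theorem map {f : α → List β} {g : α → β → γ} (hf : Poly f)
    (hg : Poly fun q : α × β => g q.1 q.2) : Poly (fun x => (f x).map (g x)) := by
  have : Poly (fun x => (f x).flatMap fun b => [g x b]) := by fun_prop
  simpa [List.map_eq_flatMap] using this

@[fun_prop]
theorem filter {f : α → List β} {g : α → β → Bool} (hf : Poly f)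
    (hg : Poly fun q : α × β => g q.1 q.2) : Poly (fun x => (f x).filter (g x)) := by
  have : Poly (fun x => (f x).flatMap fun b => bif g x b then [b] else []) := by fun_prop
  refine of_enc_eq this fun x => ?_
  congr 1
  induction f x with
  | nil => rfl
  | cons b l ih => cases h : g x b <;> simp [h, ih]

@[fun_prop]
theorem any {f : α → List β} {g : α → β → Bool} (hf : Poly f)
    (hg : Poly fun q : α × β => g q.1 q.2) : Poly (fun x => (f x).any (g x)) := by
  have : Poly (fun x => !((f x).filter (g x)).isEmpty) := by fun_prop
  refine of_enc_eq this fun x => ?_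
  congr 1
  induction f x with
  | nil => rfl
  | cons b l ih => cases h : g x b <;> simp [h, ih]

end Poly

end StackProg

/-! ### Binary arithmetic in polynomial time -/

namespace StackProg

open Enc (enc)

/-- The number with the given binary digits, most significant digit first. -/
def ofDigits (l : List Bool) : ℕ := l.foldl (fun n b => Nat.bit b n) 0

theorem foldl_bit (l : List Bool) (n : ℕ) :
    l.foldl (fun n b => Nat.bit b n) n = 2 ^ l.length * n + ofDigits l := by
  induction l generalizing n with
  | nil => simp [ofDigits]
  | cons b l ih =>
    rw [ofDigits, List.foldl_cons, List.foldl_cons, ih, ih (Nat.bit b 0), Nat.bit_val, Nat.bit_val,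
      List.length_cons]
    ring

theorem ofDigits_cons (b : Bool) (l : List Bool) :
    ofDigits (b :: l) = 2 ^ l.length * b.toNat + ofDigits l := by
  rw [ofDigits, List.foldl_cons, foldl_bit, Nat.bit_val]
  simp

theorem ofDigits_lt (l : List Bool) : ofDigits l < 2 ^ l.length := by
  induction l with
  | nil => simp [ofDigits]
  | cons b l ih =>
    rw [ofDigits_cons, List.length_cons, pow_succ]
    cases b <;> simp <;> lia

theorem bodd_add_div2 (n : ℕ) : n = 2 * n.div2 + n.bodd.toNat := by
  have := Nat.bodd_add_div2 n
  lia

theorem size_div2_le (n : ℕ) : n.div2.size ≤ n.size :=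
  Nat.size_le_size (by have := bodd_add_div2 n; lia)

/-- One step of binary addition on `(a, b, carry, digits)`. -/
def addStep (s : ℕ × ℕ × Bool × List Bool) : ℕ × ℕ × Bool × List Bool :=
  (s.1.div2, s.2.1.div2,
    (s.1.bodd && s.2.1.bodd) || (s.2.2.1 && (s.1.bodd || s.2.1.bodd)),
    (s.1.bodd ^^ (s.2.1.bodd ^^ s.2.2.1)) :: s.2.2.2)

/-- One step of binary subtraction on `(a, b, borrow, digits)`. -/
def subStep (s : ℕ × ℕ × Bool × List Bool) : ℕ × ℕ × Bool × List Bool :=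
  (s.1.div2, s.2.1.div2,
    (!s.1.bodd && (s.2.1.bodd || s.2.2.1)) || (s.2.1.bodd && s.2.2.1),
    (s.1.bodd ^^ (s.2.1.bodd ^^ s.2.2.1)) :: s.2.2.2)

/-- A list that is longer than the binary representations of two numbers. -/
def digitList (a b : ℕ) : List Bool := true :: (a.bits ++ b.bits)

theorem lt_two_pow_length (a b : ℕ) : a + b < 2 ^ (digitList a b).length := by
  have ha := Nat.lt_size_self a
  have hb := Nat.lt_size_self b
  rw [digitList, List.length_cons, List.length_append, Nat.size_eq_bits_len,
    Nat.size_eq_bits_len, pow_succ]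
  have h1 : 2 ^ a.size ≤ 2 ^ (a.size + b.size) := Nat.pow_le_pow_right (by simp) (by simp)
  have h2 : 2 ^ b.size ≤ 2 ^ (a.size + b.size) := Nat.pow_le_pow_right (by simp) (by simp)
  lia

/-- After any number of steps, the digits so far and the numbers and the carry that remain represent
the sum. -/
theorem foldl_addStep (a b : ℕ) :
    a + b = ofDigits ((digitList a b).foldl (fun s _ => addStep s) (a, b, false, [])).2.2.2 := by
  have key : ∀ (l : List Bool), ∃ a' b' c o,
      l.foldl (fun s _ => addStep s) (a, b, false, []) = (a', b', c, o) ∧ o.length = l.length ∧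
      a + b = ofDigits o + 2 ^ o.length * (a' + b' + c.toNat) := by
    intro l
    induction l using List.reverseRecOn with
    | nil => exact ⟨a, b, false, [], rfl, rfl, by simp [ofDigits]⟩
    | append_singleton l x ih =>
      obtain ⟨a', b', c, o, h1, h2, h3⟩ := ih
      rw [List.foldl_append, h1]
      refine ⟨_, _, _, _, rfl, by simp [h2], ?_⟩
      rw [h3, ofDigits_cons, List.length_cons]
      conv_lhs => rw [bodd_add_div2 a', bodd_add_div2 b']
      rw [pow_succ]
      cases a'.bodd <;> cases b'.bodd <;> cases c <;> simp <;> ring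
  obtain ⟨a', b', c, o, h1, h2, h3⟩ := key (digitList a b)
  have h4 := lt_two_pow_length a b
  have h5 : a' + b' + c.toNat = 0 := by
    rw [← h2] at h4
    by_contra h
    have := Nat.le_mul_of_pos_right (2 ^ o.length) (Nat.pos_of_ne_zero h)
    lia
  rw [h1, h3, h5]
  simp

/-- A borrow that remains at the end means that the second number is greater. -/
theorem foldl_subStep (a b : ℕ) :
    a - b = bif ((digitList a b).foldl (fun s _ => subStep s) (a, b, false, [])).2.2.1 then 0 else
      ofDigits ((digitList a b).foldl (fun s _ => subStep s) (a, b, false, [])).2.2.2 := by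
  have key : ∀ (l : List Bool), ∃ (a' b' : ℕ) (c : Bool) (o : List Bool),
      l.foldl (fun s _ => subStep s) (a, b, false, []) = (a', b', c, o) ∧ o.length = l.length ∧
      a + 2 ^ o.length * (b' + c.toNat) = b + ofDigits o + 2 ^ o.length * a' ∧
      2 ^ o.length * (a' + b') ≤ a + b := by
    intro l
    induction l using List.reverseRecOn with
    | nil => exact ⟨a, b, false, [], rfl, rfl, by simp [ofDigits]; ring, by simp⟩
    | append_singleton l x ih =>
      obtain ⟨a', b', c, o, h1, h2, h3, h4⟩ := ih
      rw [List.foldl_append, h1]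
      refine ⟨_, _, _, _, rfl, by simp [h2], ?_, ?_⟩
      · rw [ofDigits_cons, List.length_cons]
        rw [bodd_add_div2 a', bodd_add_div2 b'] at h3
        rw [pow_succ]
        revert h3
        generalize 2 ^ o.length = e
        generalize a'.div2 = x
        generalize b'.div2 = y
        cases a'.bodd <;> cases b'.bodd <;> cases c <;> simp <;> intro h3 <;> linarith
      · refine le_trans ?_ h4
        conv_rhs => rw [bodd_add_div2 a', bodd_add_div2 b']
        rw [List.length_cons, pow_succ, mul_assoc]
        gcongr
        lia
  obtain ⟨a', b', c, o, h1, h2, h3, h4⟩ := key (digitList a b)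
  have h5 := lt_two_pow_length a b
  have h6 : a' + b' = 0 := by
    rw [← h2] at h5
    by_contra h
    have := Nat.le_mul_of_pos_right (2 ^ o.length) (Nat.pos_of_ne_zero h)
    lia
  have h7 : a' = 0 := by lia
  have h8 : b' = 0 := by lia
  have h9 := ofDigits_lt o
  subst h7 h8
  rw [h1]
  cases c
  · simp at h3 ⊢
    lia
  · simp at h3 ⊢
    lia

variable {α β γ : Type} [Enc α] [Enc β] [Enc γ]

namespace Poly

@[fun_prop]
theorem bits {f : α → ℕ} (hf : Poly f) : Poly (fun x => (f x).bits) := of_enc_eq hf fun _ => rfl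

@[fun_prop]
theorem bodd {f : α → ℕ} (hf : Poly f) : Poly (fun x => (f x).bodd) := by
  refine of_enc_eq (g := fun x => (f x).bits.headD false) (by fun_prop) fun x => ?_
  rw [Nat.bodd_eq_bits_head]
  cases (f x).bits <;> rfl

@[fun_prop]
theorem div2 {f : α → ℕ} (hf : Poly f) : Poly (fun x => (f x).div2) := by
  refine of_enc_eq (g := fun x => (f x).bits.tail) (by fun_prop) fun x => ?_
  rw [← Nat.div2_bits_eq_tail]
  rfl

@[fun_prop]
theorem bit {b : α → Bool} {f : α → ℕ} (hb : Poly b) (hf : Poly f) :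
    Poly (fun x => Nat.bit (b x) (f x)) := by
  refine of_enc_eq (g := fun x => bif (f x).bits.isEmpty && !b x then [] else b x :: (f x).bits)
    (by fun_prop) fun x => ?_
  change _ = enc (Nat.bit (b x) (f x)).bits
  congr 1
  rcases Nat.eq_zero_or_pos (f x) with h | h
  · cases b x <;> simp [h]
  · rw [Nat.bits_append_bit _ _ (by lia)]
    have h' : (f x).bits.isEmpty = false := by
      have h₁ := Nat.size_eq_bits_len (f x)
      have h₂ := Nat.size_pos.2 h
      cases hl : (f x).bits
      · rw [hl] at h₁
        simp at h₁
        lia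
      · rfl
    rw [h']
    rfl

@[fun_prop]
theorem ofDigits {f : α → List Bool} (hf : Poly f) : Poly (fun x => ofDigits (f x)) := by
  unfold StackProg.ofDigits
  refine foldl_of_le hf (by fun_prop) (by fun_prop) (fun n => 4 * n.size + 1) esize_nat_le 4 ?_ ?_
  · simp
  · intro x n b _
    have : (Nat.bit b n).size ≤ n.size + 1 := by
      rw [Nat.size_le, Nat.bit_val, pow_succ]
      have := Nat.lt_size_self n
      cases b <;> simp <;> lia
    simp
    lia

/-- Folds that halve two numbers and produce one digit in each step have intermediate results of
polynomial size. -/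
theorem foldl_digitStep {f g : α → ℕ} (hf : Poly f) (hg : Poly g)
    {step : ℕ × ℕ × Bool × List Bool → ℕ × ℕ × Bool × List Bool} (hs : Poly step)
    (h1 : ∀ s, (step s).1 = s.1.div2) (h2 : ∀ s, (step s).2.1 = s.2.1.div2)
    (h3 : ∀ s, (step s).2.2.2.tail = s.2.2.2) :
    Poly (fun x => (digitList (f x) (g x)).foldl (fun s _ => step s) (f x, g x, false, [])) := by
  obtain ⟨r, hr⟩ := hf.exists_esize_le
  obtain ⟨r', hr'⟩ := hg.exists_esize_le
  refine foldl_of_le (by unfold digitList; fun_prop) (by fun_prop) (by fun_prop)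
    (fun s => 4 * s.1.size + 4 * s.2.1.size + esize s.2.2.2 + 8) ?_ (4 * r + 4 * r' + 9) ?_ ?_
  · intro s
    have h1 := esize_nat_le s.1
    have h2 := esize_nat_le s.2.1
    have h3 := esize_bool_le s.2.2.1
    simp
    lia
  · intro x
    have h1 := size_le_esize_nat (f x)
    have h2 := size_le_esize_nat (g x)
    have h3 := hr x
    have h4 := hr' x
    simp
    lia
  · intro x s b _
    have h5 := size_div2_le s.1
    have h6 := size_div2_le s.2.1
    have h7 : esize (step s).2.2.2 ≤ esize s.2.2.2 + 4 := by
      rw [← h3 s]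
      cases (step s).2.2.2 with
      | nil => simp
      | cons b l =>
        have := esize_bool_le b
        simp
        lia
    rw [h1, h2]
    simp
    lia

@[fun_prop]
theorem add {f g : α → ℕ} (hf : Poly f) (hg : Poly g) : Poly (fun x => f x + g x) := by
  simp only [foldl_addStep]
  have := foldl_digitStep hf hg (step := addStep) (by unfold addStep; fun_prop) (fun _ => rfl)
    (fun _ => rfl) (fun _ => rfl)
  fun_prop

@[fun_prop]
theorem sub {f g : α → ℕ} (hf : Poly f) (hg : Poly g) : Poly (fun x => f x - g x) := by
  simp only [foldl_subStep]
  have := foldl_digitStep hf hg (step := subStep) (by unfold subStep; fun_prop) (fun _ => rfl)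
    (fun _ => rfl) (fun _ => rfl)
  fun_prop

@[fun_prop]
theorem ble {f g : α → ℕ} (hf : Poly f) (hg : Poly g) : Poly (fun x => (f x).ble (g x)) := by
  refine of_enc_eq (g := fun x => (f x - g x).bits.isEmpty) (by fun_prop) fun x => ?_
  congr 1
  rw [Bool.eq_iff_iff, Nat.ble_eq, ← Nat.sub_eq_zero_iff_le, List.isEmpty_iff,
    ← List.length_eq_zero_iff, Nat.size_eq_bits_len, Nat.size_eq_zero]

@[fun_prop]
theorem beq {f g : α → ℕ} (hf : Poly f) (hg : Poly g) : Poly (fun x => f x == g x) := by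
  refine of_enc_eq (g := fun x => (f x).ble (g x) && (g x).ble (f x)) (by fun_prop) fun x => ?_
  congr 1
  rw [Bool.eq_iff_iff, Bool.and_eq_true, Nat.ble_eq, Nat.ble_eq, beq_iff_eq]
  lia

end Poly

/-- One step of splitting a list, on `(number of elements to take, taken, left)`, where the two
sublists are reversed. -/
def splitStep {β : Type} (s : ℕ × List β × List β) (b : β) : ℕ × List β × List β :=
  bif s.1 == 0 then (0, s.2.1, b :: s.2.2) else (s.1 - 1, b :: s.2.1, s.2.2)

theorem foldl_splitStep {β : Type} (l : List β) (n : ℕ) :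
    l.foldl splitStep (n, [], []) = (n - l.length, (l.take n).reverse, (l.drop n).reverse) := by
  induction l using List.reverseRecOn with
  | nil => simp
  | append_singleton l b ih =>
    rw [List.foldl_append, ih]
    rcases lt_or_ge l.length n with h | h
    · obtain ⟨j, hj⟩ : ∃ j, n - l.length = j + 1 := ⟨n - l.length - 1, by lia⟩
      have hj' : n - (l.length + 1) = j := by lia
      simp [splitStep, hj, hj', List.take_append, List.drop_append, List.take_of_length_le h.le,
        List.drop_of_length_le h.le]
    · have h0 : n - l.length = 0 := by lia
      simp [splitStep, h0, List.take_append, List.drop_append]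
      lia

namespace Poly

theorem split {f : α → List β} {n : α → ℕ} (hf : Poly f) (hn : Poly n) :
    Poly (fun x => (f x).foldl splitStep (n x, [], [])) := by
  obtain ⟨r, hr⟩ := hf.exists_esize_le
  obtain ⟨r', hr'⟩ := hn.exists_esize_le
  refine foldl_of_le hf (by fun_prop) (by unfold splitStep; fun_prop)
    (fun s => 4 * s.1.size + esize s.2.1 + esize s.2.2 + 3) ?_ (4 * r' + r + 6) ?_ ?_
  · intro s
    have := esize_nat_le s.1
    simp
    lia
  · intro x
    have h1 := size_le_esize_nat (n x)
    have h2 := hr' x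
    simp
    lia
  · intro x s b hb
    have h1 := (esize_le_of_mem hb).trans (hr x)
    have h2 : (s.1 - 1).size ≤ s.1.size := Nat.size_le_size (by lia)
    unfold splitStep
    cases s.1 == 0 <;> simp <;> lia

@[fun_prop]
theorem take {f : α → List β} {n : α → ℕ} (hf : Poly f) (hn : Poly n) :
    Poly (fun x => (f x).take (n x)) := by
  have := split hf hn
  have h : Poly (fun x => ((f x).foldl splitStep (n x, [], [])).2.1.reverse) := by fun_prop
  simpa only [foldl_splitStep, List.reverse_reverse] using h

@[fun_prop]
theorem drop {f : α → List β} {n : α → ℕ} (hf : Poly f) (hn : Poly n) :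
    Poly (fun x => (f x).drop (n x)) := by
  have := split hf hn
  have h : Poly (fun x => ((f x).foldl splitStep (n x, [], [])).2.2.reverse) := by fun_prop
  simpa only [foldl_splitStep, List.reverse_reverse] using h

end Poly

end StackProg

/-! ### Minimum-cost flows of unit-capacity networks: the algorithm -/

namespace Flow

/-- An arc of a network with unit capacities, together with the state of the algorithm: whether the
arc carries flow, and the reduced cost of the corresponding arc of the residual network. -/
structure Arc where
  /-- the name of the arc -/
  key : ℕ
  /-- where the arc starts -/
  src : ℕ
  /-- where the arc ends -/
  dst : ℕ
  /-- the cost of one unit of flow -/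
  price : ℕ
  /-- whether the arc carries flow -/
  used : Bool
  /-- the reduced cost of the residual arc, which is never negative -/
  red : ℕ

/-- The start of the residual arc: an arc that carries flow is reversed. -/
def Arc.tail (e : Arc) : ℕ := bif e.used then e.dst else e.src

/-- The end of the residual arc. -/
def Arc.head (e : Arc) : ℕ := bif e.used then e.src else e.dst

/-- A search tree: a list of the vertices reached so far, each with the keys of the arcs on the path
by which it was reached. -/
abbrev Reached : Type := List (ℕ × List ℕ)

/-- Whether a vertex has been reached. -/
def reached (S : Reached) (v : ℕ) : Bool := S.any fun q => q.1 == v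

/-- The keys of the arcs on the path to a vertex (none if the vertex has not been reached). -/
def pathTo (S : Reached) (v : ℕ) : List ℕ := ((S.filter fun q => q.1 == v).headD (0, [])).2

/-- Whether a residual arc leaves the set of the vertices reached. -/
def leaves (S : Reached) (e : Arc) : Bool := reached S e.tail && !reached S e.head

/-- The residual arcs of minimum reduced cost among those that leave the set of vertices reached. -/
def cheapest (L : List Arc) (S : Reached) : List Arc :=
  (L.filter fun e => leaves S e).filter fun e =>
    !(L.filter fun e => leaves S e).any fun e' => !e.red.ble e'.red

/-- The reduced cost of an arc after the potential of all vertices reached has been lowered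
by `ε`. -/
def shift (S : Reached) (ε : ℕ) (e : Arc) : Arc :=
  ⟨e.key, e.src, e.dst, e.price, e.used,
    bif leaves S e then e.red - ε else
    bif reached S e.head && !reached S e.tail then e.red + ε else e.red⟩

/-- Lower the potential of the vertices reached until another vertex can be reached by an arc of
reduced cost zero, and add that vertex. -/
def growStep (t : List Arc × Reached) : List Arc × Reached :=
  bif (cheapest t.1 t.2).isEmpty then t else
    (t.1.map (shift t.2 ((cheapest t.1 t.2).headD ⟨0, 0, 0, 0, false, 0⟩).red),
      (((cheapest t.1 t.2).headD ⟨0, 0, 0, 0, false, 0⟩).head,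
        ((cheapest t.1 t.2).headD ⟨0, 0, 0, 0, false, 0⟩).key ::
          pathTo t.2 ((cheapest t.1 t.2).headD ⟨0, 0, 0, 0, false, 0⟩).tail) :: t.2)

/-- Search from the vertex `s`, with as many steps as there are arcs. -/
def grow (L : List Arc) (s : ℕ) : List Arc × Reached :=
  L.foldl (fun t _ => growStep t) (L, [(s, [])])

/-- Change the flow along the path with the given keys. -/
def flipArc (P : List ℕ) (e : Arc) : Arc :=
  ⟨e.key, e.src, e.dst, e.price, e.used ^^ P.any fun i => i == e.key, e.red⟩

/-- Send one more unit of flow from `s` to `t`; the flag says whether all units could be sent. -/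
def augment (s t : ℕ) (x : Bool × List Arc) : Bool × List Arc :=
  (x.1 && reached (grow x.2 s).2 t, (grow x.2 s).1.map (flipArc (pathTo (grow x.2 s).2 t)))

/-- Send as many units of flow from `s` to `t` as the list `F` has elements. -/
def solve {β : Type} (L : List Arc) (s t : ℕ) (F : List β) : Bool × List Arc :=
  F.foldl (fun x _ => augment s t x) (true, L)

/-- The cost of the flow. -/
def cost (L : List Arc) : ℕ := (L.filter fun e => e.used).foldl (fun n e => n + e.price) 0

end Flow

namespace StackProg

open Enc (enc)
open Flow

instance : Enc Arc := ⟨fun e => enc (e.key, e.src, e.dst, e.price, e.used, e.red)⟩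

theorem esize_arc (e : Arc) : esize e = esize (e.key, e.src, e.dst, e.price, e.used, e.red) := rfl

variable {α β γ : Type} [Enc α] [Enc β] [Enc γ]

namespace Poly

@[fun_prop]
theorem arcMk {f₁ f₂ f₃ f₄ : α → ℕ} {f₅ : α → Bool} {f₆ : α → ℕ} (h₁ : Poly f₁) (h₂ : Poly f₂)
    (h₃ : Poly f₃) (h₄ : Poly f₄) (h₅ : Poly f₅) (h₆ : Poly f₆) :
    Poly (fun x => Arc.mk (f₁ x) (f₂ x) (f₃ x) (f₄ x) (f₅ x) (f₆ x)) :=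
  of_enc_eq (g := fun x => (f₁ x, f₂ x, f₃ x, f₄ x, f₅ x, f₆ x)) (by fun_prop) fun _ => rfl

theorem arcTuple {f : α → Arc} (hf : Poly f) : Poly (fun x =>
    ((f x).key, (f x).src, (f x).dst, (f x).price, (f x).used, (f x).red)) :=
  of_enc_eq hf fun _ => rfl

@[fun_prop]
theorem arcKey {f : α → Arc} (hf : Poly f) : Poly (fun x => (f x).key) := hf.arcTuple.fst

@[fun_prop]
theorem arcSrc {f : α → Arc} (hf : Poly f) : Poly (fun x => (f x).src) := hf.arcTuple.snd.fst

@[fun_prop]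
theorem arcDst {f : α → Arc} (hf : Poly f) : Poly (fun x => (f x).dst) := hf.arcTuple.snd.snd.fst

@[fun_prop]
theorem arcPrice {f : α → Arc} (hf : Poly f) : Poly (fun x => (f x).price) :=
  hf.arcTuple.snd.snd.snd.fst

@[fun_prop]
theorem arcUsed {f : α → Arc} (hf : Poly f) : Poly (fun x => (f x).used) :=
  hf.arcTuple.snd.snd.snd.snd.fst

@[fun_prop]
theorem arcRed {f : α → Arc} (hf : Poly f) : Poly (fun x => (f x).red) :=
  hf.arcTuple.snd.snd.snd.snd.snd

@[fun_prop]
theorem arcTail {f : α → Arc} (hf : Poly f) : Poly (fun x => (f x).tail) := by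
  unfold Arc.tail
  fun_prop

@[fun_prop]
theorem arcHead {f : α → Arc} (hf : Poly f) : Poly (fun x => (f x).head) := by
  unfold Arc.head
  fun_prop

@[fun_prop]
theorem reached {S : α → Reached} {v : α → ℕ} (hS : Poly S) (hv : Poly v) :
    Poly (fun x => reached (S x) (v x)) := by
  unfold Flow.reached
  fun_prop

@[fun_prop]
theorem pathTo {S : α → Reached} {v : α → ℕ} (hS : Poly S) (hv : Poly v) :
    Poly (fun x => pathTo (S x) (v x)) := by
  unfold Flow.pathTo
  fun_prop

@[fun_prop]
theorem leaves {S : α → Reached} {e : α → Arc} (hS : Poly S) (he : Poly e) :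
    Poly (fun x => leaves (S x) (e x)) := by
  unfold Flow.leaves
  fun_prop

@[fun_prop]
theorem cheapest {L : α → List Arc} {S : α → Reached} (hL : Poly L) (hS : Poly S) :
    Poly (fun x => cheapest (L x) (S x)) := by
  unfold Flow.cheapest
  fun_prop

@[fun_prop]
theorem shift {S : α → Reached} {ε : α → ℕ} {e : α → Arc} (hS : Poly S) (hε : Poly ε)
    (he : Poly e) : Poly (fun x => shift (S x) (ε x) (e x)) := by
  unfold Flow.shift
  fun_prop

@[fun_prop]
theorem growStep {t : α → List Arc × Reached} (ht : Poly t) : Poly (fun x => growStep (t x)) := by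
  unfold Flow.growStep
  fun_prop

@[fun_prop]
theorem flipArc {P : α → List ℕ} {e : α → Arc} (hP : Poly P) (he : Poly e) :
    Poly (fun x => flipArc (P x) (e x)) := by
  unfold Flow.flipArc
  fun_prop

end Poly

end StackProg

/-! ### Minimum-cost flows of unit-capacity networks: the running time -/

namespace Flow

open StackProg StackProg.Enc

/-- A list of `n` arcs whose names, ends and prices have size at most `K`, and whose reduced costs
have at most `R` binary digits. -/
def Small (n K R : ℕ) (L : List Arc) : Prop :=
  L.length = n ∧ ∀ e ∈ L, (esize e.key ≤ K ∧ esize e.src ≤ K ∧ esize e.dst ≤ K ∧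
    esize e.price ≤ K) ∧ e.red.size ≤ R

/-- A search tree with at most `i + 1` vertices, paths of length at most `i`, and names of size at
most `K`. -/
def SmallTree (K i : ℕ) (S : Reached) : Prop :=
  S.length ≤ i + 1 ∧ ∀ q ∈ S, esize q.1 ≤ K ∧ q.2.length ≤ i ∧ ∀ k ∈ q.2, esize k ≤ K

variable {n K R i : ℕ} {L : List Arc} {S : Reached}

theorem Small.mono {R' : ℕ} (h : Small n K R L) (hR : R ≤ R') : Small n K R' L :=
  ⟨h.1, fun e he => ⟨(h.2 e he).1, (h.2 e he).2.trans hR⟩⟩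

theorem SmallTree.mono {i' : ℕ} (h : SmallTree K i S) (hi : i ≤ i') : SmallTree K i' S :=
  ⟨h.1.trans (by lia), fun q hq => ⟨(h.2 q hq).1, (h.2 q hq).2.1.trans hi, (h.2 q hq).2.2⟩⟩

theorem Small.map (h : Small n K R L) {f : Arc → Arc} {R' : ℕ}
    (hf : ∀ e ∈ L, (f e).key = e.key ∧ (f e).src = e.src ∧ (f e).dst = e.dst ∧
      (f e).price = e.price ∧ (f e).red.size ≤ R') : Small n K R' (L.map f) := by
  refine ⟨by simpa using h.1, fun e he => ?_⟩
  obtain ⟨a, ha, rfl⟩ := List.mem_map.1 he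
  obtain ⟨h1, h2, h3, h4, h5⟩ := hf a ha
  rw [h1, h2, h3, h4]
  exact ⟨(h.2 a ha).1, h5⟩

theorem Small.esize_le (h : Small n K R L) : esize L ≤ n * (4 * K + 4 * R + 10) + 1 := by
  rw [← h.1]
  refine esize_le_of_forall (B := 4 * K + 4 * R + 9) fun e he => ?_
  obtain ⟨⟨h1, h2, h3, h4⟩, h5⟩ := h.2 e he
  have h6 := esize_bool_le e.used
  have h7 := esize_nat_le e.red
  rw [esize_arc]
  simp
  lia

theorem SmallTree.esize_le (h : SmallTree K i S) :
    esize S ≤ (i + 1) * (K + i * (K + 1) + 3) + 1 := by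
  refine (esize_le_of_forall (B := K + i * (K + 1) + 2) fun q hq => ?_).trans ?_
  · obtain ⟨h1, h2, h3⟩ := h.2 q hq
    have h4 := esize_le_of_forall h3
    have h5 := Nat.mul_le_mul_right (K + 1) h2
    simp
    lia
  · gcongr
    exact h.1

theorem cheapest_subset {e : Arc} (h : e ∈ cheapest L S) : e ∈ L :=
  (List.mem_filter.1 (List.mem_filter.1 h).1).1

theorem pathTo_mem (S : Reached) (v : ℕ) :
    pathTo S v = [] ∨ ∃ q ∈ S, q.1 = v ∧ pathTo S v = q.2 := by
  unfold pathTo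
  cases h : S.filter fun q => q.1 == v with
  | nil => exact .inl rfl
  | cons q l =>
    have hq : q ∈ S.filter fun q => q.1 == v := by rw [h]; simp
    exact .inr ⟨q, (List.mem_filter.1 hq).1, by simpa using (List.mem_filter.1 hq).2, rfl⟩

/-- A step of the search either does nothing, or it is performed with an arc of minimum reduced
cost. -/
theorem growStep_cases (L : List Arc) (S : Reached) :
    (cheapest L S = [] ∧ growStep (L, S) = (L, S)) ∨ ∃ e ∈ cheapest L S,
      growStep (L, S) = (L.map (shift S e.red), (e.head, e.key :: pathTo S e.tail) :: S) := by
  cases h : cheapest L S with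
  | nil => exact .inl ⟨rfl, by simp [growStep, h]⟩
  | cons e l => exact .inr ⟨e, by simp, by simp [growStep, h]⟩

theorem esize_end_le {e : Arc} (h : Small n K R L) (he : e ∈ L) : esize e.head ≤ K := by
  obtain ⟨⟨h1, h2, h3, h4⟩, h5⟩ := h.2 e he
  cases hu : e.used <;> simpa [Arc.head, hu]

/-- The reduced costs change by the value of another reduced cost, and thus become at most one digit
longer. -/
theorem small_growStep {t : List Arc × Reached} (h : Small n K R t.1) :
    Small n K (R + 1) (growStep t).1 := by
  obtain ⟨L, S⟩ := t
  rcases growStep_cases L S with ⟨_, hg⟩ | ⟨e, he, hg⟩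
  · rw [hg]
    exact h.mono (by lia)
  · rw [hg]
    refine h.map fun a ha => ⟨rfl, rfl, rfl, rfl, ?_⟩
    have h1 := Nat.size_le.1 (h.2 a ha).2
    have h2 := Nat.size_le.1 (h.2 e (cheapest_subset he)).2
    rw [Nat.size_le, pow_succ]
    unfold shift
    cases leaves S a <;> cases reached S a.head && !reached S a.tail <;> simp <;> lia

theorem smallTree_growStep {t : List Arc × Reached} (h : Small n K R t.1)
    (h' : SmallTree K i t.2) : SmallTree K (i + 1) (growStep t).2 := by
  obtain ⟨L, S⟩ := t
  rcases growStep_cases L S with ⟨_, hg⟩ | ⟨e, he, hg⟩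
  · rw [hg]
    exact h'.mono (by lia)
  · have heL := cheapest_subset he
    rw [hg]
    refine ⟨by simpa using h'.1, fun q hq => ?_⟩
    rcases List.mem_cons.1 hq with rfl | hq
    · refine ⟨esize_end_le h heL, ?_, ?_⟩
      · rcases pathTo_mem S e.tail with h0 | ⟨q, hq, _, h0⟩
        · simp [h0]
        · simpa [h0] using (h'.2 q hq).2.1
      · intro k hk
        rcases List.mem_cons.1 hk with rfl | hk
        · exact (h.2 e heL).1.1
        · rcases pathTo_mem S e.tail with h0 | ⟨q, hq, _, h0⟩
          · simp [h0] at hk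
          · rw [h0] at hk
            exact (h'.2 q hq).2.2 k hk
    · exact (h'.mono (Nat.le_succ i)).2 q hq

theorem small_foldl_growStep {β : Type} (l : List β) {t : List Arc × Reached}
    (h : Small n K R t.1) : Small n K (R + l.length) (l.foldl (fun t _ => growStep t) t).1 := by
  induction l generalizing t R with
  | nil => exact h
  | cons b l ih => exact (ih (small_growStep h)).mono (by simp; lia)

theorem smallTree_foldl_growStep {β : Type} (l : List β) {t : List Arc × Reached}
    (h : Small n K R t.1) (h' : SmallTree K i t.2) :
    SmallTree K (i + l.length) (l.foldl (fun t _ => growStep t) t).2 := by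
  induction l generalizing t R i with
  | nil => exact h'
  | cons b l ih =>
    exact (ih (small_growStep h) (smallTree_growStep h h')).mono (by simp; lia)

theorem smallTree_singleton {s : ℕ} (hs : esize s ≤ K) : SmallTree K 0 [(s, [])] := by
  simpa [SmallTree] using hs

theorem small_self (L : List Arc) : Small L.length (esize L) (esize L) L := by
  refine ⟨rfl, fun e he => ?_⟩
  have h1 := esize_le_of_mem he
  have h2 := size_le_esize_nat e.red
  rw [esize_arc] at h1
  simp at h1
  lia

theorem small_augment {s t : ℕ} {x : Bool × List Arc} (h : Small n K R x.2) :
    Small n K (R + n) (augment s t x).2 := by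
  have h1 : Small n K (R + n) (grow x.2 s).1 := by
    have := small_foldl_growStep x.2 h (t := (x.2, [(s, [])]))
    rwa [h.1] at this
  exact h1.map fun e he => ⟨rfl, rfl, rfl, rfl, (h1.2 e he).2⟩

theorem small_solve {β : Type} (s t : ℕ) (F : List β) {x : Bool × List Arc} (h : Small n K R x.2) :
    Small n K (R + F.length * n) (F.foldl (fun x _ => augment s t x) x).2 := by
  induction F generalizing x R with
  | nil => simpa using h
  | cons b F ih =>
    exact (ih (small_augment h (s := s) (t := t))).mono (by simp; lia)

end Flow

namespace StackProg

open Enc (enc)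
open Flow

variable {α β γ : Type} [Enc α] [Enc β] [Enc γ]

namespace Poly

@[fun_prop]
theorem grow {L : α → List Arc} {s : α → ℕ} (hL : Poly L) (hs : Poly s) :
    Poly (fun x => grow (L x) (s x)) := by
  obtain ⟨r, hr⟩ := hL.exists_esize_le
  obtain ⟨r', hr'⟩ := hs.exists_esize_le
  let k : Polynomial ℕ := r + r'
  refine foldl_of_take hL (by fun_prop) (by fun_prop)
    (k * (4 * k + 4 * (k + k) + 10) + 1 + ((k + 1) * (k + k * (k + 1) + 3) + 1) + 1) fun x j => ?_
  have h1 := hr x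
  have h2 := hr' x
  have h0 : k.eval (esize x) = r.eval (esize x) + r'.eval (esize x) := by simp [k]
  generalize hk : k.eval (esize x) = kx at h0
  have hlen : (L x).length ≤ kx := (length_le_esize _).trans (by lia)
  have h3 : Small (L x).length kx kx (L x) := by
    refine ⟨rfl, fun e he => ?_⟩
    have := (small_self (L x)).2 e he
    lia
  have h4 := small_foldl_growStep ((L x).take j) (t := (L x, [(s x, [])])) h3
  have h5 := smallTree_foldl_growStep ((L x).take j) (t := (L x, [(s x, [])])) h3
    (smallTree_singleton (by lia))
  have hj : ((L x).take j).length ≤ kx := by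
    rw [List.length_take]
    lia
  have h6 := (h4.mono (R' := kx + kx) (by lia)).esize_le
  have h7 := (h5.mono (i' := kx) (by lia)).esize_le
  have h8 : (L x).length * (4 * kx + 4 * (kx + kx) + 10) + 1 ≤
    kx * (4 * kx + 4 * (kx + kx) + 10) + 1 := by gcongr
  rw [esize_prod]
  simp only [Polynomial.eval_add, Polynomial.eval_mul, hk, Polynomial.eval_one,
    Polynomial.eval_ofNat]
  lia

@[fun_prop]
theorem augment {s t : α → ℕ} {y : α → Bool × List Arc} (hs : Poly s) (ht : Poly t) (hy : Poly y) :
    Poly (fun x => augment (s x) (t x) (y x)) := by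
  unfold Flow.augment
  fun_prop

@[fun_prop]
theorem solve {L : α → List Arc} {s t : α → ℕ} {F : α → List β} (hL : Poly L) (hs : Poly s)
    (ht : Poly t) (hF : Poly F) : Poly (fun x => solve (L x) (s x) (t x) (F x)) := by
  obtain ⟨r, hr⟩ := hL.exists_esize_le
  obtain ⟨r', hr'⟩ := hF.exists_esize_le
  refine foldl_of_take (γ := Bool × List Arc) (l := F) (init := fun x => (true, L x))
    (step := fun x y _ => Flow.augment (s x) (t x) y) hF (by fun_prop) ?_
    (r * (4 * r + 4 * (r + r' * r) + 10) + 5) fun x j => ?_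
  · fun_prop
  have h1 := hr x
  have h3 : Small (L x).length (r.eval (esize x)) (r.eval (esize x)) (L x) := by
    refine ⟨rfl, fun e he => ?_⟩
    have := (small_self (L x)).2 e he
    lia
  have hlen : (L x).length ≤ r.eval (esize x) := (length_le_esize _).trans h1
  have hj : ((F x).take j).length ≤ r'.eval (esize x) := by
    rw [List.length_take]
    exact (min_le_right _ _).trans ((length_le_esize _).trans (hr' x))
  have h4 := small_solve (s x) (t x) ((F x).take j) (x := (true, L x)) h3
  have h5 := (h4.mono (Nat.add_le_add_left (Nat.mul_le_mul hj hlen) _)).esize_le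
  have h6 := Nat.mul_le_mul_right
    (4 * r.eval (esize x) + 4 * (r.eval (esize x) + r'.eval (esize x) * r.eval (esize x)) + 10) hlen
  have h7 := esize_bool_le (((F x).take j).foldl
    (fun y _ => Flow.augment (s x) (t x) y) (true, L x)).1
  rw [esize_prod]
  simp only [Polynomial.eval_add, Polynomial.eval_mul, Polynomial.eval_ofNat]
  lia

/-- Sums of natural numbers are computable in polynomial time. -/
theorem foldl_add {f : α → List β} {g : β → ℕ} (hf : Poly f) (hg : Poly g) :
    Poly (fun x => (f x).foldl (fun n b => n + g b) 0) := by
  obtain ⟨r, hr⟩ := hf.exists_esize_le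
  obtain ⟨r', hr'⟩ := hg.exists_esize_le
  refine foldl_of_take hf (by fun_prop) (by fun_prop) (4 * (r'.comp r + r) + 1) fun x j => ?_
  refine (esize_nat_le _).trans ?_
  have key : ∀ (l : List β) (n : ℕ), (∀ b ∈ l, b ∈ f x) →
      (l.foldl (fun n b => n + g b) n) ≤ n + l.length * 2 ^ r'.eval (r.eval (esize x)) := by
    intro l
    induction l with
    | nil => simp
    | cons b l ih =>
      intro n h
      have hb : (g b).size ≤ r'.eval (r.eval (esize x)) :=
        (size_le_esize_nat _).trans ((hr' b).trans (eval_mono r'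
          ((esize_le_of_mem (h b List.mem_cons_self)).trans (hr x))))
      have := Nat.size_le.1 hb
      have h2 : ∀ (l : List β) (n : ℕ), l.foldl (fun n b => n + g b) n =
          n + l.foldl (fun n b => n + g b) 0 := by
        intro l
        induction l with
        | nil => simp
        | cons b l ih =>
          intro n
          rw [List.foldl_cons, List.foldl_cons, ih, ih (0 + g b)]
          ring
      have h3 := ih 0 fun b hb => h b (List.mem_cons_of_mem _ hb)
      rw [List.foldl_cons, h2, List.length_cons, add_mul]
      lia
  have h1 := key ((f x).take j) 0 fun b hb => List.mem_of_mem_take hb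
  have h2 : ((f x).take j).length ≤ r.eval (esize x) := by
    rw [List.length_take]
    exact (min_le_right _ _).trans ((length_le_esize _).trans (hr x))
  have h3 : r.eval (esize x) < 2 ^ r.eval (esize x) := Nat.lt_two_pow_self
  have h4 : (((f x).take j).foldl (fun n b => n + g b) 0).size ≤
      r'.eval (r.eval (esize x)) + r.eval (esize x) := by
    rw [Nat.size_le, pow_add]
    refine h1.trans_lt ?_
    rw [zero_add, mul_comm]
    exact Nat.mul_lt_mul_of_pos_left (h2.trans_lt h3) (by positivity)
  simp only [Polynomial.eval_add, Polynomial.eval_mul, Polynomial.eval_comp, Polynomial.eval_ofNat,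
    Polynomial.eval_one]
  lia

@[fun_prop]
theorem cost {L : α → List Arc} (hL : Poly L) : Poly (fun x => cost (L x)) := by
  unfold Flow.cost
  exact foldl_add (by fun_prop) (by fun_prop)

end Poly

end StackProg

/-! ### Minimum-cost flows of unit-capacity networks: correctness -/

namespace Flow

/-- The cost of one unit of flow along the residual arc. -/
def Arc.resCost (e : Arc) : ℤ := bif e.used then -e.price else e.price

/-- The part of an arc that the algorithm does not change. -/
def Arc.static (e : Arc) : ℕ × ℕ × ℕ × ℕ := (e.key, e.src, e.dst, e.price)

/-- The balance of the set `χ` of arcs, tested by the function `g` on the vertices: the sum of `g`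
over the ends of the arcs, minus the sum over their starts. -/
def balance (L : List Arc) (χ : ℕ → Bool) (g : ℕ → ℤ) : ℤ :=
  (L.map fun e => bif χ e.key then g e.dst - g e.src else 0).sum

/-- The set `χ` of arcs is a flow of value `N` from `s` to `t`: it has the balance of `N` arcs
from `s` to `t`. -/
def IsFlow (L : List Arc) (s t N : ℕ) (χ : ℕ → Bool) : Prop :=
  ∀ g : ℕ → ℤ, balance L χ g = N * (g t - g s)

/-- The cost of a set of arcs. -/
def flowCost (L : List Arc) (χ : ℕ → Bool) : ℕ :=
  (L.map fun e => bif χ e.key then e.price else 0).sum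

/-- The reduced costs come from a potential. As they are not negative, this certifies that the flow
has minimum cost. -/
def Optimal (L : List Arc) : Prop :=
  ∃ π : ℕ → ℤ, ∀ e ∈ L, (e.red : ℤ) = e.resCost + π e.tail - π e.head

/-- The invariant of the algorithm: `L` describes an optimal flow of value `N` in the
network `L₀`. -/
structure Valid (s t N : ℕ) (L₀ L : List Arc) : Prop where
  static : L.map Arc.static = L₀.map Arc.static
  optimal : Optimal L
  flow : ∀ g : ℕ → ℤ, (L.map fun e => bif e.used then g e.dst - g e.src else 0).sum =
    N * (g t - g s)

/-- The invariant of the search: every vertex in the search tree is reached from `s` by residual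
arcs of reduced cost zero between vertices of the tree. -/
structure Tree (s : ℕ) (L : List Arc) (S : Reached) : Prop where
  root : reached S s = true
  tight : ∀ q ∈ S, ∀ e ∈ L, e.key ∈ q.2 → e.red = 0 ∧ reached S e.tail = true ∧
    reached S e.head = true
  path : ∀ q ∈ S, ∀ g : ℕ → ℤ,
    (L.map fun e => if e.key ∈ q.2 then g e.head - g e.tail else 0).sum = g q.1 - g s

variable {s t N : ℕ} {L L₀ L₁ : List Arc} {S : Reached}

theorem reached_iff {v : ℕ} : reached S v = true ↔ ∃ q ∈ S, q.1 = v := by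
  simp [reached]

theorem exists_pathTo {v : ℕ} (h : reached S v = true) :
    ∃ q ∈ S, q.1 = v ∧ pathTo S v = q.2 := by
  obtain ⟨q, hq, hv⟩ := reached_iff.1 h
  unfold pathTo
  cases h : S.filter fun q => q.1 == v with
  | nil =>
    have := List.filter_eq_nil_iff.1 h q hq
    simp [hv] at this
  | cons q' l =>
    have hq' : q' ∈ S.filter fun q => q.1 == v := by rw [h]; simp
    exact ⟨q', (List.mem_filter.1 hq').1, by simpa using (List.mem_filter.1 hq').2, rfl⟩

theorem mem_cheapest {e : Arc} (h : e ∈ cheapest L S) :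
    e ∈ L ∧ leaves S e = true ∧ ∀ a ∈ L, leaves S a = true → e.red ≤ a.red := by
  simp only [cheapest, List.mem_filter, Bool.not_eq_true', List.any_eq_false] at h
  refine ⟨h.1.1, h.1.2, fun a ha hl => ?_⟩
  have := h.2 a ⟨ha, hl⟩
  simpa using this

theorem leaves_eq_false_of_cheapest (h : cheapest L S = []) : ∀ e ∈ L, leaves S e = false := by
  by_contra! hne
  obtain ⟨e, he, hl⟩ := hne
  have hmem : e ∈ L.filter fun e => leaves S e := List.mem_filter.2 ⟨he, by simpa using hl⟩
  obtain ⟨a, ha⟩ : ∃ a, (L.filter fun e => leaves S e).argmin Arc.red = some a :=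
    Option.ne_none_iff_exists'.1 fun h' => by rw [List.argmin_eq_none.1 h'] at hmem; simp at hmem
  have ha' : a ∈ cheapest L S := by
    refine List.mem_filter.2 ⟨List.argmin_mem ha, ?_⟩
    simp only [Bool.not_eq_true', List.any_eq_false]
    intro b hb
    simpa using List.le_of_mem_argmin hb ha
  rw [h] at ha'
  simp at ha'

@[simp] theorem tail_shift (ε : ℕ) (e : Arc) : (shift S ε e).tail = e.tail := rfl
@[simp] theorem head_shift (ε : ℕ) (e : Arc) : (shift S ε e).head = e.head := rfl

theorem optimal_shift {ε : ℕ} (h : Optimal L)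
    (hε : ∀ a ∈ L, leaves S a = true → ε ≤ a.red) : Optimal (L.map (shift S ε)) := by
  obtain ⟨π, hπ⟩ := h
  refine ⟨fun v => π v - bif reached S v then ε else 0, fun e he => ?_⟩
  obtain ⟨a, ha, rfl⟩ := List.mem_map.1 he
  have h1 := hπ a ha
  have h2 := hε a ha
  rw [tail_shift, head_shift]
  change ((shift S ε a).red : ℤ) = a.resCost + _ - _
  unfold shift leaves at *
  cases ht : reached S a.tail <;> cases hh : reached S a.head <;> simp [ht, hh] at h2 ⊢ <;> lia

/-- If the keys are distinct, adding a key to a set adds one summand. -/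
theorem sum_key_cons (hL : (L.map Arc.key).Nodup) {e : Arc} (he : e ∈ L) {P : List ℕ}
    (hP : e.key ∉ P) (f : Arc → ℤ) :
    (L.map fun a => if a.key ∈ e.key :: P then f a else 0).sum =
      f e + (L.map fun a => if a.key ∈ P then f a else 0).sum := by
  induction L with
  | nil => simp at he
  | cons b L ih =>
    rw [List.map_cons, List.nodup_cons] at hL
    simp only [List.map_cons, List.sum_cons]
    rcases List.mem_cons.1 he with rfl | he
    · have h : (L.map fun a => if a.key ∈ e.key :: P then f a else 0) =
          L.map fun a => if a.key ∈ P then f a else 0 := by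
        refine List.map_congr_left fun a ha => ?_
        have : a.key ≠ e.key := fun h => hL.1 (h ▸ List.mem_map_of_mem ha)
        simp [this]
      rw [h]
      simp [hP]
    · have : b.key ≠ e.key := fun h => hL.1 (h ▸ List.mem_map_of_mem he)
      rw [ih hL.2 he]
      simp only [List.mem_cons, this, false_or]
      ring

/-- A step of the search extends the tree by an arc that has reduced cost zero after the shift of
the potential. -/
theorem tree_growStep (hL : (L.map Arc.key).Nodup) (h : Tree s L S) {e : Arc}
    (he : e ∈ cheapest L S) :
    Tree s (L.map (shift S e.red)) ((e.head, e.key :: pathTo S e.tail) :: S) := by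
  obtain ⟨heL, hl, hmin⟩ := mem_cheapest he
  have hl' := hl
  rw [leaves, Bool.and_eq_true, Bool.not_eq_true'] at hl'
  obtain ⟨q₀, hq₀, hv₀, hp₀⟩ := exists_pathTo hl'.1
  have hmono : ∀ v, reached S v = true →
      reached ((e.head, e.key :: pathTo S e.tail) :: S) v = true := by
    intro v hv
    obtain ⟨q, hq, h⟩ := reached_iff.1 hv
    exact reached_iff.2 ⟨q, List.mem_cons_of_mem _ hq, h⟩
  have hint : ∀ a : Arc, reached S a.tail = true → reached S a.head = true →
      (shift S e.red a).red = a.red := by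
    intro a h1 h2
    simp [shift, leaves, h1, h2]
  have hold : ∀ q ∈ S, ∀ a ∈ L, a.key ∈ q.2 → (shift S e.red a).red = 0 ∧
      reached ((e.head, e.key :: pathTo S e.tail) :: S) a.tail = true ∧
      reached ((e.head, e.key :: pathTo S e.tail) :: S) a.head = true := by
    intro q hq a ha hk
    obtain ⟨h1, h2, h3⟩ := h.tight q hq a ha hk
    exact ⟨(hint a h2 h3).trans h1, hmono _ h2, hmono _ h3⟩
  refine ⟨hmono _ h.root, ?_, ?_⟩
  · intro q hq a' ha' hk
    obtain ⟨a, ha, rfl⟩ := List.mem_map.1 ha'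
    rcases List.mem_cons.1 hq with rfl | hq
    · rcases List.mem_cons.1 hk with hk | hk
      · obtain rfl : a = e := List.inj_on_of_nodup_map hL ha heL hk
        refine ⟨?_, hmono _ hl'.1, reached_iff.2 ⟨_, List.mem_cons_self, rfl⟩⟩
        simp [shift, hl]
      · rw [hp₀] at hk
        exact hold q₀ hq₀ a ha hk
    · exact hold q hq a ha hk
  · intro q hq g
    rw [List.map_map]
    rcases List.mem_cons.1 hq with rfl | hq
    · have hP : e.key ∉ pathTo S e.tail := by
        intro hk
        rw [hp₀] at hk
        have := (h.tight q₀ hq₀ e heL hk).2.2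
        simp [hl'.2] at this
      have h1 := sum_key_cons hL heL hP (fun a => g a.head - g a.tail)
      rw [hp₀, h.path q₀ hq₀ g, hv₀] at h1
      refine Eq.trans ?_ (h1.trans (by ring))
      rw [hp₀]
      rfl
    · exact h.path q hq g

/-- What the search guarantees about the list of arcs `L` and the tree `S`, when it started from the
list `L₁`. -/
structure Search (s : ℕ) (L₁ L : List Arc) (S : Reached) : Prop where
  same : L.map (fun e => (e.static, e.used)) = L₁.map (fun e => (e.static, e.used))
  optimal : Optimal L
  tree : Tree s L S

theorem map_key_eq (h : L.map Arc.static = L₁.map Arc.static) :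
    L.map Arc.key = L₁.map Arc.key := by
  have := congrArg (List.map Prod.fst) h
  rwa [List.map_map, List.map_map] at this

theorem Search.static (h : Search s L₁ L S) : L.map Arc.static = L₁.map Arc.static := by
  have := congrArg (List.map Prod.fst) h.same
  rwa [List.map_map, List.map_map] at this

theorem Search.step (hL : (L₁.map Arc.key).Nodup) (h : Search s L₁ L S) {e : Arc}
    (he : e ∈ cheapest L S) :
    Search s L₁ (L.map (shift S e.red)) ((e.head, e.key :: pathTo S e.tail) :: S) := by
  refine ⟨?_, optimal_shift h.optimal (mem_cheapest he).2.2, tree_growStep ?_ h.tree he⟩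
  · rw [← h.same, List.map_map]
    rfl
  · rwa [map_key_eq h.static]

/-- The number of arcs between vertices of the search tree. -/
def inner (L : List Arc) (S : Reached) : ℕ :=
  L.countP fun e => reached S e.tail && reached S e.head

/-- A step of the search adds the arc by which a new vertex is reached. -/
theorem inner_lt {e : Arc} (he : e ∈ cheapest L S) {ε : ℕ} {P : List ℕ} :
    inner L S < inner (L.map (shift S ε)) ((e.head, P) :: S) := by
  obtain ⟨heL, hl, -⟩ := mem_cheapest he
  rw [leaves, Bool.and_eq_true, Bool.not_eq_true'] at hl
  have hmono : ∀ v, reached S v = true → reached ((e.head, P) :: S) v = true := by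
    intro v hv
    obtain ⟨q, hq, h⟩ := reached_iff.1 hv
    exact reached_iff.2 ⟨q, List.mem_cons_of_mem _ hq, h⟩
  unfold inner
  rw [List.countP_map]
  obtain ⟨l₁, l₂, rfl⟩ := List.append_of_mem heL
  have hle : ∀ l : List Arc, l.countP (fun e => reached S e.tail && reached S e.head) ≤
      l.countP ((fun a => reached ((e.head, P) :: S) a.tail && reached ((e.head, P) :: S) a.head) ∘
        shift S ε) := by
    intro l
    refine List.countP_mono_left fun a _ h => ?_
    simp only [Bool.and_eq_true] at h
    simp only [Function.comp_apply, tail_shift, head_shift, Bool.and_eq_true]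
    exact ⟨hmono _ h.1, hmono _ h.2⟩
  have h1 := hle l₁
  have h2 := hle l₂
  have h3 : reached ((e.head, P) :: S) e.head = true := reached_iff.2 ⟨_, List.mem_cons_self, rfl⟩
  have h4 := hmono _ hl.1
  simp only [List.countP_append, List.countP_cons, hl.2, Bool.and_false, Function.comp_apply,
    tail_shift, head_shift, h3, h4, Bool.and_true]
  simp
  lia

/-- After as many steps as there are arcs, no residual arc leaves the set of vertices reached. -/
theorem search_grow (hL : (L.map Arc.key).Nodup) (h : Optimal L) (s : ℕ) :
    Search s L (grow L s).1 (grow L s).2 ∧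
      ∀ e ∈ (grow L s).1, leaves (grow L s).2 e = false := by
  have key : ∀ (l : List Arc) (t : List Arc × Reached), Search s L t.1 t.2 →
      Search s L (l.foldl (fun t _ => growStep t) t).1 (l.foldl (fun t _ => growStep t) t).2 ∧
      (cheapest (l.foldl (fun t _ => growStep t) t).1 (l.foldl (fun t _ => growStep t) t).2 = [] ∨
        inner t.1 t.2 + l.length ≤
          inner (l.foldl (fun t _ => growStep t) t).1 (l.foldl (fun t _ => growStep t) t).2) := by
    intro l
    induction l with
    | nil => exact fun t ht => ⟨ht, .inr (by simp)⟩
    | cons b l ih =>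
      rintro ⟨L', S'⟩ ht
      rw [List.foldl_cons]
      rcases growStep_cases L' S' with ⟨h0, hg⟩ | ⟨e, he, hg⟩
      · have hfix : ∀ l : List Arc, l.foldl (fun t _ => growStep t) (L', S') = (L', S') := by
          intro l
          induction l with
          | nil => rfl
          | cons b l ih => rw [List.foldl_cons, hg, ih]
        rw [hg, hfix]
        exact ⟨ht, .inl h0⟩
      · rw [hg]
        obtain ⟨h1, h2⟩ := ih (L'.map (shift S' e.red), (e.head, e.key :: pathTo S' e.tail) :: S')
          (Search.step hL (L := L') (S := S') ht he)
        refine ⟨h1, h2.imp_right fun h2 => ?_⟩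
        have := inner_lt he (ε := e.red) (P := e.key :: pathTo S' e.tail)
        simp only [List.length_cons]
        lia
  have h0 : Search s L L [(s, [])] := by
    refine ⟨rfl, h, ⟨by simp [reached], ?_, ?_⟩⟩
    · simp
    · simp
  obtain ⟨h1, h2⟩ : Search s L (grow L s).1 (grow L s).2 ∧
      (cheapest (grow L s).1 (grow L s).2 = [] ∨
        inner L [(s, [])] + L.length ≤ inner (grow L s).1 (grow L s).2) :=
    key L (L, [(s, [])]) h0
  refine ⟨h1, ?_⟩
  rcases h2 with h2 | h2
  · exact leaves_eq_false_of_cheapest h2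
  · have hlen : (grow L s).1.length = L.length := by
      simpa using congrArg List.length h1.static
    have hall : inner (grow L s).1 (grow L s).2 = (grow L s).1.length :=
      le_antisymm List.countP_le_length (by lia)
    intro e he
    have := List.countP_eq_length.1 hall e he
    simp only [Bool.and_eq_true] at this
    simp [leaves, this.2]

theorem balance_congr (h : L.map Arc.static = L₀.map Arc.static) (χ : ℕ → Bool) (g : ℕ → ℤ) :
    balance L χ g = balance L₀ χ g := by
  have := congrArg (fun l => (l.map fun x : ℕ × ℕ × ℕ × ℕ =>
    bif χ x.1 then g x.2.2.1 - g x.2.1 else 0).sum) h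
  simp only [List.map_map] at this
  exact this

theorem flowCost_congr (h : L.map Arc.static = L₀.map Arc.static) (χ : ℕ → Bool) :
    flowCost L χ = flowCost L₀ χ := by
  have := congrArg (fun l => (l.map fun x : ℕ × ℕ × ℕ × ℕ =>
    bif χ x.1 then x.2.2.2 else 0).sum) h
  simp only [List.map_map] at this
  exact this

theorem sum_used_congr (h : L.map (fun e => (e.static, e.used)) =
    L₁.map (fun e => (e.static, e.used))) (g : ℕ → ℤ) :
    (L.map fun e => bif e.used then g e.dst - g e.src else 0).sum =
      (L₁.map fun e => bif e.used then g e.dst - g e.src else 0).sum := by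
  have := congrArg (fun l => (l.map fun x : (ℕ × ℕ × ℕ × ℕ) × Bool =>
    bif x.2 then g x.1.2.2.1 - g x.1.2.1 else 0).sum) h
  simp only [List.map_map] at this
  exact this

theorem sum_map_sub (f g : Arc → ℤ) (L : List Arc) :
    (L.map fun e => f e - g e).sum = (L.map f).sum - (L.map g).sum := by
  induction L with
  | nil => simp
  | cons e L ih =>
    simp only [List.map_cons, List.sum_cons, ih]
    ring

theorem sum_map_le {f g : Arc → ℤ} (h : ∀ e ∈ L, f e ≤ g e) : (L.map f).sum ≤ (L.map g).sum :=
  List.sum_le_sum h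

/-- Changing the flow along a path of reduced cost zero from `s` to `t` preserves the invariant and
increases the value of the flow by one. -/
theorem Valid.augment (h : Valid s t N L₀ L₁) (hS : Search s L₁ L S) (ht : reached S t = true) :
    Valid s t (N + 1) L₀ (L.map (flipArc (pathTo S t))) := by
  obtain ⟨q, hq, hv, hp⟩ := exists_pathTo ht
  have hany : ∀ k, ((pathTo S t).any fun i => i == k) = decide (k ∈ q.2) := by
    intro k
    rw [hp, Bool.eq_iff_iff]
    simp
  refine ⟨?_, ?_, fun g => ?_⟩
  · rw [← h.static, ← hS.static, List.map_map]
    rfl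
  · obtain ⟨π, hπ⟩ := hS.optimal
    refine ⟨π, fun e he => ?_⟩
    obtain ⟨a, ha, rfl⟩ := List.mem_map.1 he
    have h1 := hπ a ha
    by_cases hk : a.key ∈ q.2
    · have h2 := (hS.tree.tight q hq a ha hk).1
      simp only [Arc.resCost, Arc.tail, Arc.head, flipArc, hany, hk, decide_true] at h1 ⊢
      cases hu : a.used <;> simp [hu] at h1 ⊢ <;> lia
    · simp only [Arc.resCost, Arc.tail, Arc.head, flipArc, hany, hk, decide_false] at h1 ⊢
      cases hu : a.used <;> simp [hu] at h1 ⊢ <;> lia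
  · have h1 := (sum_used_congr hS.same g).trans (h.flow g)
    have h2 := hS.tree.path q hq g
    rw [hv] at h2
    push_cast
    rw [add_mul, one_mul, ← h1, ← h2, ← List.sum_map_add, List.map_map]
    congr 1
    refine List.map_congr_left fun a _ => ?_
    simp only [Function.comp_apply, flipArc, hany, Arc.head, Arc.tail]
    by_cases hk : a.key ∈ q.2 <;> cases hu : a.used <;> simp [hk]

/-- If `t` cannot be reached, the vertices reached form a cut, and there is no flow of greater
value. -/
theorem Valid.not_isFlow (h : Valid s t N L₀ L₁) (hS : Search s L₁ L S)
    (hl : ∀ e ∈ L, leaves S e = false) (ht : reached S t = false) {M : ℕ} (hM : N < M)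
    (χ : ℕ → Bool) : ¬ IsFlow L₀ s t M χ := by
  intro hχ
  -- the cut is tested by its indicator function
  let g : ℕ → ℤ := fun v => bif reached S v then 1 else 0
  have h1 := (sum_used_congr hS.same g).trans (h.flow g)
  have h2 := (balance_congr (hS.static.trans h.static) χ g).trans (hχ g)
  have h3 : (L.map fun e => bif e.used then g e.dst - g e.src else 0).sum ≤ balance L χ g := by
    refine sum_map_le fun e he => ?_
    have := hl e he
    simp only [leaves, Arc.tail, Arc.head] at this
    simp only [g]
    cases hu : e.used <;> cases χ e.key <;> cases h1 : reached S e.src <;>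
      cases h2 : reached S e.dst <;> simp_all
  rw [h1, h2] at h3
  have hgs : g s = 1 := by simp [g, hS.tree.root]
  have hgt : g t = 0 := by simp [g, ht]
  rw [hgs, hgt] at h3
  lia

/-- By weak duality, a flow with non-negative reduced costs has minimum cost among the flows of the
same value. -/
theorem Valid.cost_le (h : Valid s t N L₀ L) {χ : ℕ → Bool} (hχ : IsFlow L₀ s t N χ) :
    (L.map fun e => bif e.used then e.price else 0).sum ≤ flowCost L₀ χ := by
  obtain ⟨π, hπ⟩ := h.optimal
  have h1 := h.flow π
  have h2 := (balance_congr h.static χ π).trans (hχ π)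
  have h3 : (L.map fun e => (bif e.used then (e.price : ℤ) else 0) -
      (bif e.used then π e.dst - π e.src else 0)).sum ≤
      (L.map fun e => (bif χ e.key then (e.price : ℤ) else 0) -
      (bif χ e.key then π e.dst - π e.src else 0)).sum := by
    refine sum_map_le fun e he => ?_
    have := hπ e he
    simp only [Arc.resCost, Arc.tail, Arc.head] at this
    cases hu : e.used <;> cases hk : χ e.key <;> simp [hu] at this ⊢ <;> lia
  rw [sum_map_sub, sum_map_sub, h1] at h3
  have h4 : (L.map fun e => bif χ e.key then π e.dst - π e.src else 0).sum = N * (π t - π s) := h2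
  rw [h4] at h3
  have h5 : (L.map fun e => bif e.used then (e.price : ℤ) else 0).sum =
      ((L.map fun e => bif e.used then e.price else 0).sum : ℕ) := by
    rw [Nat.cast_list_sum, List.map_map]
    congr 1
    refine List.map_congr_left fun e _ => ?_
    cases hu : e.used <;> simp [hu]
  have h6 : (L.map fun e => bif χ e.key then (e.price : ℤ) else 0).sum = (flowCost L χ : ℕ) := by
    rw [flowCost, Nat.cast_list_sum, List.map_map]
    congr 1
    refine List.map_congr_left fun e _ => ?_
    cases hu : χ e.key <;> simp [hu]
  rw [← flowCost_congr h.static]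
  lia

theorem cost_eq (L : List Arc) : cost L = (L.map fun e => bif e.used then e.price else 0).sum := by
  have key : ∀ (L : List Arc) (n : ℕ), (L.filter fun e => e.used).foldl (fun n e => n + e.price) n =
      n + (L.map fun e => bif e.used then e.price else 0).sum := by
    intro L
    induction L with
    | nil => simp
    | cons e L ih =>
      intro n
      cases hu : e.used
      · simp [hu, ih]
      · simp [hu, ih]
        ring
  simpa [cost] using key L 0

/-- The flow found by the algorithm, as a set of keys. -/
def usedKeys (L : List Arc) (k : ℕ) : Bool := L.any fun e => e.key == k && e.used

theorem usedKeys_key (hL : (L.map Arc.key).Nodup) {e : Arc} (he : e ∈ L) :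
    usedKeys L e.key = e.used := by
  rw [Bool.eq_iff_iff, usedKeys, List.any_eq_true]
  constructor
  · rintro ⟨a, ha, h⟩
    simp only [Bool.and_eq_true, beq_iff_eq] at h
    rw [← List.inj_on_of_nodup_map hL ha he h.1]
    exact h.2
  · intro h
    exact ⟨e, he, by simp [h]⟩

/-- The algorithm finds a flow of minimum cost among the flows whose value is the length of `F`, if
there is any such flow. -/
theorem solve_spec {β : Type} {s t : ℕ} (L₀ : List Arc) (hL : (L₀.map Arc.key).Nodup)
    (hinit : ∀ e ∈ L₀, e.used = false ∧ e.red = e.price) (F : List β) (B : ℕ) :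
    ((solve L₀ s t F).1 = true ∧ cost (solve L₀ s t F).2 ≤ B) ↔
      ∃ χ, IsFlow L₀ s t F.length χ ∧ flowCost L₀ χ ≤ B := by
  have h0 : Valid s t 0 L₀ L₀ := by
    refine ⟨rfl, ⟨fun _ => 0, fun e he => ?_⟩, fun g => ?_⟩
    · obtain ⟨h1, h2⟩ := hinit e he
      simp [Arc.resCost, h1, h2]
    · rw [List.map_congr_left (g := fun _ => 0) fun e he => by simp [(hinit e he).1]]
      simp
  have key : ∀ (l : List β), let x := l.foldl (fun x _ => augment s t x) (true, L₀)
      (x.1 = true → Valid s t l.length L₀ x.2) ∧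
      (x.1 = false → ∀ M, l.length ≤ M → ∀ χ, ¬ IsFlow L₀ s t M χ) := by
    intro l
    induction l using List.reverseRecOn with
    | nil => exact ⟨fun _ => h0, by simp⟩
    | append_singleton l b ih =>
      simp only [List.foldl_append, List.foldl_cons, List.foldl_nil, List.length_append,
        List.length_singleton]
      simp only at ih
      generalize l.foldl (fun x _ => augment s t x) (true, L₀) = x at ih
      obtain ⟨ok, L₁⟩ := x
      cases ok
      · refine ⟨by simp [augment], fun _ M hM => ih.2 rfl M (by lia)⟩
      · have hv := ih.1 rfl
        obtain ⟨h1, h2⟩ := search_grow (by rwa [map_key_eq hv.static]) hv.optimal s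
        refine ⟨fun h => ?_, fun h M hM => ?_⟩
        · exact hv.augment h1 (by simpa [augment] using h)
        · exact hv.not_isFlow h1 h2 (by simpa [augment] using h) (by lia)
  have hF := key F
  simp only at hF
  change ((solve L₀ s t F).1 = true → Valid s t F.length L₀ (solve L₀ s t F).2) ∧
    ((solve L₀ s t F).1 = false → ∀ M, F.length ≤ M → ∀ χ, ¬ IsFlow L₀ s t M χ) at hF
  constructor
  · rintro ⟨h1, h2⟩
    have hv := hF.1 h1
    have hk : ((solve L₀ s t F).2.map Arc.key).Nodup := by rwa [map_key_eq hv.static]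
    refine ⟨usedKeys (solve L₀ s t F).2, fun g => ?_, ?_⟩
    · rw [← hv.flow, ← balance_congr hv.static, balance]
      congr 1
      exact List.map_congr_left fun e he => by rw [usedKeys_key hk he]
    · rw [cost_eq] at h2
      rw [← flowCost_congr hv.static, flowCost]
      refine le_trans (le_of_eq ?_) h2
      congr 1
      exact List.map_congr_left fun e he => by rw [usedKeys_key hk he]
  · rintro ⟨χ, h1, h2⟩
    have hok : (solve L₀ s t F).1 = true := by
      by_contra h
      exact hF.2 (by simpa using h) _ le_rfl χ h1
    refine ⟨hok, ?_⟩
    rw [cost_eq]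
    exact ((hF.1 hok).cost_le h1).trans h2

end Flow

/-! ### The decision algorithm -/

namespace StackProg

open Enc (enc)

variable {α β γ : Type} [Enc α] [Enc β] [Enc γ]

/-- Cut a list into pieces of length `w`. -/
def chunks {β : Type} (w : ℕ) (l : List β) : List (List β) :=
  (l.foldl (fun s _ => (s.1.drop w, bif s.1.isEmpty then s.2 else s.1.take w :: s.2))
    (l, ([] : List (List β)))).2.reverse

theorem chunks_flatten {β : Type} {w : ℕ} (hw : 0 < w) {L : List (List β)}
    (hL : ∀ l ∈ L, l.length = w) : chunks w L.flatten = L := by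
  have key : ∀ (L : List (List β)) (_ : ∀ l ∈ L, l.length = w) (t : List β) (acc : List (List β)),
      L.length ≤ t.length →
      t.foldl (fun s _ => (s.1.drop w, bif s.1.isEmpty then s.2 else s.1.take w :: s.2))
        (L.flatten, acc) = ([], L.reverse ++ acc) := by
    intro L hL t
    induction t generalizing L with
    | nil =>
      intro acc h
      obtain rfl : L = [] := List.length_eq_zero_iff.1 (by simpa using h)
      simp
    | cons b t ih =>
      intro acc h
      rw [List.foldl_cons]
      cases L with
      | nil => simpa using ih [] (by simp) acc (by simp)
      | cons a L =>
        have ha : a.length = w := hL a List.mem_cons_self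
        have h1 : (a ++ L.flatten).isEmpty = false := by
          cases a with
          | nil => simp at ha; lia
          | cons => rfl
        have h2 := ih L (fun l hl => hL l (List.mem_cons_of_mem _ hl)) (a :: acc) (by simpa using h)
        simp [h1, ← ha] at h2 ⊢
        exact h2
  have hlen : ∀ L : List (List β), (∀ l ∈ L, l.length = w) → L.length ≤ L.flatten.length := by
    intro L
    induction L with
    | nil => simp
    | cons a L ih =>
      intro hL
      have h1 := hL a List.mem_cons_self
      have h2 := ih fun l hl => hL l (List.mem_cons_of_mem _ hl)
      simp only [List.flatten_cons, List.length_append, List.length_cons]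
      lia
  rw [chunks, key L hL _ _ (hlen L hL)]
  simp

/-- One step in reading numbers from a string, beginning at the end of the string: a separator
starts a new number, and a digit is added to the number at the head of the list. -/
def readStep (l : List ℕ) (a : Option Bool) : List ℕ :=
  bif a.toList.isEmpty then 0 :: l else Nat.bit (a.toList.headD false) (l.headD 0) :: l.tail

/-- The list of numbers that is written as a given string. -/
def readNats (w : List (Option Bool)) : List ℕ := w.reverse.foldl readStep []

theorem foldr_bit_encodePosNum (p : PosNum) :
    (Computability.encodePosNum p).foldr Nat.bit 0 = (p : ℕ) := by
  induction p with
  | one => rfl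
  | bit0 p ih =>
    rw [Computability.encodePosNum, List.foldr_cons, ih, PosNum.cast_bit0, Nat.bit_val]
    simp
    ring
  | bit1 p ih =>
    rw [Computability.encodePosNum, List.foldr_cons, ih, PosNum.cast_bit1, Nat.bit_val]
    simp
    ring

theorem foldr_bit_encodeNat (n : ℕ) : (Computability.encodeNat n).foldr Nat.bit 0 = n := by
  have key : ∀ n : Num, (Computability.encodeNum n).foldr Nat.bit 0 = (n : ℕ) := by
    rintro (_ | p)
    · rfl
    · exact foldr_bit_encodePosNum p
  rw [Computability.encodeNat, key]
  simp

theorem readNats_encodeNats (l : List ℕ) : readNats (LocalBribery.encodeNats l) = l := by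
  have h1 : ∀ w, readNats w = w.foldr (fun a l => readStep l a) [] := fun w => List.foldl_reverse
  have h2 : ∀ (u : List Bool) (n : ℕ) (l : List ℕ),
      (u.map some).foldr (fun a l => readStep l a) (n :: l) = u.foldr Nat.bit n :: l := by
    intro u n l
    induction u with
    | nil => rfl
    | cons b u ih =>
      rw [List.map_cons, List.foldr_cons, ih]
      rfl
  rw [h1, LocalBribery.encodeNats]
  induction l with
  | nil => rfl
  | cons n l ih =>
    rw [List.flatMap_cons, List.foldr_append, ih, List.foldr_append]
    refine (h2 _ 0 l).trans ?_
    rw [foldr_bit_encodeNat]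

theorem esize_bit_le (b : Bool) (n : ℕ) : esize (Nat.bit b n) ≤ esize n + 4 := by
  by_cases h : n = 0 → b = true
  · rw [esize_nat, Nat.bits_append_bit n b h, esize_cons, ← esize_nat]
    have := esize_bool_le b
    lia
  · obtain ⟨rfl, hb⟩ : n = 0 ∧ ¬ b = true := by simpa using h
    obtain rfl : b = false := by simpa using hb
    simp

namespace Poly

@[fun_prop]
theorem zipIdx {f : α → List β} (hf : Poly f) : Poly (fun x => (f x).zipIdx) := by
  let step : ℕ × List (β × ℕ) → β → ℕ × List (β × ℕ) := fun s b => (s.1 + 1, (b, s.1) :: s.2)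
  have key : ∀ l : List β, l.foldl step (0, []) = (l.length, l.zipIdx.reverse) := by
    intro l
    induction l using List.reverseRecOn with
    | nil => rfl
    | append_singleton l b ih =>
      rw [List.foldl_append, ih]
      simp [step, List.zipIdx_append]
  obtain ⟨r, hr⟩ := hf.exists_esize_le
  have h : Poly (fun x => (f x).foldl step (0, [])) := by
    refine foldl_of_take hf (by fun_prop) (by fun_prop)
      (4 * r + 1 + (r * (r + (4 * r + 1) + 1 + 1) + 1) + 1) fun x j => ?_
    rw [key]
    have hlen := (length_le_esize (f x)).trans (hr x)
    have hnat : ∀ i ≤ (f x).length, esize i ≤ 4 * r.eval (esize x) + 1 := by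
      intro i hi
      have h1 := esize_nat_le i
      have h2 : i.size ≤ i := Nat.size_le.2 Nat.lt_two_pow_self
      lia
    have h1 := hnat ((f x).take j).length (by simp)
    have h2 : esize ((f x).take j).zipIdx.reverse ≤
        ((f x).take j).zipIdx.reverse.length *
          (r.eval (esize x) + (4 * r.eval (esize x) + 1) + 1 + 1) + 1 := by
      refine esize_le_of_forall fun a ha => ?_
      rw [List.mem_reverse] at ha
      obtain ⟨b, i⟩ := a
      have h3 := List.mem_zipIdx ha
      have h4 := hnat i (by simp at h3; lia)
      have h5 : b ∈ (f x).take j := by rw [h3.2.2]; exact List.getElem_mem _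
      have h6 := (esize_le_of_mem (List.mem_of_mem_take h5)).trans (hr x)
      simp only [esize_prod]
      lia
    have h3 : ((f x).take j).zipIdx.reverse.length ≤ r.eval (esize x) := by
      simp
      lia
    have h4 := Nat.mul_le_mul_right
      (r.eval (esize x) + (4 * r.eval (esize x) + 1) + 1 + 1) h3
    simp only [esize_prod, Polynomial.eval_add, Polynomial.eval_mul, Polynomial.eval_ofNat,
      Polynomial.eval_one]
    lia
  have h' : Poly (fun x => ((f x).foldl step (0, [])).2.reverse) := by fun_prop
  simpa only [key, List.reverse_reverse] using h'

@[fun_prop]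
theorem chunks {w : α → ℕ} {f : α → List β} (hw : Poly w) (hf : Poly f) :
    Poly (fun x => chunks (w x) (f x)) := by
  obtain ⟨r, hr⟩ := hf.exists_esize_le
  have h : Poly (fun x => (f x).foldl (fun s _ => (s.1.drop (w x),
      bif s.1.isEmpty then s.2 else s.1.take (w x) :: s.2)) (f x, ([] : List (List β)))) := by
    refine foldl_of_le hf (by fun_prop) (by fun_prop) (fun s => esize s.1 + esize s.2 + 1) ?_
      (r + 2) ?_ ?_
    · intro s
      simp
    · intro x
      have := hr x
      simp
      lia
    · intro x s b hb
      have h1 := esize_append (s.1.take (w x)) (s.1.drop (w x))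
      rw [List.take_append_drop] at h1
      have h2 := esize_pos (s.1.take (w x))
      cases h : s.1.isEmpty <;> simp <;> lia
  unfold StackProg.chunks
  fun_prop

@[fun_prop]
theorem optionToList {f : α → Option Bool} (hf : Poly f) : Poly (fun x => (f x).toList) :=
  of_enc_eq hf fun x => by cases f x <;> rfl

@[fun_prop]
theorem readNats {f : α → List (Option Bool)} (hf : Poly f) : Poly (fun x => readNats (f x)) := by
  unfold StackProg.readNats
  refine foldl_of_le (step := fun _ => readStep) hf.reverse (by fun_prop)
    (by unfold readStep; fun_prop) esize (fun _ => le_rfl) 8 ?_ ?_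
  · simp
  · intro x l a ha
    have h0 : esize 0 = 1 := rfl
    rcases a with _ | b
    · simp [readStep, h0]
      lia
    · rcases l with _ | ⟨n, l⟩
      · have := esize_bit_le b 0
        simp [readStep] at this ⊢
        lia
      · have := esize_bit_le b n
        simp [readStep] at this ⊢
        lia

end Poly

end StackProg

namespace Bribery

open StackProg Flow

/-- A voter is a list of numbers: the price, the distance allowed, and the ranking from top to
bottom. -/
abbrev Voter : Type := List ℕ

/-- The price of a voter. -/
def voterPrice (v : Voter) : ℕ := v.headD 0

/-- The distance allowed for a voter. -/
def voterDist (v : Voter) : ℕ := v.tail.headD 0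

/-- The alternatives from top to bottom. -/
def ranking (v : Voter) : List ℕ := v.tail.tail

/-- The approved alternatives. -/
def approvals (k : ℕ) (v : Voter) : List ℕ := (ranking v).take k

/-- The last approved alternative. -/
def lastIn (k : ℕ) (v : Voter) : ℕ := ((ranking v).drop (k - 1)).headD 0

/-- The first alternative that is not approved. -/
def firstOut (k : ℕ) (v : Voter) : ℕ := ((ranking v).drop k).headD 0

/-- All approvals of a profile. -/
def allApprovals (k : ℕ) (V : List Voter) : List ℕ := V.flatMap (approvals k)

/-- The voters that can be bribed, if a bribe requires the distance `T`. -/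
def bribable (T : ℕ) (V : List Voter) : List Voter := V.filter fun v => T.ble (voterDist v)

/-- The possible changes of the approvals, with their prices, as arcs. -/
def exchanges (T k : ℕ) (V : List Voter) : List (ℕ × ℕ × ℕ) :=
  (bribable T V).map fun v => (lastIn k v, firstOut k v, voterPrice v)

/-- The arcs (start, end, price) of a network in which the flows whose value is the number of all
approvals correspond to the bribes after which `c` has at least `t` approvals and the other
alternatives have fewer. The vertices are the alternatives `0, …, m - 1`, a collector `m`, the
source `m + 1`, and the sink `m + 2`. -/
def network (T m k c : ℕ) (V : List Voter) (t : ℕ) : List (ℕ × ℕ × ℕ) :=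
  ((allApprovals k V).map fun a => (m + 1, a, 0)) ++ (exchanges T k V ++
  ((((ranking (V.headD [])).filter fun a => !(a == c)).flatMap fun a =>
    (V.take (t - 1)).map fun _ => (a, m, 0)) ++
  (((allApprovals k V).map fun _ => (c, m, 0)) ++ (((V.take t).map fun _ => (c, m + 2, 0)) ++
  (((allApprovals k V).drop t).map fun _ => (m, m + 2, 0))))))

/-- Arcs without flow, numbered consecutively. -/
def numbered (l : List (ℕ × ℕ × ℕ)) : List Arc :=
  l.zipIdx.map fun x => ⟨x.2, x.1.1, x.1.2.1, x.1.2.2, false, x.1.2.2⟩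

/-- Whether there is a bribe within the budget `B` after which `c` has at least `t` approvals and
the other alternatives have fewer. -/
def decideAt (T m k c B : ℕ) (V : List Voter) (t : ℕ) : Bool :=
  (solve (numbered (network T m k c V t)) (m + 1) (m + 2) (allApprovals k V)).1 &&
  (cost (solve (numbered (network T m k c V t)) (m + 1) (m + 2) (allApprovals k V)).2).ble B

/-- Whether there is a bribe within the budget after which `c` wins alone, for the instance given by
a list of numbers. -/
def decideNats (T : ℕ) (z : List ℕ) : Bool :=
  (chunks (z.headD 0 + 2) (z.drop 5)).zipIdx.any fun x =>
    decideAt T (z.headD 0) ((z.drop 2).headD 0) ((z.drop 3).headD 0) ((z.drop 4).headD 0)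
      (chunks (z.headD 0 + 2) (z.drop 5)) (x.2 + 1)

section
variable {α : Type} [Enc α]

@[fun_prop]
theorem poly_voterPrice {v : α → Voter} (hv : Poly v) : Poly (fun x => voterPrice (v x)) := by
  unfold voterPrice
  fun_prop

@[fun_prop]
theorem poly_voterDist {v : α → Voter} (hv : Poly v) : Poly (fun x => voterDist (v x)) := by
  unfold voterDist
  fun_prop

@[fun_prop]
theorem poly_ranking {v : α → Voter} (hv : Poly v) : Poly (fun x => ranking (v x)) := by
  unfold ranking
  fun_prop

@[fun_prop]
theorem poly_allApprovals {k : α → ℕ} {V : α → List Voter} (hk : Poly k) (hV : Poly V) :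
    Poly (fun x => allApprovals (k x) (V x)) := by
  unfold allApprovals approvals
  fun_prop

@[fun_prop]
theorem poly_exchanges {k : α → ℕ} {V : α → List Voter} (T : ℕ) (hk : Poly k) (hV : Poly V) :
    Poly (fun x => exchanges T (k x) (V x)) := by
  unfold exchanges bribable lastIn firstOut
  fun_prop

@[fun_prop]
theorem poly_network {m k c t : α → ℕ} {V : α → List Voter} (T : ℕ) (hm : Poly m) (hk : Poly k)
    (hc : Poly c) (hV : Poly V) (ht : Poly t) :
    Poly (fun x => network T (m x) (k x) (c x) (V x) (t x)) := by
  unfold network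
  fun_prop

@[fun_prop]
theorem poly_numbered {l : α → List (ℕ × ℕ × ℕ)} (hl : Poly l) :
    Poly (fun x => numbered (l x)) := by
  unfold numbered
  fun_prop

@[fun_prop]
theorem poly_decideAt {m k c B t : α → ℕ} {V : α → List Voter} (T : ℕ) (hm : Poly m) (hk : Poly k)
    (hc : Poly c) (hB : Poly B) (hV : Poly V) (ht : Poly t) :
    Poly (fun x => decideAt T (m x) (k x) (c x) (B x) (V x) (t x)) := by
  unfold decideAt
  fun_prop

@[fun_prop]
theorem poly_decideNats {z : α → List ℕ} (T : ℕ) (hz : Poly z) :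
    Poly (fun x => decideNats T (z x)) := by
  unfold decideNats
  fun_prop

end

theorem enc_string (w : List (Option Bool)) : Enc.enc w = strData w := by
  induction w with
  | nil => rfl
  | cons a w ih => exact congrArg (Data.node (symData a)) ih

/-- The problem is solvable in polynomial time if the algorithm answers it. -/
theorem polyTimeSolvable_of_decideNats {D yes : LocalBribery.Instance → Prop} (T : ℕ)
    (h : ∀ I, D I → (decideNats T I.toNats = true ↔ yes I)) :
    LocalBribery.PolyTimeSolvable LocalBribery.Instance.encode D yes := by
  have h1 : Poly (fun w : List (Option Bool) => decideNats T (readNats w)) := by fun_prop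
  have h2 := (PolyD.reindex (fun I : {I // D I} => I.1.encode) h1).congr
    (f' := fun I => boolData (@decide (yes I.1) (Classical.propDecidable _))) fun I => by
      change boolData (decideNats T (readNats (LocalBribery.encodeNats I.1.toNats))) = _
      rw [readNats_encodeNats]
      refine congrArg boolData ?_
      exact Bool.eq_iff_iff.2 ((h I.1 I.2).trans
        (@decide_eq_true_iff _ (Classical.propDecidable _)).symm)
  simp only [enc_string] at h2
  exact PolyD.computable h2

end Bribery

/-! ### Bribes as flows -/

namespace Bribery

open Flow

/-- The balance of a list of arcs, tested by the function `g` on the vertices. -/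
def netFlow (l : List (ℕ × ℕ × ℕ)) (g : ℕ → ℤ) : ℤ := (l.map fun e => g e.2.1 - g e.1).sum

/-- The cost of a list of arcs. -/
def totalPrice (l : List (ℕ × ℕ × ℕ)) : ℕ := (l.map fun e => e.2.2).sum

theorem sum_map_bif {α M : Type} [AddCommMonoid M] (l : List α) (p : α → Bool) (f : α → M) :
    (l.map fun x => bif p x then f x else 0).sum = ((l.filter p).map f).sum := by
  induction l with
  | nil => simp
  | cons a l ih => cases h : p a <;> simp [h, ih]

theorem filter_mem_of_sublist {α β : Type} [DecidableEq β] {z l : List α} (h : z.Sublist l)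
    {f : α → β} (hl : (l.map f).Nodup) : l.filter (fun x => decide (f x ∈ z.map f)) = z := by
  induction h with
  | slnil => rfl
  | @cons z l a h ih =>
    rw [List.map_cons, List.nodup_cons] at hl
    have ha : f a ∉ z.map f := fun h' => hl.1 ((h.map f).subset h')
    rw [List.filter_cons_of_neg (by simpa using ha), ih hl.2]
  | @cons_cons z l a h ih =>
    rw [List.map_cons, List.nodup_cons] at hl
    rw [List.filter_cons_of_pos (by simp)]
    congr 1
    refine Eq.trans (List.filter_congr fun x hx => ?_) (ih hl.2)
    have : f x ≠ f a := fun h' => hl.1 (h' ▸ List.mem_map_of_mem hx)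
    simp [this]

/-- The flows of the network of numbered arcs are the sublists of the list of arcs with the
appropriate balance. -/
theorem exists_flow_numbered_iff (l : List (ℕ × ℕ × ℕ)) (s τ N B : ℕ) :
    (∃ χ, IsFlow (numbered l) s τ N χ ∧ flowCost (numbered l) χ ≤ B) ↔
      ∃ l', l'.Sublist l ∧ (∀ g, netFlow l' g = N * (g τ - g s)) ∧ totalPrice l' ≤ B := by
  have h1 : ∀ (χ : ℕ → Bool) g, balance (numbered l) χ g =
      netFlow ((l.zipIdx.filter fun x => χ x.2).map Prod.fst) g := by
    intro χ g
    rw [netFlow, List.map_map]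
    refine Eq.trans ?_ (sum_map_bif _ _ _)
    rw [balance, numbered, List.map_map]
    rfl
  have h2 : ∀ χ : ℕ → Bool, flowCost (numbered l) χ =
      totalPrice ((l.zipIdx.filter fun x => χ x.2).map Prod.fst) := by
    intro χ
    rw [totalPrice, List.map_map]
    refine Eq.trans ?_ (sum_map_bif _ _ _)
    rw [flowCost, numbered, List.map_map]
    rfl
  constructor
  · rintro ⟨χ, hχ, hB⟩
    refine ⟨(l.zipIdx.filter fun x => χ x.2).map Prod.fst, ?_, fun g => ?_, ?_⟩
    · have := (List.filter_sublist (l := l.zipIdx) (p := fun x => χ x.2)).map Prod.fst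
      rwa [List.zipIdx_map_fst] at this
    · rw [← h1, hχ g]
    · rwa [← h2]
  · rintro ⟨l', hl, hf, hB⟩
    rw [← List.zipIdx_map_fst 0 l, List.sublist_map_iff] at hl
    obtain ⟨z, hz, rfl⟩ := hl
    have h3 : (l.zipIdx.filter fun x => decide (x.2 ∈ z.map Prod.snd)) = z := by
      refine filter_mem_of_sublist hz ?_
      rw [List.zipIdx_map_snd]
      exact List.nodup_range'
    refine ⟨fun i => decide (i ∈ z.map Prod.snd), fun g => ?_, ?_⟩
    · rw [h1, h3, hf]
    · rwa [h2, h3]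

theorem sublist_flatMap_replicate {β : Type} {A : List ℕ} (hA : A.Nodup) {n : ℕ} {f : ℕ → β}
    {l : List β} (h : l.Sublist (A.flatMap fun a => List.replicate n (f a))) :
    ∃ ν : ℕ → ℕ, (∀ a, ν a ≤ n) ∧ l = A.flatMap fun a => List.replicate (ν a) (f a) := by
  induction A generalizing l with
  | nil => exact ⟨fun _ => 0, by simp, by simpa using h⟩
  | cons a A ih =>
    rw [List.nodup_cons] at hA
    rw [List.flatMap_cons, List.sublist_append_iff] at h
    obtain ⟨l₁, l₂, rfl, h₁, h₂⟩ := h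
    obtain ⟨i, hi, rfl⟩ := List.sublist_replicate_iff.1 h₁
    obtain ⟨ν, hν, rfl⟩ := ih hA.2 h₂
    refine ⟨Function.update ν a i, fun b => ?_, ?_⟩
    · rcases eq_or_ne b a with rfl | hb
      · simpa using hi
      · simpa [hb] using hν b
    · rw [List.flatMap_cons, Function.update_self]
      congr 1
      refine List.flatMap_congr fun b hb => ?_
      rw [Function.update_of_ne]
      rintro rfl
      exact hA.1 hb

theorem sublist_flatMap_replicate_of_le {β : Type} (A : List ℕ) {n : ℕ} {f : ℕ → β} {ν : ℕ → ℕ}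
    (h : ∀ a ∈ A, ν a ≤ n) : (A.flatMap fun a => List.replicate (ν a) (f a)).Sublist
      (A.flatMap fun a => List.replicate n (f a)) := by
  induction A with
  | nil => simp
  | cons a A ih =>
    rw [List.flatMap_cons, List.flatMap_cons]
    exact ((List.replicate_sublist_replicate _).2 (h a List.mem_cons_self)).append
      (ih fun b hb => h b (List.mem_cons_of_mem _ hb))

theorem sum_map_single (l : List ℕ) (a : ℕ) :
    (l.map fun v => if v = a then (1 : ℤ) else 0).sum = l.count a := by
  induction l with
  | nil => simp
  | cons b l ih =>
    rw [List.map_cons, List.sum_cons, ih, List.count_cons]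
    by_cases h : b = a <;> simp [h]
    ring

theorem sum_map_eq_sum_count {l : List ℕ} {S : Finset ℕ} (h : ∀ a ∈ l, a ∈ S) (g : ℕ → ℤ) :
    (l.map g).sum = ∑ a ∈ S, (l.count a : ℤ) * g a := by
  rw [Finset.sum_list_map_count]
  simp only [nsmul_eq_mul]
  refine Finset.sum_subset (fun a ha => h a (List.mem_toFinset.1 ha)) fun a _ ha => ?_
  rw [List.mem_toFinset] at ha
  simp [List.count_eq_zero_of_not_mem ha]

@[simp] theorem netFlow_append (l l' : List (ℕ × ℕ × ℕ)) (g : ℕ → ℤ) :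
    netFlow (l ++ l') g = netFlow l g + netFlow l' g := by
  simp [netFlow]

@[simp] theorem totalPrice_append (l l' : List (ℕ × ℕ × ℕ)) :
    totalPrice (l ++ l') = totalPrice l + totalPrice l' := by
  simp [totalPrice]

@[simp] theorem netFlow_replicate (n a b p : ℕ) (g : ℕ → ℤ) :
    netFlow (List.replicate n (a, b, p)) g = n * (g b - g a) := by
  simp [netFlow]

@[simp] theorem totalPrice_replicate (n a b : ℕ) :
    totalPrice (List.replicate n (a, b, 0)) = 0 := by
  simp [totalPrice]

theorem netFlow_star (l : List ℕ) (s : ℕ) (g : ℕ → ℤ) :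
    netFlow (l.map fun a => (s, a, 0)) g = (l.map g).sum - l.length * g s := by
  induction l with
  | nil => simp [netFlow]
  | cons a l ih =>
    simp only [netFlow, List.map_cons, List.sum_cons, List.length_cons] at ih ⊢
    rw [ih]
    push_cast
    ring

theorem netFlow_eq (l : List (ℕ × ℕ × ℕ)) (g : ℕ → ℤ) :
    netFlow l g = ((l.map fun e => e.2.1).map g).sum - ((l.map fun e => e.1).map g).sum := by
  induction l with
  | nil => simp [netFlow]
  | cons a l ih =>
    simp only [netFlow, List.map_cons, List.sum_cons] at ih ⊢
    rw [ih]
    ring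

theorem netFlow_flatMap {A : List ℕ} (hA : A.Nodup) (ν : ℕ → ℕ) (r : ℕ) (g : ℕ → ℤ) :
    netFlow (A.flatMap fun a => List.replicate (ν a) (a, r, 0)) g =
      ∑ a ∈ A.toFinset, (ν a : ℤ) * (g r - g a) := by
  rw [List.sum_toFinset _ hA]
  induction A with
  | nil => simp [netFlow]
  | cons a A ih => simp [ih (List.nodup_cons.1 hA).2]

theorem totalPrice_flatMap (A : List ℕ) (ν : ℕ → ℕ) (r : ℕ) :
    totalPrice (A.flatMap fun a => List.replicate (ν a) (a, r, 0)) = 0 := by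
  induction A with
  | nil => rfl
  | cons a A ih => simp [ih]

theorem totalPrice_star (l : List ℕ) (s : ℕ) : totalPrice (l.map fun a => (s, a, 0)) = 0 := by
  simp [totalPrice, Function.comp_def]

/-- A flow that saturates the arcs at the source is a set `W` of exchanges after which `c` has at
least `t` approvals and the other alternatives have fewer: the flow through an alternative is the
number of its approvals, the arcs to the collector `r` admit at most `t - 1` approvals of every
alternative other than `c`, and the arcs from `r` to the sink force `t` approvals of `c` to go to
the sink directly. -/
theorem exists_sublist_iff {s r τ c t B : ℕ} {F A : List ℕ} {E : List (ℕ × ℕ × ℕ)} (hA : A.Nodup)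
    (hF : ∀ a ∈ F, a ∈ A) (hE : ∀ e ∈ E, e.1 ∈ A ∧ e.2.1 ∈ A) (hc : c ∈ A) (hs : s ∉ A)
    (hr : r ∉ A) (hτ : τ ∉ A) (hsr : s ≠ r) (hsτ : s ≠ τ) (hrτ : r ≠ τ) (ht : 0 < t)
    (htF : t ≤ F.length) (hEF : (E.map fun e => e.1).Sublist F) :
    (∃ l, l.Sublist ((F.map fun a => (s, a, 0)) ++ (E ++
      (((A.filter fun a => !(a == c)).flatMap fun a => List.replicate (t - 1) (a, r, 0)) ++
      (List.replicate F.length (c, r, 0) ++ (List.replicate t (c, τ, 0) ++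
      List.replicate (F.length - t) (r, τ, 0)))))) ∧
      (∀ g, netFlow l g = F.length * (g τ - g s)) ∧ totalPrice l ≤ B) ↔
    ∃ W, W.Sublist E ∧ totalPrice W ≤ B ∧
      t + (W.map fun e => e.1).count c ≤ F.count c + (W.map fun e => e.2.1).count c ∧
      ∀ a ∈ A, a ≠ c → F.count a + (W.map fun e => e.2.1).count a <
        t + (W.map fun e => e.1).count a := by
  have hA' : (A.filter fun a => !(a == c)).Nodup := hA.filter _
  have hAc : (A.filter fun a => !(a == c)).toFinset = A.toFinset.erase c := by
    ext a
    simp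
    tauto
  constructor
  · rintro ⟨l, hl, hf, hB⟩
    rw [List.sublist_append_iff] at hl
    obtain ⟨l₁, l, rfl, hl₁, hl⟩ := hl
    rw [List.sublist_append_iff] at hl
    obtain ⟨W, l, rfl, hW, hl⟩ := hl
    rw [List.sublist_append_iff] at hl
    obtain ⟨l₃, l, rfl, hl₃, hl⟩ := hl
    rw [List.sublist_append_iff] at hl
    obtain ⟨l₄, l, rfl, hl₄, hl⟩ := hl
    rw [List.sublist_append_iff] at hl
    obtain ⟨l₅, l₆, rfl, hl₅, hl₆⟩ := hl
    obtain ⟨F', hF', rfl⟩ := List.sublist_map_iff.1 hl₁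
    obtain ⟨ν, hν, rfl⟩ := sublist_flatMap_replicate hA' hl₃
    obtain ⟨p, hp, rfl⟩ := List.sublist_replicate_iff.1 hl₄
    obtain ⟨q, hq, rfl⟩ := List.sublist_replicate_iff.1 hl₅
    obtain ⟨u, hu, rfl⟩ := List.sublist_replicate_iff.1 hl₆
    simp only [netFlow_append, netFlow_star, netFlow_flatMap hA', netFlow_replicate,
      netFlow_eq W, hAc] at hf
    have hout : ∀ {x}, x ∉ A → F'.count x = 0 ∧ (W.map fun e => e.2.1).count x = 0 ∧
        (W.map fun e => e.1).count x = 0 := by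
      intro x hx
      refine ⟨List.count_eq_zero_of_not_mem fun h => hx (hF _ (hF'.subset h)),
        List.count_eq_zero_of_not_mem fun h => ?_, List.count_eq_zero_of_not_mem fun h => ?_⟩
      · obtain ⟨e, he, rfl⟩ := List.mem_map.1 h
        exact hx (hE e (hW.subset he)).2
      · obtain ⟨e, he, rfl⟩ := List.mem_map.1 h
        exact hx (hE e (hW.subset he)).1
    have hne : ∀ {x a}, x ∉ A → a ∈ A → a ≠ x := fun hx ha h => hx (h ▸ ha)
    -- the balance at the source
    have hFF : F' = F := by
      refine hF'.eq_of_length ?_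
      have h := hf fun v => if v = s then 1 else 0
      rw [sum_map_single, sum_map_single, sum_map_single, (hout hs).1, (hout hs).2.1,
        (hout hs).2.2, Finset.sum_eq_zero fun a ha => ?_] at h
      · simp [hsr.symm, hsτ.symm, hne hs hc] at h
        exact h
      · simp only [Finset.mem_erase, List.mem_toFinset] at ha
        simp [hsr.symm, hne hs ha.2]
    subst hFF
    -- the balance at the sink
    have hqu : q + u = F'.length := by
      have h := hf fun v => if v = τ then 1 else 0
      rw [sum_map_single, sum_map_single, sum_map_single, (hout hτ).1, (hout hτ).2.1,
        (hout hτ).2.2, Finset.sum_eq_zero fun a ha => ?_] at h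
      · simp [hrτ, hsτ, hne hτ hc] at h
        lia
      · simp only [Finset.mem_erase, List.mem_toFinset] at ha
        simp [hrτ, hne hτ ha.2]
    refine ⟨W, hW, ?_, ?_, fun a ha hac => ?_⟩
    · simp only [totalPrice_append] at hB
      lia
    · have h := hf fun v => if v = c then 1 else 0
      rw [sum_map_single, sum_map_single, sum_map_single, Finset.sum_eq_zero fun a ha => ?_] at h
      · simp [(hne hr hc).symm, (hne hτ hc).symm, (hne hs hc).symm] at h
        lia
      · simp only [Finset.mem_erase, List.mem_toFinset] at ha
        simp [(hne hr hc).symm, ha.1]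
    · have h := hf fun v => if v = a then 1 else 0
      rw [sum_map_single, sum_map_single, sum_map_single,
        Finset.sum_eq_single a (fun b _ hb => by simp [(hne hr ha).symm, hb])
          (fun h => absurd (by simp [ha, hac]) h)] at h
      simp [(hne hr ha).symm, (hne hτ ha).symm, (hne hs ha).symm, hac.symm] at h
      have := hν a
      lia
  · rintro ⟨W, hW, hB, hcW, haW⟩
    have hle : ∀ a, (W.map fun e => e.1).count a ≤ F.count a := fun a =>
      ((hW.map _).trans hEF).count_le a
    -- the number of approvals after the exchanges
    obtain ⟨ν, hν⟩ : ∃ ν : ℕ → ℕ, ∀ a, ν a + (W.map fun e => e.1).count a =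
        F.count a + (W.map fun e => e.2.1).count a :=
      ⟨fun a => F.count a + (W.map fun e => e.2.1).count a - (W.map fun e => e.1).count a,
        fun a => by have := hle a; lia⟩
    have hsum : ∀ g : ℕ → ℤ, (F.map g).sum + (((W.map fun e => e.2.1).map g).sum -
        ((W.map fun e => e.1).map g).sum) = ∑ a ∈ A.toFinset, (ν a : ℤ) * g a := by
      intro g
      rw [sum_map_eq_sum_count (S := A.toFinset) (by simpa using hF),
        sum_map_eq_sum_count (S := A.toFinset), sum_map_eq_sum_count (S := A.toFinset),
        ← Finset.sum_sub_distrib, ← Finset.sum_add_distrib]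
      · refine Finset.sum_congr rfl fun a _ => ?_
        have : (ν a : ℤ) = F.count a + (W.map fun e => e.2.1).count a -
            (W.map fun e => e.1).count a := by
          have := hν a
          lia
        rw [this]
        ring
      · intro a ha
        obtain ⟨e, he, rfl⟩ := List.mem_map.1 ha
        simpa using (hE e (hW.subset he)).1
      · intro a ha
        obtain ⟨e, he, rfl⟩ := List.mem_map.1 ha
        simpa using (hE e (hW.subset he)).2
    have hN : (∑ a ∈ A.toFinset, (ν a : ℤ)) = F.length := by
      have := hsum fun _ => 1
      simp [Function.comp_def] at this
      exact this.symm
    have hcA : c ∈ A.toFinset := by simpa using hc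
    have hcN : ν c ≤ F.length := by
      have := Finset.single_le_sum (f := fun a => (ν a : ℤ)) (fun a _ => by positivity) hcA
      rw [hN] at this
      exact_mod_cast this
    have htc : t ≤ ν c := by
      have := hν c
      lia
    refine ⟨(F.map fun a => (s, a, 0)) ++ (W ++
      (((A.filter fun a => !(a == c)).flatMap fun a => List.replicate (ν a) (a, r, 0)) ++
      (List.replicate (ν c - t) (c, r, 0) ++ (List.replicate t (c, τ, 0) ++
      List.replicate (F.length - t) (r, τ, 0))))), ?_, fun g => ?_, ?_⟩
    · refine (List.Sublist.refl _).append (hW.append ((sublist_flatMap_replicate_of_le _ ?_).append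
        (((List.replicate_sublist_replicate _).2 (by lia)).append (List.Sublist.refl _))))
      intro a ha
      simp only [List.mem_filter, Bool.not_eq_true', beq_eq_false_iff_ne] at ha
      have h1 := haW a ha.1 ha.2
      have h2 := hν a
      lia
    · simp only [netFlow_append, netFlow_star, netFlow_flatMap hA', netFlow_replicate,
        netFlow_eq W, hAc]
      have h1 := hsum g
      have h2 := Finset.add_sum_erase A.toFinset (fun a => (ν a : ℤ) * (g r - g a)) hcA
      have h3 : ∑ a ∈ A.toFinset, (ν a : ℤ) * (g r - g a) =
          F.length * g r - ∑ a ∈ A.toFinset, (ν a : ℤ) * g a := by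
        rw [← hN, Finset.sum_mul, ← Finset.sum_sub_distrib]
        exact Finset.sum_congr rfl fun a _ => by ring
      push_cast [Nat.cast_sub htc, Nat.cast_sub htF]
      linear_combination h1 + h2 + h3
    · simpa [totalPrice_flatMap, totalPrice_star] using hB

end Bribery

/-! ### The algorithm finds the bribes that exchange approvals -/

namespace Bribery

open Flow LocalBribery

theorem count_map {ι : Type} (l : List ι) (f : ι → ℕ) (a : ℕ) :
    (l.map f).count a = (l.map fun i => if f i = a then 1 else 0).sum := by
  induction l with
  | nil => rfl
  | cons i l ih =>
    rw [List.map_cons, List.count_cons, ih, List.map_cons, List.sum_cons, add_comm]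
    congr 1
    simp

section voter
variable (I : Instance) (i : Fin I.n)

/-- The preference that arises from `σ` by exchanging the last approved alternative and the first
alternative that is not approved. -/
def exchange (σ : Pref I.m) : Pref I.m :=
  σ.trans (Equiv.swap ⟨I.k - 1, by have := I.k_lt; lia⟩ ⟨I.k, I.k_lt⟩)

/-- The profile after a bribe of the voters in `J`. -/
def bribed (J : Finset (Fin I.n)) : Fin I.n → Pref I.m :=
  fun i => if i ∈ J then exchange I (I.profile i) else I.profile i

theorem exchange_val (σ : Pref I.m) (a : Fin I.m) : (exchange I σ a : ℕ) =
    if (σ a : ℕ) = I.k - 1 then I.k else if (σ a : ℕ) = I.k then I.k - 1 else σ a := by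
  simp only [exchange, Equiv.trans_apply, Equiv.swap_apply_def, Fin.ext_iff]
  split_ifs <;> rfl

/-- An exchange costs the last approved alternative its approval, and gives it to the next one. -/
theorem approvalVector_exchange (σ : Pref I.m) (a : Fin I.m) :
    approvalVector I.m I.k (exchange I σ a) + (if (σ a : ℕ) = I.k - 1 then 1 else 0) =
      approvalVector I.m I.k (σ a) + (if (σ a : ℕ) = I.k then 1 else 0) := by
  have := I.k_pos
  simp only [approvalVector, exchange_val]
  split_ifs <;> lia

theorem ranking_voterNats : ranking (I.voterNats i) =
    List.ofFn fun j : Fin I.m => (((I.profile i).symm j : Fin I.m) : ℕ) := rfl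

theorem nodup_ranking : (ranking (I.voterNats i)).Nodup := by
  rw [ranking_voterNats, List.nodup_ofFn]
  exact Fin.val_injective.comp (I.profile i).symm.injective

theorem mem_ranking (a : ℕ) : a ∈ ranking (I.voterNats i) ↔ a < I.m := by
  rw [ranking_voterNats, List.mem_ofFn]
  constructor
  · rintro ⟨j, rfl⟩
    exact Fin.is_lt _
  · intro h
    exact ⟨I.profile i ⟨a, h⟩, by simp⟩

theorem mem_approvals (a : Fin I.m) :
    (a : ℕ) ∈ approvals I.k (I.voterNats i) ↔ (I.profile i a : ℕ) < I.k := by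
  rw [approvals, ranking_voterNats, List.mem_take_iff_getElem]
  constructor
  · rintro ⟨j, hj, h⟩
    rw [List.getElem_ofFn] at h
    rw [← Fin.ext h]
    simp at hj ⊢
    lia
  · intro h
    exact ⟨I.profile i a, by simp [h], by simp⟩

theorem count_approvals (a : Fin I.m) : (approvals I.k (I.voterNats i)).count (a : ℕ) =
    approvalVector I.m I.k (I.profile i a) := by
  have h : (approvals I.k (I.voterNats i)).Nodup :=
    (List.take_sublist _ _).nodup (nodup_ranking I i)
  rw [approvalVector, h.count]
  simp only [mem_approvals]

theorem headD_drop_ranking {j : ℕ} (hj : j < I.m) :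
    ((ranking (I.voterNats i)).drop j).headD 0 = (I.profile i).symm ⟨j, hj⟩ := by
  rw [ranking_voterNats, List.headD_eq_head?_getD, List.head?_drop,
    List.getElem?_eq_getElem (by simpa using hj), List.getElem_ofFn]
  rfl

theorem headD_drop_ranking_eq_iff {j : ℕ} (hj : j < I.m) (a : Fin I.m) :
    ((ranking (I.voterNats i)).drop j).headD 0 = a ↔ (I.profile i a : ℕ) = j := by
  rw [headD_drop_ranking I i hj, ← Fin.ext_iff, Equiv.symm_apply_eq, Fin.ext_iff]
  exact eq_comm

theorem lastIn_mem : lastIn I.k (I.voterNats i) ∈ approvals I.k (I.voterNats i) := by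
  have h1 := I.k_pos
  have h2 := I.k_lt
  rw [lastIn, headD_drop_ranking I i (j := I.k - 1) (by lia), mem_approvals]
  simp
  lia

theorem firstOut_lt : firstOut I.k (I.voterNats i) < I.m := by
  rw [firstOut, headD_drop_ranking I i I.k_lt]
  exact Fin.is_lt _

end voter

section profile
variable (I : Instance)

/-- The voters of an instance. -/
def voters : List Voter := (List.finRange I.n).map I.voterNats

theorem count_allApprovals (a : Fin I.m) : (allApprovals I.k (voters I)).count (a : ℕ) =
    score (approvalVector I.m I.k) I.profile a := by
  rw [allApprovals, voters, List.flatMap_map, List.count_flatMap, score, Fin.sum_univ_def]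
  congr 1
  exact List.map_congr_left fun i _ => count_approvals I i a

theorem mem_allApprovals {a : ℕ} (h : a ∈ allApprovals I.k (voters I)) : a < I.m := by
  simp only [allApprovals, voters, List.mem_flatMap, List.mem_map] at h
  obtain ⟨_, ⟨i, _, rfl⟩, h⟩ := h
  exact (mem_ranking I i a).1 (List.mem_of_mem_take h)

theorem length_le_allApprovals : I.n ≤ (allApprovals I.k (voters I)).length := by
  have h : ∀ l : List (Fin I.n),
      l.length ≤ (l.flatMap fun i => approvals I.k (I.voterNats i)).length := by
    intro l
    induction l with
    | nil => simp
    | cons i l ih =>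
      have := List.length_pos_of_mem (lastIn_mem I i)
      simp only [List.flatMap_cons, List.length_append, List.length_cons]
      lia
  have := h (List.finRange I.n)
  rwa [List.length_finRange, ← List.flatMap_map] at this

theorem exchanges_eq (T : ℕ) : exchanges T I.k (voters I) =
    ((List.finRange I.n).filter fun i => T.ble (I.δ i)).map fun i =>
      (lastIn I.k (I.voterNats i), firstOut I.k (I.voterNats i), I.price i) := by
  rw [exchanges, bribable, voters, List.filter_map, List.map_map]
  rfl

theorem lastIn_sublist (T : ℕ) : ((exchanges T I.k (voters I)).map fun e => e.1).Sublist
    (allApprovals I.k (voters I)) := by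
  rw [exchanges_eq, List.map_map, allApprovals, voters, List.flatMap_map]
  refine (List.filter_sublist.map _).trans ?_
  induction List.finRange I.n with
  | nil => simp
  | cons i l ih =>
    rw [List.map_cons, List.flatMap_cons]
    exact (List.singleton_sublist.2 (lastIn_mem I i)).append ih

/-- The effect of the exchanges on the number of approvals. -/
theorem score_bribed (J : Finset (Fin I.n)) (a : Fin I.m) :
    score (approvalVector I.m I.k) (bribed I J) a +
        ∑ i ∈ J, (if lastIn I.k (I.voterNats i) = a then 1 else 0) =
      score (approvalVector I.m I.k) I.profile a +
        ∑ i ∈ J, (if firstOut I.k (I.voterNats i) = a then 1 else 0) := by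
  have h1 : ∀ i, (lastIn I.k (I.voterNats i) = a ↔ (I.profile i a : ℕ) = I.k - 1) := fun i =>
    headD_drop_ranking_eq_iff I i (by have := I.k_lt; lia) a
  have h2 : ∀ i, (firstOut I.k (I.voterNats i) = a ↔ (I.profile i a : ℕ) = I.k) := fun i =>
    headD_drop_ranking_eq_iff I i I.k_lt a
  simp only [h1, h2]
  rw [score, score, ← Finset.sum_filter_add_sum_filter_not Finset.univ (· ∈ J),
    ← Finset.sum_filter_add_sum_filter_not (s := Finset.univ) (f := fun i =>
      approvalVector I.m I.k (I.profile i a)) (· ∈ J), Finset.filter_univ_mem, add_right_comm,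
    add_right_comm _ _ (∑ i ∈ J, _), ← Finset.sum_add_distrib, ← Finset.sum_add_distrib]
  congr 1
  · refine Finset.sum_congr rfl fun i hi => ?_
    rw [bribed, if_pos hi, approvalVector_exchange]
  · refine Finset.sum_congr rfl fun i hi => ?_
    rw [bribed, if_neg (Finset.mem_filter.1 hi).2]

/-- The algorithm decides, for a positive threshold `t`, whether some voters can be bribed to
exchange two approvals each, so that `c` has at least `t` approvals and the other alternatives have
fewer. -/
theorem decideAt_iff (T : ℕ) {t : ℕ} (ht : 0 < t) (htn : t ≤ I.n) :
    decideAt T I.m I.k I.c I.budget (voters I) t = true ↔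
      ∃ J : Finset (Fin I.n), (∀ i ∈ J, T ≤ I.δ i) ∧ ∑ i ∈ J, I.price i ≤ I.budget ∧
        t ≤ score (approvalVector I.m I.k) (bribed I J) I.c ∧
        ∀ a, a ≠ I.c → score (approvalVector I.m I.k) (bribed I J) a < t := by
  have hn := I.n_pos
  have hlen : (voters I).length = I.n := by simp [voters]
  obtain ⟨A, hA, hAnd, hAm⟩ : ∃ A, ranking ((voters I).headD []) = A ∧ A.Nodup ∧
      ∀ a, a ∈ A ↔ a < I.m := by
    refine ⟨_, rfl, ?_⟩
    have : (voters I).headD [] = I.voterNats ⟨0, hn⟩ := by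
      rw [List.headD_eq_head?_getD, List.head?_eq_getElem?,
        List.getElem?_eq_getElem (by lia)]
      simp [voters]
    rw [this]
    exact ⟨nodup_ranking I _, mem_ranking I _⟩
  have hnet : network T I.m I.k I.c (voters I) t =
      ((allApprovals I.k (voters I)).map fun a => (I.m + 1, a, 0)) ++
      (exchanges T I.k (voters I) ++
      (((A.filter fun a => !(a == (I.c : ℕ))).flatMap fun a =>
        List.replicate (t - 1) (a, I.m, 0)) ++
      (List.replicate (allApprovals I.k (voters I)).length ((I.c : ℕ), I.m, 0) ++
      (List.replicate t ((I.c : ℕ), I.m + 2, 0) ++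
      List.replicate ((allApprovals I.k (voters I)).length - t) (I.m, I.m + 2, 0))))) := by
    have h1 : min (t - 1) I.n = t - 1 := by lia
    have h2 : min t I.n = t := by lia
    simp only [network, hA, List.map_const', List.length_take, List.length_drop, hlen, h1, h2]
  have hkeys : ((numbered (network T I.m I.k I.c (voters I) t)).map Arc.key).Nodup := by
    have : (numbered (network T I.m I.k I.c (voters I) t)).map Arc.key =
        (network T I.m I.k I.c (voters I) t).zipIdx.map Prod.snd := by
      rw [numbered, List.map_map]
      rfl
    rw [this, List.zipIdx_map_snd]
    exact List.nodup_range'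
  have hinit : ∀ e ∈ numbered (network T I.m I.k I.c (voters I) t),
      e.used = false ∧ e.red = e.price := by
    intro e he
    obtain ⟨x, _, rfl⟩ := List.mem_map.1 he
    exact ⟨rfl, rfl⟩
  have hE : ∀ e ∈ exchanges T I.k (voters I), e.1 ∈ A ∧ e.2.1 ∈ A := by
    intro e he
    rw [exchanges_eq] at he
    obtain ⟨i, _, rfl⟩ := List.mem_map.1 he
    rw [hAm, hAm]
    exact ⟨(mem_ranking I i _).1 (List.mem_of_mem_take (lastIn_mem I i)), firstOut_lt I i⟩
  rw [decideAt, Bool.and_eq_true, Nat.ble_eq, solve_spec _ hkeys hinit, exists_flow_numbered_iff,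
    hnet, exists_sublist_iff hAnd (fun a ha => (hAm a).2 (mem_allApprovals I ha)) hE
    ((hAm _).2 I.c.2) (by simp [hAm]) (by simp [hAm]) (by simp [hAm]) (by lia) (by lia) (by lia) ht
    (htn.trans (length_le_allApprovals I)) (lastIn_sublist I T)]
  -- a sublist of the exchanges is a set of voters
  have hz : ∀ z : List (Fin I.n), z.Nodup → ∀ W, W = z.map (fun i =>
        (lastIn I.k (I.voterNats i), firstOut I.k (I.voterNats i), I.price i)) →
      totalPrice W = ∑ i ∈ z.toFinset, I.price i ∧ ∀ a : Fin I.m,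
        score (approvalVector I.m I.k) (bribed I z.toFinset) a +
          (W.map fun e => e.1).count (a : ℕ) =
        (allApprovals I.k (voters I)).count (a : ℕ) + (W.map fun e => e.2.1).count (a : ℕ) := by
    rintro z hz W rfl
    refine ⟨?_, fun a => ?_⟩
    · rw [List.sum_toFinset _ hz, totalPrice, List.map_map]
      rfl
    · rw [List.map_map, List.map_map, count_map, count_map, ← List.sum_toFinset _ hz,
        ← List.sum_toFinset _ hz, count_allApprovals]
      exact score_bribed I z.toFinset a
  constructor
  · rintro ⟨W, hW, hB, hcW, haW⟩
    rw [exchanges_eq] at hW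
    obtain ⟨z, hzs, rfl⟩ := List.sublist_map_iff.1 hW
    obtain ⟨h1, h2⟩ := hz z (hzs.nodup ((List.nodup_finRange _).filter _)) _ rfl
    refine ⟨z.toFinset, fun i hi => ?_, h1 ▸ hB, ?_, fun a ha => ?_⟩
    · have := (List.mem_filter.1 (hzs.subset (List.mem_toFinset.1 hi))).2
      exact Nat.le_of_ble_eq_true this
    · have := h2 I.c
      lia
    · have h3 := h2 a
      have h4 := haW a ((hAm _).2 a.2) fun h => ha (Fin.ext h)
      lia
  · rintro ⟨J, hJ, hB, hc, ha⟩
    have hzJ : ((List.finRange I.n).filter fun i => decide (i ∈ J)).toFinset = J := by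
      ext i
      simp
    obtain ⟨h1, h2⟩ := hz ((List.finRange I.n).filter fun i => decide (i ∈ J))
      ((List.nodup_finRange _).filter _) _ rfl
    rw [hzJ] at h1 h2
    refine ⟨_, ?_, h1 ▸ hB, ?_, fun a haA hac => ?_⟩
    · rw [exchanges_eq]
      refine (List.monotone_filter_right _ fun i hi => ?_).map _
      exact Nat.ble_eq_true_of_le (hJ i (by simpa using hi))
    · have := h2 I.c
      lia
    · have h3 := h2 ⟨a, (hAm a).1 haA⟩
      have h4 := ha ⟨a, (hAm a).1 haA⟩ fun h => hac (congrArg Fin.val h)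
      simp only at h3
      lia

theorem kApproval_eq_singleton_iff {m n : ℕ} (k : ℕ) (P : Fin n → Pref m) (c : Fin m) :
    kApproval k P = {c} ↔ ∀ a, a ≠ c →
      score (approvalVector m k) P a < score (approvalVector m k) P c := by
  constructor
  · intro h a hac
    have hc : c ∈ kApproval k P := by rw [h]; simp
    have ha : a ∉ kApproval k P := by rw [h]; simpa using hac
    simp only [kApproval, scoringWinners, Finset.mem_filter, Finset.mem_univ, true_and] at hc ha
    push Not at ha
    obtain ⟨b, hb⟩ := ha
    exact hb.trans_le (hc b)
  · intro h
    ext a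
    simp only [kApproval, scoringWinners, Finset.mem_filter, Finset.mem_univ, true_and,
      Finset.mem_singleton]
    constructor
    · intro ha
      by_contra hac
      exact absurd (ha c) (not_le.2 (h a hac))
    · rintro rfl b
      rcases eq_or_ne b a with rfl | hb
      · exact le_rfl
      · exact (h b hb).le

theorem toNats_voters : StackProg.chunks (I.m + 2) ((List.finRange I.n).flatMap I.voterNats) =
    voters I := by
  rw [List.flatMap_def]
  refine StackProg.chunks_flatten (by lia) fun l hl => ?_
  obtain ⟨i, _, rfl⟩ := List.mem_map.1 hl
  simp [Instance.voterNats]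

/-- The algorithm decides whether `c` can be made to win alone by exchanges alone. -/
theorem decideNats_iff (T : ℕ) : decideNats T I.toNats = true ↔
    ∃ J : Finset (Fin I.n), (∀ i ∈ J, T ≤ I.δ i) ∧ ∑ i ∈ J, I.price i ≤ I.budget ∧
      kApproval I.k (bribed I J) = {I.c} := by
  have h : decideNats T I.toNats = (voters I).zipIdx.any fun x =>
      decideAt T I.m I.k I.c I.budget (voters I) (x.2 + 1) := by
    rw [← toNats_voters]
    rfl
  have hlen : (voters I).length = I.n := by simp [voters]
  rw [h, List.any_eq_true]
  simp only [kApproval_eq_singleton_iff]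
  constructor
  · rintro ⟨⟨v, j⟩, hx, hd⟩
    have hj := List.mem_zipIdx hx
    obtain ⟨J, h1, h2, h3, h4⟩ := (decideAt_iff I T (by lia) (by simp at hj ⊢; lia)).1 hd
    exact ⟨J, h1, h2, fun a ha => (h4 a ha).trans_le h3⟩
  · rintro ⟨J, h1, h2, h3⟩
    -- the threshold is the number of approvals of `c`
    have hpos : 0 < score (approvalVector I.m I.k) (bribed I J) I.c := by
      have hm : 1 < I.m := by have := I.k_pos; have := I.k_lt; lia
      have : Nontrivial (Fin I.m) := Fin.nontrivial_iff_two_le.2 hm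
      obtain ⟨a, ha⟩ := exists_ne I.c
      exact (Nat.zero_le _).trans_lt (h3 a ha)
    have hle : score (approvalVector I.m I.k) (bribed I J) I.c ≤ I.n := by
      refine (Finset.sum_le_card_nsmul _ _ 1 fun i _ => ?_).trans (by simp)
      unfold approvalVector
      split_ifs <;> simp
    obtain ⟨j, hj⟩ : ∃ j, score (approvalVector I.m I.k) (bribed I J) I.c = j + 1 :=
      ⟨_, (Nat.succ_pred_eq_of_pos hpos).symm⟩
    rw [hj] at hle h3
    refine ⟨((voters I)[j]'(by lia), j), List.mk_mem_zipIdx_iff_getElem?.2 ?_, ?_⟩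
    · exact List.getElem?_eq_getElem _
    · exact (decideAt_iff I T (by lia) hle).2 ⟨J, h1, h2, hj.ge, h3⟩

end profile

end Bribery

/-! ### Bribes within small distances -/

namespace Bribery

open LocalBribery

section pref
variable {m : ℕ} (σ τ : Pref m) (k : ℕ)

/-- The alternatives that are approved in `σ` and not in `τ`. -/
def lost : Finset (Fin m) := Finset.univ.filter fun a => (σ a : ℕ) < k ∧ k ≤ (τ a : ℕ)

theorem mem_lost {a : Fin m} : a ∈ lost σ τ k ↔ (σ a : ℕ) < k ∧ k ≤ (τ a : ℕ) := by
  simp [lost]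

/-- As many alternatives are lost as are gained. -/
theorem card_lost : (lost σ τ k).card = (lost τ σ k).card := by
  have hS : ∀ σ : Pref m, (Finset.univ.filter fun a => (σ a : ℕ) < k).card =
      (Finset.univ.filter fun j : Fin m => (j : ℕ) < k).card := by
    intro σ
    refine Finset.card_bij (fun a _ => σ a) (by simp) (fun a _ b _ h => σ.injective h) ?_
    intro j hj
    exact ⟨σ.symm j, by simpa using hj, by simp⟩
  have h : ∀ σ τ : Pref m, lost σ τ k = (Finset.univ.filter fun a => (σ a : ℕ) < k) \
      Finset.univ.filter fun a => (τ a : ℕ) < k := by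
    intro σ τ
    ext a
    simp [lost]
  rw [h, h]
  exact Finset.card_sdiff_comm ((hS σ).trans (hS τ).symm)

/-- If at most the last approved alternative is lost, and at most the first alternative that is not
approved is gained, the approvals are unchanged or exchanged. -/
theorem eq_or_exchange_of_lost {τ : Pref m}
    (h1 : ∀ a ∈ lost σ τ k, (σ a : ℕ) = k - 1) (h2 : ∀ a ∈ lost τ σ k, (σ a : ℕ) = k) :
    (∀ a, (τ a : ℕ) < k ↔ (σ a : ℕ) < k) ∨ ((lost σ τ k).Nonempty ∧
      ∀ a, (τ a : ℕ) < k ↔ (σ a : ℕ) < k - 1 ∨ (σ a : ℕ) = k) := by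
  rcases (lost σ τ k).eq_empty_or_nonempty with h | h
  · left
    have h' : lost τ σ k = ∅ := by rw [← Finset.card_eq_zero, ← card_lost, h]; simp
    intro a
    have ha := Finset.eq_empty_iff_forall_notMem.1 h a
    have ha' := Finset.eq_empty_iff_forall_notMem.1 h' a
    rw [mem_lost] at ha ha'
    lia
  · right
    refine ⟨h, fun a => ?_⟩
    obtain ⟨x, hx⟩ := h
    obtain ⟨y, hy⟩ : (lost τ σ k).Nonempty := by
      rw [← Finset.card_pos, ← card_lost, Finset.card_pos]
      exact ⟨x, hx⟩
    have hx1 := h1 x hx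
    have hy1 := h2 y hy
    have ha1 := h1 a
    have ha2 := h2 a
    rw [mem_lost] at hx hy ha1 ha2
    rcases eq_or_ne a x with rfl | hax
    · lia
    rcases eq_or_ne a y with rfl | hay
    · lia
    have hax' : (σ a : ℕ) ≠ σ x := fun h => hax (σ.injective (Fin.ext h))
    have hay' : (σ a : ℕ) ≠ σ y := fun h => hay (σ.injective (Fin.ext h))
    lia

theorem exists_gained {a : Fin m} (ha : a ∈ lost σ τ k) : ∃ b, b ∈ lost τ σ k := by
  rw [← Finset.Nonempty, ← Finset.card_pos, ← card_lost, Finset.card_pos]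
  exact ⟨a, ha⟩

/-- The displacements add up to an even number, because the sum of all positions is the same in both
preferences. -/
theorem even_footruleDist : Even (footruleDist σ τ) := by
  have h0 : ∑ a, (((σ a : ℕ) : ℤ) - ((τ a : ℕ) : ℤ)) = 0 := by
    rw [Finset.sum_sub_distrib, Equiv.sum_comp σ (fun j => ((j : ℕ) : ℤ)),
      Equiv.sum_comp τ (fun j => ((j : ℕ) : ℤ)), sub_self]
  have h1 : Even (∑ a, ((displacement σ τ a : ℤ) - (((σ a : ℕ) : ℤ) - ((τ a : ℕ) : ℤ)))) := by
    refine Finset.even_sum _ fun a _ => ?_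
    unfold displacement
    rw [Int.even_iff]
    lia
  rw [Finset.sum_sub_distrib, h0, sub_zero] at h1
  unfold footruleDist
  exact_mod_cast h1

variable {σ τ k}

theorem prefers_of_lost {a b : Fin m} (ha : a ∈ lost σ τ k) (hb : b ∈ lost τ σ k) :
    Prefers σ a b ∧ Prefers τ b a := by
  rw [mem_lost] at ha hb
  unfold Prefers
  rw [Fin.lt_def, Fin.lt_def]
  lia

theorem eq_of_swapDist_le (h : swapDist σ τ ≤ 1) {a b a' b' : Fin m}
    (h1 : Prefers σ a b ∧ Prefers τ b a) (h2 : Prefers σ a' b' ∧ Prefers τ b' a') :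
    a = a' ∧ b = b' := by
  have := Finset.card_le_one.1 h (a, b) (by simpa using h1) (a', b') (by simpa using h2)
  simpa using this

/-- Preferences with swap distance at most one differ by a swap of adjacent alternatives. -/
theorem lost_of_swapDist_le (h : swapDist σ τ ≤ 1) (hk : k < m) :
    (∀ a ∈ lost σ τ k, (σ a : ℕ) = k - 1) ∧ ∀ a ∈ lost τ σ k, (σ a : ℕ) = k := by
  have key : ∀ a b, a ∈ lost σ τ k → b ∈ lost τ σ k → (σ a : ℕ) = k - 1 ∧ (σ b : ℕ) = k := by
    intro a b ha hb
    have hab := prefers_of_lost ha hb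
    have ha' := (mem_lost ..).1 ha
    have hb' := (mem_lost ..).1 hb
    constructor
    · by_contra hne
      -- the last approved alternative gives a second pair of alternatives in different order
      obtain ⟨x, hx⟩ : ∃ x, (σ x : ℕ) = k - 1 := ⟨σ.symm ⟨k - 1, by lia⟩, by simp⟩
      have hax : a ≠ x := fun h => hne (h ▸ hx)
      by_cases hxl : (τ x : ℕ) < k
      · have h2 := eq_of_swapDist_le h hab (a' := a) (b' := x) (by
          unfold Prefers
          rw [Fin.lt_def, Fin.lt_def]
          lia)
        rw [← h2.2] at hx
        lia
      · exact hax (eq_of_swapDist_le h hab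
          (prefers_of_lost ((mem_lost ..).2 (by lia : (σ x : ℕ) < k ∧ k ≤ (τ x : ℕ))) hb)).1
    · by_contra hne
      obtain ⟨y, hy⟩ : ∃ y, (σ y : ℕ) = k := ⟨σ.symm ⟨k, hk⟩, by simp⟩
      have hby : b ≠ y := fun h => hne (h ▸ hy)
      by_cases hyl : (τ y : ℕ) < k
      · exact hby (eq_of_swapDist_le h hab
          (prefers_of_lost ha ((mem_lost ..).2 (by lia : (τ y : ℕ) < k ∧ k ≤ (σ y : ℕ))))).2
      · have h2 := eq_of_swapDist_le h hab (a' := y) (b' := b) (by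
          unfold Prefers
          rw [Fin.lt_def, Fin.lt_def]
          lia)
        rw [← h2.1] at hy
        lia
  constructor
  · intro a ha
    obtain ⟨b, hb⟩ := exists_gained σ τ k ha
    exact (key a b ha hb).1
  · intro b hb
    obtain ⟨a, ha⟩ := exists_gained τ σ k hb
    exact (key a b ha hb).2

theorem lost_of_maxDisplacementDist_le (h : maxDisplacementDist σ τ ≤ 1) :
    (∀ a ∈ lost σ τ k, (σ a : ℕ) = k - 1) ∧ ∀ a ∈ lost τ σ k, (σ a : ℕ) = k := by
  have hd : ∀ a, displacement σ τ a ≤ 1 := fun a => (Finset.le_sup (Finset.mem_univ a)).trans h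
  constructor <;>
  · intro a ha
    have := hd a
    rw [mem_lost] at ha
    unfold displacement at this
    lia

theorem add_displacement_le {a b : Fin m} (hab : a ≠ b) :
    displacement σ τ a + displacement σ τ b ≤ footruleDist σ τ := by
  rw [← Finset.sum_pair hab]
  exact Finset.sum_le_sum_of_subset (Finset.subset_univ _)

theorem footruleDist_le_two (h : footruleDist σ τ ≤ 3) : footruleDist σ τ ≤ 2 := by
  obtain ⟨j, hj⟩ := even_footruleDist σ τ
  lia

theorem two_le_footruleDist_of_lost {a : Fin m} (ha : a ∈ lost σ τ k) :
    2 ≤ footruleDist σ τ := by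
  obtain ⟨b, hb⟩ := exists_gained σ τ k ha
  rw [mem_lost] at ha hb
  have hab : a ≠ b := by
    rintro rfl
    lia
  have := add_displacement_le (σ := σ) (τ := τ) hab
  unfold displacement at this
  lia

theorem lost_of_footruleDist_le (h : footruleDist σ τ ≤ 3) :
    (∀ a ∈ lost σ τ k, (σ a : ℕ) = k - 1) ∧ ∀ a ∈ lost τ σ k, (σ a : ℕ) = k := by
  have h' := footruleDist_le_two h
  have key : ∀ a b, a ∈ lost σ τ k → b ∈ lost τ σ k → (σ a : ℕ) = k - 1 ∧ (σ b : ℕ) = k := by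
    intro a b ha hb
    rw [mem_lost] at ha hb
    have hab : a ≠ b := by
      rintro rfl
      lia
    have := add_displacement_le (σ := σ) (τ := τ) hab
    unfold displacement at this
    lia
  constructor
  · intro a ha
    obtain ⟨b, hb⟩ := exists_gained σ τ k ha
    exact (key a b ha hb).1
  · intro b hb
    obtain ⟨a, ha⟩ := exists_gained τ σ k hb
    exact (key a b ha hb).2

/-- If one alternative is displaced, so is the one that had its new position before. -/
theorem exists_displaced {a : Fin m} (ha : displacement σ τ a ≠ 0) :
    ∃ b, b ≠ a ∧ displacement σ τ b ≠ 0 := by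
  refine ⟨σ.symm (τ a), fun h => ha ?_, fun h => ha ?_⟩
  · have : τ a = σ a := (Equiv.symm_apply_eq σ).1 h
    simp [displacement, this]
  · have h1 : (τ a : ℕ) = τ (σ.symm (τ a)) := by
      unfold displacement at h
      simp at h
      lia
    have h2 : a = σ.symm (τ a) := τ.injective (Fin.ext h1)
    have : τ a = σ a := (Equiv.symm_apply_eq σ).1 h2.symm
    simp [displacement, this]

/-- At most two alternatives are displaced, each by one position. -/
theorem swapDist_le_one_of_footruleDist_le (h : footruleDist σ τ ≤ 3) : swapDist σ τ ≤ 1 := by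
  have h' := footruleDist_le_two h
  have hd : ∀ a, displacement σ τ a ≤ 1 := by
    intro a
    by_contra ha
    obtain ⟨b, hba, hb⟩ := exists_displaced (σ := σ) (τ := τ) (a := a) (by lia)
    have := add_displacement_le (σ := σ) (τ := τ) hba
    lia
  have hpair : ∀ a b, Prefers σ a b ∧ Prefers τ b a →
      a ≠ b ∧ displacement σ τ a = 1 ∧ displacement σ τ b = 1 := by
    rintro a b ⟨h1, h2⟩
    have hab : a ≠ b := by
      rintro rfl
      exact lt_irrefl _ h1
    have ha := hd a
    have hb := hd b
    unfold Prefers at h1 h2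
    rw [Fin.lt_def] at h1 h2
    unfold displacement at *
    exact ⟨hab, by lia, by lia⟩
  have hthree : ∀ a b e, a ≠ b → displacement σ τ a = 1 → displacement σ τ b = 1 →
      displacement σ τ e = 1 → e = a ∨ e = b := by
    intro a b e hab ha hb he
    by_contra! hne
    have : ∑ x ∈ {e, a, b}, displacement σ τ x ≤ footruleDist σ τ :=
      Finset.sum_le_sum_of_subset (Finset.subset_univ _)
    rw [Finset.sum_insert (by simp [hne.1, hne.2]), Finset.sum_pair hab] at this
    lia
  refine Finset.card_le_one.2 ?_
  rintro ⟨a, b⟩ hab ⟨a', b'⟩ hab'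
  simp only [Finset.mem_filter, Finset.mem_univ, true_and] at hab hab'
  obtain ⟨h1, h2, h3⟩ := hpair a b hab
  obtain ⟨h4, h5, h6⟩ := hpair a' b' hab'
  rcases hthree a b a' h1 h2 h3 h5 with rfl | rfl <;>
    rcases hthree _ _ b' h1 h2 h3 h6 with rfl | rfl
  · exact absurd rfl h4
  · rfl
  · exact absurd hab.1 (not_lt.2 (le_of_lt hab'.1))
  · exact absurd rfl h4

end pref

section exchange
variable (I : Instance) (σ : Pref I.m)

theorem displacement_exchange (a : Fin I.m) : displacement σ (exchange I σ) a =
    if (σ a : ℕ) = I.k - 1 ∨ (σ a : ℕ) = I.k then 1 else 0 := by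
  have := I.k_pos
  rw [displacement, exchange_val]
  split_ifs <;> lia

theorem maxDisplacementDist_exchange : maxDisplacementDist σ (exchange I σ) ≤ 1 := by
  refine Finset.sup_le fun a _ => ?_
  rw [displacement_exchange]
  split_ifs <;> simp

theorem footruleDist_exchange : footruleDist σ (exchange I σ) ≤ 2 := by
  have hk := I.k_lt
  simp only [footruleDist, displacement_exchange]
  rw [Finset.sum_boole]
  have h : (Finset.univ.filter fun a : Fin I.m => (σ a : ℕ) = I.k - 1 ∨ (σ a : ℕ) = I.k) ⊆
      {σ.symm ⟨I.k - 1, by lia⟩, σ.symm ⟨I.k, hk⟩} := by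
    intro a ha
    simpa [Equiv.eq_symm_apply, Fin.ext_iff] using ha
  exact (Finset.card_le_card h).trans Finset.card_le_two

theorem swapDist_exchange : swapDist σ (exchange I σ) ≤ 1 :=
  swapDist_le_one_of_footruleDist_le ((footruleDist_exchange I σ).trans (by simp))

end exchange

/-- The algorithm is correct for a distance function if the changes within the distances allowed
leave the approvals as they are or exchange two alternatives that are adjacent at the boundary, and
the distance `T` is the least distance that permits the exchange. -/
theorem decideNats_iff_isYes {d : ∀ {m : ℕ}, Pref m → Pref m → ℕ} (T : ℕ) (I : Instance)
    (h1 : ∀ i, T ≤ I.δ i → d (I.profile i) (exchange I (I.profile i)) ≤ I.δ i)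
    (h2 : ∀ i (Q : Pref I.m), d (I.profile i) Q ≤ I.δ i →
      (∀ a ∈ lost (I.profile i) Q I.k, (I.profile i a : ℕ) = I.k - 1) ∧
      (∀ a ∈ lost Q (I.profile i) I.k, (I.profile i a : ℕ) = I.k) ∧
      ((lost (I.profile i) Q I.k).Nonempty → T ≤ I.δ i)) :
    decideNats T I.toNats = true ↔ IsYes d I := by
  classical
  rw [decideNats_iff]
  constructor
  · rintro ⟨J, hJ, hB, hw⟩
    exact ⟨J, fun i => exchange I (I.profile i), hB, fun i hi => h1 i (hJ i hi), hw⟩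
  · rintro ⟨J, Q, hB, hQ, hw⟩
    -- only the voters whose approvals change are bribed
    refine ⟨J.filter fun i => (lost (I.profile i) (Q i) I.k).Nonempty, fun i hi => ?_, ?_, ?_⟩
    · rw [Finset.mem_filter] at hi
      exact (h2 i (Q i) (hQ i hi.1)).2.2 hi.2
    · exact (Finset.sum_le_sum_of_subset (Finset.filter_subset _ _)).trans hB
    · rw [kApproval_eq_singleton_iff] at hw ⊢
      have hk := I.k_pos
      have hs : ∀ a, score (approvalVector I.m I.k) (bribed I (J.filter fun i =>
          (lost (I.profile i) (Q i) I.k).Nonempty)) a = score (approvalVector I.m I.k)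
          (fun i => if i ∈ J then Q i else I.profile i) a := by
        intro a
        refine Finset.sum_congr rfl fun i _ => ?_
        by_cases hi : i ∈ J
        · obtain ⟨h3, h4, -⟩ := h2 i (Q i) (hQ i hi)
          by_cases hne : (lost (I.profile i) (Q i) I.k).Nonempty
          · rcases eq_or_exchange_of_lost _ _ h3 h4 with h | ⟨-, h⟩
            · obtain ⟨x, hx⟩ := hne
              rw [mem_lost, ← h x] at hx
              lia
            · simp only [bribed, Finset.mem_filter, hi, hne, and_self, if_true, approvalVector,
                exchange_val, h]
              split_ifs <;> lia
          · rcases eq_or_exchange_of_lost _ _ h3 h4 with h | ⟨h, -⟩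
            · simp only [bribed, Finset.mem_filter, hi, hne, and_false, if_true, if_false,
                approvalVector, h]
            · exact absurd h hne
        · simp only [bribed, Finset.mem_filter, hi, false_and, if_false]
      intro a ha
      rw [hs, hs]
      exact hw a ha

end Bribery

theorem mainTheorem2 :
    LocalBribery.PolyTimeSolvable LocalBribery.Instance.encode
      (fun I => ∀ i, I.δ i = 1) (LocalBribery.IsYes LocalBribery.swapDist) ∧
    LocalBribery.PolyTimeSolvable LocalBribery.Instance.encode
      (fun I => ∀ i, I.δ i = 1) (LocalBribery.IsYes LocalBribery.maxDisplacementDist) ∧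
    LocalBribery.PolyTimeSolvable LocalBribery.Instance.encode
      (fun I => ∀ i, I.δ i ≤ 3) (LocalBribery.IsYes LocalBribery.footruleDist) ∧
    (∀ (m : ℕ) (σ τ : LocalBribery.Pref m),
      LocalBribery.footruleDist σ τ ≤ 3 → LocalBribery.swapDist σ τ ≤ 1) := by
  refine ⟨Bribery.polyTimeSolvable_of_decideNats 1 fun I hI => ?_,
    Bribery.polyTimeSolvable_of_decideNats 1 fun I hI => ?_,
    -- an exchange has footrule distance two
    Bribery.polyTimeSolvable_of_decideNats 2 fun I hI => ?_,
    fun m σ τ => Bribery.swapDist_le_one_of_footruleDist_le⟩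
  · refine Bribery.decideNats_iff_isYes 1 I (fun i _ => ?_) fun i Q hQ => ?_
    · rw [hI i]
      exact Bribery.swapDist_exchange I _
    · rw [hI i] at hQ ⊢
      obtain ⟨h1, h2⟩ := Bribery.lost_of_swapDist_le hQ I.k_lt
      exact ⟨h1, h2, fun _ => le_rfl⟩
  · refine Bribery.decideNats_iff_isYes 1 I (fun i _ => ?_) fun i Q hQ => ?_
    · rw [hI i]
      exact Bribery.maxDisplacementDist_exchange I _
    · rw [hI i] at hQ ⊢
      obtain ⟨h1, h2⟩ := Bribery.lost_of_maxDisplacementDist_le hQ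
      exact ⟨h1, h2, fun _ => le_rfl⟩
  · refine Bribery.decideNats_iff_isYes 2 I (fun i hi => ?_) fun i Q hQ => ?_
    · exact (Bribery.footruleDist_exchange I _).trans hi
    · obtain ⟨h1, h2⟩ := Bribery.lost_of_footruleDist_le (hQ.trans (hI i))
      exact ⟨h1, h2, fun ⟨a, ha⟩ => (Bribery.two_le_footruleDist_of_lost ha).trans hQ⟩
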